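/- **Setting.** Let $f:\mathbb R^p\to\mathbb R$ be differentiable and $l_f$-Lipschitz with $L_f$-Lipschitz gradient; let every $g_\xi:\mathbb R^d\to\mathbb R^p$ be differentiable and $l_g$-Lipschitz with $L_g$-Lipschitz Jacobian matrix $g_\xi'$ (matrices carry the Euclidean, i.e. Frobenius, norm); let $r:\mathbb R^d\to\mathbb R$ be convex. Put $F=f\circ g$, $\Phi=F+r$ and assume $\Phi^*=\inf\Phi>-\infty$, where either $(\Sigma^1)$ $g=\frac1n\sum_{i=1}^n g_i$ with $n\ge1$, or $(\mathbb E^1)$ $g(x)=\mathbb E_\xi g_\xi(x)$, in which case moreover $\mathbb E\|g_\xi(x)-g(x)\|^2\le\sigma_g^2$ and $\mathbb E\|g'_\xi(x)-g'(x)\|^2\le\sigma_{g'}^2$ for all $x$, with $\sigma_g,\sigma_{g'}>0$. Let $L_F=l_g^2L_f+l_fL_g$, $G_0=2(l_g^4L_f^2+l_f^2L_g^2)$, $\sigma_0^2=2(l_g^2L_f^2\sigma_g^2+l_f^2\sigma_{g'}^2)$, $\mathrm{prox}_{\lambda r}(x)=\arg\min_y\{r(y)+\frac1{2\lambda}\|y-x\|^2\}$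 and $\mathcal G_\lambda(x)=\frac1\lambda\big(x-\mathrm{prox}_{\lambda r}(x-\lambda\nabla F(x))\big)$. **Algorithm (MVRC-1 with constant momentum).** Let $\alpha\in(0,1]$, let $$0<\beta\le\Big(4\sqrt{(1+1/\alpha)^2L_F^2+3G_0}+4(1+1/\alpha)L_F\Big)^{-1}$$ (no upper bound if the bracket is $0$), and let $\lambda_t\in[\beta,(1+\alpha)\beta]$ for all $t$. Start with $y_0=x_0$. For $t=0,\dots,T-1$ set $z_t=(1-\alpha)y_t+\alpha x_t$ and take a batch $\mathcal A_t$. If $t\bmod\tau=0$, set $\widetilde g_t=\frac1{|\mathcal A_t|}\sum_{\xi\in\mathcal A_t}g_\xi(z_t)$ and $\widetilde g_t'=\frac1{|\mathcal A_t|}\sum_{\xi\in\mathcal A_t}g'_\xi(z_t)$; otherwise set $\widetilde g_t=\widetilde g_{t-1}+\frac1{|\mathcal A_t|}\sum_{\xi\in\mathcal A_t}(g_\xi(z_t)-g_\xi(z_{t-1}))$ and $\widetilde g'_t=\widetilde g'_{t-1}+\frac1{|\mathcal A_t|}\sum_{\xi\in\mathcal A_t}(g'_\xi(z_t)-g'_\xi(z_{t-1}))$.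 Then set $x_{t+1}=\mathrm{prox}_{\lambda_tr}\big(x_t-\lambda_t\widetilde g_t'^{\top}\nabla f(\widetilde g_t)\big)$ and $y_{t+1}=z_t+\frac{\beta}{\lambda_t}(x_{t+1}-x_t)$. All batches are independent. The output is $z_\zeta$, with $\zeta$ uniform on $\{0,\dots,T-1\}$ and independent of the batches. The number of evaluations of component maps $g_\xi$ and component Jacobians $g_\xi'$ is the sample complexity. **Theorem.** There is a universal constant $C>0$ such that, with $\Delta=\Phi(x_0)-\Phi^*$, the following holds. 1. $(\Sigma^1)$ Let $\tau=\lfloor\sqrt n\rfloor$; let $\mathcal A_t=\{1,\dots,n\}$ if $t\bmod\tau=0$, and let $\mathcal A_t$ be a uniformly random subset of $\{1,\dots,n\}$ of size $\lfloor\sqrt n\rfloor$ otherwise. Then for every $T\ge1$ $$\mathbb E\|\mathcal G_{\lambda_\zeta}(z_\zeta)\|^2\le C\,\frac{1/\alpha+1}{T\beta}\,\Delta .$$ Moreover, for every $\epsilon>0$ there is a $T\ge1$ such that $\mathbb E\|\mathcal G_{\lambda_\zeta}(z_\zeta)\|\le\epsilon$ with at most $C\big(n+\frac{(1/\alpha+1)\Delta}{\beta}\sqrt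 n\,\epsilon^{-2}\big)$ evaluations, i.e. $\mathcal O(n+\sqrt n\,\epsilon^{-2})$ for fixed $\alpha,\beta,\Delta$. 2. $(\mathbb E^1)$ Let $0<\epsilon\le\sqrt{2\sigma_0^2}$, $\tau=\lfloor\sqrt{2\sigma_0^2\epsilon^{-2}}\rfloor$, and let $\mathcal A_t$ consist of i.i.d. samples of $\xi$, $\lceil2\sigma_0^2\epsilon^{-2}\rceil$ many if $t\bmod\tau=0$ and $\lfloor\sqrt{2\sigma_0^2\epsilon^{-2}}\rfloor$ many otherwise. Then for every $T\ge1$ $$\mathbb E\|\mathcal G_{\lambda_\zeta}(z_\zeta)\|^2\le C\Big(\frac1\alpha+1\Big)\Big(\epsilon^2+\frac{\Delta}{T\beta}\Big).$$ Moreover, for every $0<\epsilon\le\sqrt{2\sigma_0^2}$ there are $\delta\in(0,\epsilon]$ and $T\ge1$ such that the algorithm, with $\tau$ and $|\mathcal A_t|$ chosen for $\delta$ in place of $\epsilon$, achieves $\mathbb E\|\mathcal G_{\lambda_\zeta}(z_\zeta)\|\le\epsilon$ with at most $C(1/\alpha+1)^{3/2}\sigma_0\big(\sigma_0^2+\frac{\Delta}{\beta}\big)\epsilon^{-3}$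 evaluations, i.e. $\mathcal O(\epsilon^{-3})$ for fixed $\alpha,\beta,\sigma_0,\Delta$. -/

import Mathlib

open MeasureTheory ProbabilityTheory

namespace MVRC

/-- The Euclidean space of dimension `d`. -/
abbrev E (d : ℕ) : Type := EuclideanSpace ℝ (Fin d)

/-- The Jacobian matrix of a map between Euclidean spaces. -/
noncomputable def jacobian {d p : ℕ} (g : E d → E p) (x : E d) : Matrix (Fin p) (Fin d) ℝ :=
  Matrix.of fun i j => fderiv ℝ g x (EuclideanSpace.single j 1) i

/-- The smooth part `F = f ∘ g` of the objective. -/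
def smoothPart {d p : ℕ} (f : E p → ℝ) (g : E d → E p) : E d → ℝ := fun x => f (g x)

/-- The objective `Φ = f ∘ g + r`. -/
def objective {d p : ℕ} (f : E p → ℝ) (g : E d → E p) (r : E d → ℝ) : E d → ℝ :=
  fun x => smoothPart f g x + r x

/-- The proximal mapping: a minimizer over `y` of `r y + ‖y - x‖ ^ 2 / (2 * lam)`. For convex `r`
and `lam > 0` the minimizer exists and is unique. -/
noncomputable def prox {d : ℕ} (lam : ℝ) (r : E d → ℝ) (x : E d) : E d :=
  Classical.epsilon fun y => IsMinOn (fun w => r w + 1 / (2 * lam) * ‖w - x‖ ^ 2) Set.univ y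

/-- The generalized gradient mapping of `F + r` with parameter `lam`. -/
noncomputable def gradMapping {d : ℕ} (lam : ℝ) (r F : E d → ℝ) (x : E d) : E d :=
  lam⁻¹ • (x - prox lam r (x - lam • gradient F x))

/-- The mean map of a finite family `g_1, …, g_n`. -/
noncomputable def finiteMean {d p n : ℕ} (g : Fin n → E d → E p) : E d → E p :=
  fun x => (n : ℝ)⁻¹ • ∑ i, g i x

/-- The mean map of a random family, for `ξ` with law `μ`. -/
noncomputable def onlineMean {d p : ℕ} {Ξ : Type*} [MeasurableSpace Ξ] (μ : Measure Ξ)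
    (g : Ξ → E d → E p) : E d → E p :=
  fun x => ∫ ξ, g ξ x ∂μ

section Assumptions

/- The norm of a (Jacobian) matrix is the Euclidean, that is, Frobenius norm. -/
attribute [local instance] Matrix.frobeniusNormedAddCommGroup

/-- Smoothness, Lipschitz continuity, convexity and lower boundedness; `gbar` is the mean map. -/
structure SmoothnessAssumption {d p : ℕ} {Ξ : Type*} (f : E p → ℝ) (g : Ξ → E d → E p)
    (gbar : E d → E p) (r : E d → ℝ) (lf Lf lg Lg : NNReal) : Prop where
  f_diff : Differentiable ℝ f
  f_lipschitz : LipschitzWith lf f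
  f_smooth : LipschitzWith Lf (gradient f)
  g_diff : ∀ ξ, Differentiable ℝ (g ξ)
  g_lipschitz : ∀ ξ, LipschitzWith lg (g ξ)
  g_smooth : ∀ ξ x y, ‖jacobian (g ξ) x - jacobian (g ξ) y‖ ≤ Lg * ‖x - y‖
  r_convex : ConvexOn ℝ Set.univ r
  bddBelow : BddBelow (Set.range (objective f gbar r))

/-- In the online problem `g ξ x` is a random vector with a mean, and `g` and its Jacobian have
bounded variance. -/
structure VarianceAssumption {d p : ℕ} {Ξ : Type*} [MeasurableSpace Ξ] (μ : Measure Ξ)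
    (g : Ξ → E d → E p) (sg sg' : ℝ) : Prop where
  measurable : ∀ x, Measurable fun ξ => g ξ x
  integrable : ∀ x, Integrable (fun ξ => g ξ x) μ
  sg_pos : 0 < sg
  sg'_pos : 0 < sg'
  variance_g : ∀ x, ∫⁻ ξ, ‖g ξ x - onlineMean μ g x‖ₑ ^ 2 ∂μ ≤ ENNReal.ofReal (sg ^ 2)
  variance_jacobian : ∀ x,
    ∫⁻ ξ, ‖jacobian (g ξ) x - jacobian (onlineMean μ g) x‖ₑ ^ 2 ∂μ ≤ ENNReal.ofReal (sg' ^ 2)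

end Assumptions

/-- `L_F = l_g² L_f + l_f L_g`. -/
noncomputable def constLF (lf Lf lg Lg : ℝ) : ℝ := lg ^ 2 * Lf + lf * Lg

/-- `G_0 = 2 (l_g⁴ L_f² + l_f² L_g²)`. -/
noncomputable def constG0 (lf Lf lg Lg : ℝ) : ℝ := 2 * (lg ^ 4 * Lf ^ 2 + lf ^ 2 * Lg ^ 2)

/-- `σ_0² = 2 (l_g² L_f² σ_g² + l_f² σ_{g'}²)` for the online problem. -/
noncomputable def sigmaSq (lf Lf lg sg sg' : ℝ) : ℝ :=
  2 * (lg ^ 2 * Lf ^ 2 * sg ^ 2 + lf ^ 2 * sg' ^ 2)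

/-- Constant momentum `α ∈ (0, 1]`, step size
`β ≤ (4 √((1 + 1/α)² L_F² + 3 G_0) + 4 (1 + 1/α) L_F)⁻¹` (without a division, so that the bound is
void when all Lipschitz constants vanish), and `lam t ∈ [β, (1 + α) β]`. -/
structure ConstantMomentum (LF G0 α β : ℝ) (lam : ℕ → ℝ) : Prop where
  α_pos : 0 < α
  α_le_one : α ≤ 1
  β_pos : 0 < β
  β_le : β * (4 * √((1 + α⁻¹) ^ 2 * LF ^ 2 + 3 * G0) + 4 * (1 + α⁻¹) * LF) ≤ 1
  lam_mem : ∀ t, lam t ∈ Set.Icc β ((1 + α) * β)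

section Algorithm

variable {d p : ℕ} {Ξ : Type*}

/-- The average of `h` over a batch `A` (samples may occur repeatedly in it). -/
noncomputable def batchMean {V : Type*} [AddCommGroup V] [Module ℝ V] (A : Multiset Ξ)
    (h : Ξ → V) : V :=
  (A.card : ℝ)⁻¹ • (A.map h).sum

/-- The memory of the algorithm at the start of iteration `t`: `x_t`, `y_t`, the point `z_{t-1}`,
the estimates of `g` and `g'` at that point, and the number of evaluations of component maps
`g_ξ` and of component Jacobians `g_ξ'` made so far. -/
structure State (d p : ℕ) where
  x : E d
  y : E d
  zPrev : E d
  gEst : E p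
  jacEst : Matrix (Fin p) (Fin d) ℝ
  evals : ℕ

/-- Initially `y_0 = x_0`; the entries `zPrev`, `gEst`, `jacEst` are placeholders, which are
overwritten in iteration `0` before they are read. -/
noncomputable def initState (x0 : E d) : State d p := ⟨x0, x0, x0, 0, 0, 0⟩

/-- The extrapolated point `z_t = (1 - α_{t+1}) y_t + α_{t+1} x_t`. -/
noncomputable def extrapolate (α : ℕ → ℝ) (t : ℕ) (S : State d p) : E d :=
  (1 - α (t + 1)) • S.y + α (t + 1) • S.x

/-- Iteration `t` of the algorithm with the batch `A`. -/
noncomputable def step (f : E p → ℝ) (g : Ξ → E d → E p) (r : E d → ℝ) (τ : ℕ)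
    (α β lam : ℕ → ℝ) (t : ℕ) (A : Multiset Ξ) (S : State d p) : State d p :=
  let z := extrapolate α t S
  let gEst := if t % τ = 0 then batchMean A (fun ξ => g ξ z)
    else S.gEst + batchMean A (fun ξ => g ξ z - g ξ S.zPrev)
  let jacEst := if t % τ = 0 then batchMean A (fun ξ => jacobian (g ξ) z)
    else S.jacEst + batchMean A (fun ξ => jacobian (g ξ) z - jacobian (g ξ) S.zPrev)
  let v : E d := WithLp.toLp 2 (jacEst.transpose.mulVec (gradient f gEst).ofLp)
  let x := prox (lam t) r (S.x - lam t • v)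
  { x := x
    y := z + (β t / lam t) • (x - S.x)
    zPrev := z
    gEst := gEst
    jacEst := jacEst
    evals := S.evals + if t % τ = 0 then 2 * A.card else 4 * A.card }

/-- The state of the algorithm after `t` iterations with the batches `A 0, A 1, …`. -/
noncomputable def iterate (f : E p → ℝ) (g : Ξ → E d → E p) (r : E d → ℝ) (τ : ℕ)
    (α β lam : ℕ → ℝ) (x0 : E d) (A : ℕ → Multiset Ξ) : ℕ → State d p
  | 0 => initState x0
  | t + 1 => step f g r τ α β lam t (A t) (iterate f g r τ α β lam x0 A t)

/-- The point `z_t` that the algorithm computes in iteration `t`. -/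
noncomputable def zIter (f : E p → ℝ) (g : Ξ → E d → E p) (r : E d → ℝ) (τ : ℕ)
    (α β lam : ℕ → ℝ) (x0 : E d) (A : ℕ → Multiset Ξ) (t : ℕ) : E d :=
  extrapolate α t (iterate f g r τ α β lam x0 A t)

end Algorithm

section Sampling

variable {Ω : Type*} [MeasurableSpace Ω]

/-- The samples of a run of `T` iterations for the finite-sum problem with `τ = ⌊√n⌋`: the batch
of iteration `t` is the full index set if `t mod τ = 0`, and otherwise a uniformly random subset of
size `⌊√n⌋`; the batches are independent, and the output index `ζ` is uniform on `{0, …, T-1}` and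
independent of the batches. -/
structure FiniteSumSampling (P : Measure Ω) (n T : ℕ) (A : ℕ → Ω → Finset (Fin n))
    (ζ : Ω → Fin T) : Prop where
  full : ∀ t < T, t % Nat.sqrt n = 0 → ∀ ω, A t ω = Finset.univ
  measurable : ∀ t < T, ∀ s, MeasurableSet {ω | A t ω = s}
  uniform : ∀ t < T, t % Nat.sqrt n ≠ 0 → ∀ s : Finset (Fin n), s.card = Nat.sqrt n →
    P {ω | A t ω = s} = ((n.choose (Nat.sqrt n) : ℕ) : ENNReal)⁻¹
  indep : iIndepFun (fun t : Fin T => A t) P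
  output_measurable : Measurable ζ
  output_uniform : ∀ t, P {ω | ζ ω = t} = (T : ENNReal)⁻¹
  output_indep : IndepFun ζ (fun ω (t : Fin T) => A t ω) P

/-- The epoch length `⌊√(2 σ_0² ε⁻²)⌋` of the online problem. -/
noncomputable def onlineEpoch (s0sq ε : ℝ) : ℕ := ⌊√(2 * s0sq / ε ^ 2)⌋₊

/-- The batch sizes of the online problem: `⌈2 σ_0² ε⁻²⌉` if `t mod τ = 0`, and
`⌊√(2 σ_0² ε⁻²)⌋` otherwise. -/
noncomputable def onlineBatchSize (s0sq ε : ℝ) (t : ℕ) : ℕ :=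
  if t % onlineEpoch s0sq ε = 0 then ⌈2 * s0sq / ε ^ 2⌉₊ else ⌊√(2 * s0sq / ε ^ 2)⌋₊

/-- The samples of a run of `T` iterations for the online problem with batch sizes `m t`: all
samples `ξ t i` are independent with law `μ`, and the output index `ζ` is uniform on
`{0, …, T-1}` and independent of the samples. -/
structure OnlineSampling {Ξ : Type*} [MeasurableSpace Ξ] (P : Measure Ω) (μ : Measure Ξ)
    (m : ℕ → ℕ) (T : ℕ) (ξ : (t : ℕ) → Fin (m t) → Ω → Ξ) (ζ : Ω → Fin T) : Prop where
  measurable : ∀ t < T, ∀ i, Measurable (ξ t i)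
  law : ∀ t < T, ∀ i, P.map (ξ t i) = μ
  indep : iIndepFun (fun q : (t : Fin T) × Fin (m t) => ξ q.1 q.2) P
  output_measurable : Measurable ζ
  output_uniform : ∀ t, P {ω | ζ ω = t} = (T : ENNReal)⁻¹
  output_indep : IndepFun ζ (fun ω (q : (t : Fin T) × Fin (m t)) => ξ q.1 q.2 ω) P

/-- The batches of the finite-sum problem for the outcome `ω`. -/
def finiteBatch {n : ℕ} (A : ℕ → Ω → Finset (Fin n)) (ω : Ω) (t : ℕ) : Multiset (Fin n) :=
  (A t ω).val

/-- The batches of the online problem for the outcome `ω`. -/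
def onlineBatch {Ξ : Type*} {m : ℕ → ℕ} (ξ : (t : ℕ) → Fin (m t) → Ω → Ξ) (ω : Ω) (t : ℕ) :
    Multiset Ξ :=
  (Finset.univ : Finset (Fin (m t))).val.map fun i => ξ t i ω

end Sampling

end MVRC

/-! The proof joins a pathwise energy argument to a variance estimate; the coupling quantity is the
total squared step. Write s_t = x_{t+1} - x_t, e_t = y_t - x_t and δ_t = v_t - ∇F(z_t), where v_t is
the gradient estimate in use.

Pathwise part. Since 0 ≤ 1 - β/λ_t ≤ α, the momentum gap satisfies ‖e_{t+1}‖ ≤ (1-α)‖e_t‖ + α‖s_t‖.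
Convexity of the square and telescoping from e_0 = 0 give Σ‖e_t‖² ≤ Σ‖s_t‖², because the factor α
cancels. Extrapolation therefore costs no more than the steps themselves. Optimality of the proximal
point and the descent inequality for F yield (1/4)Σ‖s_t‖² ≤ βΔ + 2β²Σ‖δ_t‖² (`sum_norm_step_sq_le`).
Moreover Σ‖z_{t+1} - z_t‖² ≤ (17/8)Σ‖s_t‖², and nonexpansiveness of the proximal map gives β²Σ‖G‖² ≤
15Σ‖s_t‖² + 3β²Σ‖δ_t‖² for the gradient mapping G at z_t (`sum_norm_gradMapping_sq_le`).

Stochastic part. Inside an epoch the error of a recursive estimator grows by a fluctuation that is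
centred given the past, with mean square at most (l²/τ)‖z_t - z_{t-1}‖². Orthogonality makes these
contributions add (`UnbiasedBatches.error_le`), and each increment is counted at most τ times
(`sum_epoch_le`). Applied to g and to its Jacobian, this bounds the expected total gradient error by
T c + G_0 Σ E‖z_{t+1} - z_t‖², where c is the error after a refresh.

Since β²G_0 ≤ 1/48, the feedback through the increments is absorbed, and `convergence_rate` gives
112Δ/(Tβ) + 227c. Here c = 0 for the finite sum, and c = ε²/2 is admissible online. This rate
contains no 1/α; the factors with 1/α in the theorem are at least 1, and α matters only through the
admissible β. For the complexity, refreshes of size about s² every s iterations and batches of size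
s otherwise cost O(s² + sT). -/

namespace MVRC

/-! ### The proximal map of a convex function. -/

section Prox

variable {d : ℕ} {r : E d → ℝ} {lam : ℝ}

/-- A convex function falls at most linearly away from `x`, so the quadratic term wins outside a
large ball, and compactness supplies a minimizer inside. Existence is all that the choice in `prox`
requires; uniqueness plays no role. -/
theorem exists_prox_minimizer (hr : ConvexOn ℝ Set.univ r) (hlam : 0 < lam) (x : E d) :
    ∃ y, IsMinOn (fun w => r w + 1 / (2 * lam) * ‖w - x‖ ^ 2) Set.univ y := by
  have hrc : Continuous r := hr.locallyLipschitz.continuous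
  have hc : Continuous fun w => r w + 1 / (2 * lam) * ‖w - x‖ ^ 2 := by fun_prop
  obtain ⟨q, hq, hqmin⟩ := (isCompact_closedBall x 1).exists_isMinOn
    ⟨x, Metric.mem_closedBall_self zero_le_one⟩ hrc.continuousOn
  have hqx : r q ≤ r x := hqmin (Metric.mem_closedBall_self zero_le_one)
  -- For `ρ ≥ R` the possible linear decrease `ρ * (r x - r q)` is at most `ρ ^ 2 / (2 * lam)`. The
  -- `1` ensures that the segment from `x` to an outer point meets the unit sphere around `x`, where
  -- `r q` is a lower bound.
  set R := max 1 (2 * lam * (r x - r q)) with hR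
  have hR1 : 1 ≤ R := le_max_left _ _
  obtain ⟨y, hy, hymin⟩ := (isCompact_closedBall x R).exists_isMinOn
    ⟨x, Metric.mem_closedBall_self (by linarith)⟩ hc.continuousOn
  have hyx : r y + 1 / (2 * lam) * ‖y - x‖ ^ 2 ≤ r x := by
    have := hymin (Metric.mem_closedBall_self (by linarith) : x ∈ Metric.closedBall x R)
    simpa using this
  refine ⟨y, fun w _ => ?_⟩
  by_cases hw : w ∈ Metric.closedBall x R
  · exact hymin hw
  · refine hyx.trans ?_
    set ρ := ‖w - x‖ with hρ
    have hρR : R < ρ := by simpa [Metric.mem_closedBall, dist_eq_norm] using hw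
    have hρ1 : 1 ≤ ρ := hR1.trans hρR.le
    have hρ0 : 0 < ρ := by linarith
    have hp : x + ρ⁻¹ • (w - x) ∈ Metric.closedBall x 1 := by
      simp [Metric.mem_closedBall, dist_eq_norm, norm_smul, abs_of_pos hρ0, ← hρ,
        inv_mul_cancel₀ hρ0.ne']
    have h1 : r q ≤ r (x + ρ⁻¹ • (w - x)) := hqmin hp
    have h2 : r (x + ρ⁻¹ • (w - x)) ≤ (1 - ρ⁻¹) * r x + ρ⁻¹ * r w := by
      have := hr.2 (Set.mem_univ x) (Set.mem_univ w)
        (sub_nonneg.2 (inv_le_one_of_one_le₀ hρ1)) (inv_nonneg.2 hρ0.le) (by ring)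
      have e : (1 - ρ⁻¹) • x + ρ⁻¹ • w = x + ρ⁻¹ • (w - x) := by module
      rwa [e] at this
    have h3 : ρ * r q ≤ (ρ - 1) * r x + r w := by
      have := mul_le_mul_of_nonneg_left (h1.trans h2) hρ0.le
      have e : ρ * ((1 - ρ⁻¹) * r x + ρ⁻¹ * r w) = (ρ - 1) * r x + r w := by
        field_simp
      linarith
    have h4 : 2 * lam * (r x - r q) ≤ ρ := (le_max_right _ _).trans hρR.le
    have h5 : ρ * (r x - r q) ≤ 1 / (2 * lam) * ρ ^ 2 := by
      rw [div_mul_eq_mul_div, le_div_iff₀ (by positivity)]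
      nlinarith
    simp only
    linarith

theorem isMinOn_prox (hr : ConvexOn ℝ Set.univ r) (hlam : 0 < lam) (x : E d) :
    IsMinOn (fun w => r w + 1 / (2 * lam) * ‖w - x‖ ^ 2) Set.univ (prox lam r x) :=
  Classical.epsilon_spec (exists_prox_minimizer hr hlam x)

/-- The first-order optimality condition of the proximal mapping. -/
theorem prox_variational (hr : ConvexOn ℝ Set.univ r) (hlam : 0 < lam) (u w : E d) :
    r (prox lam r u) + lam⁻¹ * inner ℝ (u - prox lam r u) (w - prox lam r u) ≤ r w := by
  set q := prox lam r u with hq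
  -- Minimality of `q` against `q + θ • (w - q)`, divided by `θ`; the claim is the limit `θ → 0`.
  have key : ∀ θ : ℝ, 0 < θ → θ ≤ 1 →
      0 ≤ (r w - r q - lam⁻¹ * inner ℝ (u - q) (w - q)) + θ * (1 / (2 * lam) * ‖w - q‖ ^ 2) := by
    intro θ h0 h1
    have hmin := isMinOn_prox hr hlam u (Set.mem_univ (q + θ • (w - q)))
    simp only [Set.mem_ofPred_eq, ← hq] at hmin
    have hconv : r (q + θ • (w - q)) ≤ (1 - θ) * r q + θ * r w := by
      have := hr.2 (Set.mem_univ q) (Set.mem_univ w) (sub_nonneg.2 h1) h0.le (by ring)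
      have e : (1 - θ) • q + θ • w = q + θ • (w - q) := by module
      rwa [e] at this
    have hn : ‖q + θ • (w - q) - u‖ ^ 2
        = ‖q - u‖ ^ 2 - 2 * θ * inner ℝ (u - q) (w - q) + θ ^ 2 * ‖w - q‖ ^ 2 := by
      have e : q + θ • (w - q) - u = (q - u) + θ • (w - q) := by abel
      rw [e, norm_add_sq_real, norm_smul, inner_smul_right, ← neg_sub u q, inner_neg_left, mul_pow,
        Real.norm_eq_abs, sq_abs]
      ring
    rw [hn] at hmin
    have hl : lam⁻¹ = 2 * (1 / (2 * lam)) := by field_simp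
    rw [hl]
    by_contra hcon
    push Not at hcon
    nlinarith [mul_neg_of_pos_of_neg h0 hcon]
  by_contra hcon
  push Not at hcon
  set a := r w - r q - lam⁻¹ * inner ℝ (u - q) (w - q) with ha
  set b := 1 / (2 * lam) * ‖w - q‖ ^ 2 with hb
  have hb0 : 0 ≤ b := by positivity
  have ha0 : a < 0 := by linarith
  have hpos : 0 < -a + 2 * b + 1 := by linarith
  -- An explicit small `θ` replaces the limit: here `θ * b ≤ -a / 2`, so `a + θ * b ≤ a / 2 < 0`.
  have := key (-a / (-a + 2 * b + 1)) (div_pos (by linarith) hpos)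
    ((div_le_one hpos).2 (by linarith))
  have e : -a / (-a + 2 * b + 1) * b ≤ -a / 2 := by
    rw [div_mul_eq_mul_div, div_le_iff₀ hpos]
    nlinarith
  linarith

/-- Adding the variational inequalities at `u` and `v` cancels `r` and leaves ‖p - q‖² ≤ ⟨u - v, p -
q⟩; Cauchy–Schwarz finishes. -/
theorem norm_prox_sub_le (hr : ConvexOn ℝ Set.univ r) (hlam : 0 < lam) (u v : E d) :
    ‖prox lam r u - prox lam r v‖ ≤ ‖u - v‖ := by
  have h1 := prox_variational hr hlam u (prox lam r v)
  have h2 := prox_variational hr hlam v (prox lam r u)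
  set p := prox lam r u
  set q := prox lam r v
  have h3 : lam⁻¹ * (inner ℝ (u - p) (q - p) + inner ℝ (v - q) (p - q)) ≤ 0 := by linarith
  have h4 : inner ℝ (u - p) (q - p) + inner ℝ (v - q) (p - q) ≤ 0 := by
    by_contra h
    push Not at h
    have := mul_pos (inv_pos.2 hlam) h
    linarith
  have h5 : inner ℝ (u - p) (q - p) + inner ℝ (v - q) (p - q)
      = ‖p - q‖ ^ 2 - inner ℝ (u - v) (p - q) := by
    rw [← real_inner_self_eq_norm_sq, ← neg_sub p q, inner_neg_right, ← sub_eq_neg_add,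
      ← inner_sub_left, ← inner_sub_left]
    congr 1
    abel
  have h6 := real_inner_le_norm (u - v) (p - q)
  by_contra h
  push Not at h
  nlinarith [norm_nonneg (u - v), norm_nonneg (p - q)]

theorem continuous_prox (hr : ConvexOn ℝ Set.univ r) (hlam : 0 < lam) :
    Continuous (prox lam r) := by
  refine (LipschitzWith.of_dist_le_mul (K := 1) fun u v => ?_).continuous
  simpa [dist_eq_norm] using norm_prox_sub_le hr hlam u v

end Prox

/-! ### Averages over batches. -/

section BatchMean

variable {Ξ V : Type*}

theorem batchMean_sub [AddCommGroup V] [Module ℝ V] (A : Multiset Ξ) (h k : Ξ → V) :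
    batchMean A (fun ξ => h ξ - k ξ) = batchMean A h - batchMean A k := by
  simp [batchMean, Multiset.sum_map_sub, smul_sub]

theorem map_batchMean {W : Type*} [AddCommGroup V] [Module ℝ V] [AddCommGroup W] [Module ℝ W]
    (L : V →ₗ[ℝ] W) (A : Multiset Ξ) (h : Ξ → V) :
    L (batchMean A h) = batchMean A (fun ξ => L (h ξ)) := by
  simp [batchMean, map_multiset_sum]

/-- An empty batch has mean `0`, whence `0 ≤ K`; the bound is then uniform over all multisets. -/
theorem norm_batchMean_le [NormedAddCommGroup V] [NormedSpace ℝ V] (A : Multiset Ξ) {h : Ξ → V}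
    {K : ℝ} (hK : 0 ≤ K) (hh : ∀ ξ, ‖h ξ‖ ≤ K) : ‖batchMean A h‖ ≤ K := by
  rw [batchMean, norm_smul, norm_inv, Real.norm_natCast]
  rcases Nat.eq_zero_or_pos A.card with h0 | h0
  · simpa [h0] using hK
  · rw [inv_mul_le_iff₀ (by positivity)]
    have h1 : ∀ B : Multiset Ξ, ‖(B.map h).sum‖ ≤ B.card * K := by
      intro B
      induction B using Multiset.induction with
      | empty => simp
      | cons a B ih =>
        simp only [Multiset.map_cons, Multiset.sum_cons, Multiset.card_cons, Nat.cast_add,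
          Nat.cast_one]
        linarith [norm_add_le (h a) (B.map h).sum, hh a]
    exact h1 A

theorem lipschitzWith_batchMean [NormedAddCommGroup V] [NormedSpace ℝ V] {X : Type*}
    [SeminormedAddCommGroup X] (A : Multiset Ξ) {h : Ξ → X → V} {K : NNReal}
    (hh : ∀ ξ, LipschitzWith K (h ξ)) : LipschitzWith K fun z => batchMean A fun ξ => h ξ z := by
  refine LipschitzWith.of_dist_le_mul fun x y => ?_
  rw [dist_eq_norm, ← batchMean_sub]
  refine norm_batchMean_le A (by positivity) fun ξ => ?_
  simpa [dist_eq_norm] using (hh ξ).dist_le_mul x y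

end BatchMean

/-! ### Jacobians as Euclidean vectors, gradients and the chain rule. -/

section Jacobian

variable {d p : ℕ}

/-- A matrix as a vector of entries; the Euclidean norm of the vector is the Frobenius norm of the
matrix. -/
def matVec : Matrix (Fin p) (Fin d) ℝ →ₗ[ℝ] EuclideanSpace ℝ (Fin p × Fin d) where
  toFun M := WithLp.toLp 2 fun q => M q.1 q.2
  map_add' _ _ := rfl
  map_smul' _ _ := rfl

theorem matVec_apply (M : Matrix (Fin p) (Fin d) ℝ) (q : Fin p × Fin d) :
    matVec M q = M q.1 q.2 := rfl

/-- The Jacobian matrix as a vector of entries. -/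
noncomputable def jacVec (g : E d → E p) (x : E d) : EuclideanSpace ℝ (Fin p × Fin d) :=
  matVec (jacobian g x)

theorem norm_matVec_sq (M : Matrix (Fin p) (Fin d) ℝ) :
    ‖matVec M‖ ^ 2 = ∑ i, ∑ j, M i j ^ 2 := by
  rw [EuclideanSpace.norm_sq_eq, Fintype.sum_prod_type]
  simp [matVec_apply]

section
attribute [local instance] Matrix.frobeniusNormedAddCommGroup

theorem frobenius_norm_eq (M : Matrix (Fin p) (Fin d) ℝ) : ‖M‖ = ‖matVec M‖ := by
  rw [Matrix.frobenius_norm_def, ← Real.sqrt_eq_rpow, ← Real.sqrt_sq (norm_nonneg (matVec M)),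
    norm_matVec_sq]
  simp

theorem frobenius_enorm_eq (M : Matrix (Fin p) (Fin d) ℝ) : ‖M‖ₑ = ‖matVec M‖ₑ := by
  rw [← ofReal_norm, ← ofReal_norm, frobenius_norm_eq]

theorem SmoothnessAssumption.lipschitzWith_jacVec {Ξ : Type*} {f : E p → ℝ} {g : Ξ → E d → E p}
    {gbar : E d → E p} {r : E d → ℝ} {lf Lf lg Lg : NNReal}
    (H : SmoothnessAssumption f g gbar r lf Lf lg Lg) (ξ : Ξ) :
    LipschitzWith Lg (jacVec (g ξ)) := by
  refine LipschitzWith.of_dist_le_mul fun x y => ?_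
  have := H.g_smooth ξ x y
  rwa [frobenius_norm_eq, map_sub, ← dist_eq_norm, ← dist_eq_norm] at this

theorem VarianceAssumption.variance_jacVec {Ξ : Type*} [MeasurableSpace Ξ] {μ : Measure Ξ}
    {g : Ξ → E d → E p} {sg sg' : ℝ} (H : VarianceAssumption μ g sg sg') (x : E d) :
    ∫⁻ ξ, ‖jacVec (g ξ) x - jacVec (onlineMean μ g) x‖ₑ ^ 2 ∂μ ≤ ENNReal.ofReal (sg' ^ 2) := by
  have := H.variance_jacobian x
  simpa only [frobenius_enorm_eq, map_sub, jacVec] using this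
end

/-- The transpose of a matrix applied to a vector. -/
noncomputable def transposeMul (M : Matrix (Fin p) (Fin d) ℝ) (u : E p) : E d :=
  WithLp.toLp 2 (M.transpose.mulVec u.ofLp)

theorem transposeMul_sub_left (M N : Matrix (Fin p) (Fin d) ℝ) (u : E p) :
    transposeMul (M - N) u = transposeMul M u - transposeMul N u := by
  simp [transposeMul, Matrix.sub_mulVec]

theorem transposeMul_sub_right (M : Matrix (Fin p) (Fin d) ℝ) (u v : E p) :
    transposeMul M (u - v) = transposeMul M u - transposeMul M v := by
  simp [transposeMul, Matrix.mulVec_sub]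

theorem norm_transposeMul_le (M : Matrix (Fin p) (Fin d) ℝ) (u : E p) :
    ‖transposeMul M u‖ ≤ ‖matVec M‖ * ‖u‖ := by
  refine le_of_sq_le_sq ?_ (by positivity)
  rw [mul_pow, norm_matVec_sq, EuclideanSpace.norm_sq_eq, EuclideanSpace.norm_sq_eq u,
    Finset.sum_comm, Finset.sum_mul]
  refine Finset.sum_le_sum fun j _ => ?_
  simp only [transposeMul, Matrix.mulVec, dotProduct, Matrix.transpose_apply, Real.norm_eq_abs,
    sq_abs]
  exact Finset.sum_mul_sq_le_sq_mul_sq _ _ _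

theorem inner_transposeMul_jacobian (g : E d → E p) (x w : E d) (u : E p) :
    inner ℝ (transposeMul (jacobian g x) u) w = inner ℝ u (fderiv ℝ g x w) := by
  have hw : w = ∑ j, w j • EuclideanSpace.single j (1 : ℝ) := by
    ext i
    simp [Finset.sum_apply, Pi.single_apply]
  have h1 : ∀ i, (fderiv ℝ g x w) i = ∑ j, jacobian g x i j * w j := by
    intro i
    conv_lhs => rw [hw, map_sum]
    simp [jacobian, mul_comm]
  simp only [PiLp.inner_apply, transposeMul, Matrix.mulVec, dotProduct, h1,
    RCLike.inner_apply, conj_trivial, Matrix.transpose_apply]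
  simp only [Finset.mul_sum, Finset.sum_mul]
  rw [Finset.sum_comm]
  refine Finset.sum_congr rfl fun i _ => Finset.sum_congr rfl fun j _ => ?_
  ring

/-- Pairing the vector with itself brings in the operator norm of the derivative, which is at most
`l`. The Frobenius norm would introduce a dimension factor and spoil `constLF`. -/
theorem norm_transposeMul_jacobian_le {g : E d → E p} {l : NNReal} (hg : LipschitzWith l g)
    (x : E d) (u : E p) : ‖transposeMul (jacobian g x) u‖ ≤ l * ‖u‖ := by
  set w := transposeMul (jacobian g x) u with hw
  have h1 : ‖w‖ ^ 2 ≤ ‖u‖ * (l * ‖w‖) := by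
    rw [← real_inner_self_eq_norm_sq, hw, inner_transposeMul_jacobian, ← hw]
    refine (real_inner_le_norm _ _).trans ?_
    gcongr
    exact (ContinuousLinearMap.le_opNorm _ _).trans
      (by gcongr; exact norm_fderiv_le_of_lipschitz ℝ hg)
  by_contra h
  push Not at h
  have hl : 0 ≤ (l : ℝ) * ‖u‖ := by positivity
  nlinarith

/-- A crude, dimension-dependent bound that serves boundedness and integrability only and never
enters the rate. -/
theorem norm_jacVec_le {g : E d → E p} {l : NNReal} (hg : LipschitzWith l g) (x : E d) :
    ‖jacVec g x‖ ≤ √(p * d * l ^ 2) := by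
  refine Real.le_sqrt_of_sq_le ?_
  rw [jacVec, norm_matVec_sq]
  have : ∀ i j, jacobian g x i j ^ 2 ≤ (l : ℝ) ^ 2 := by
    intro i j
    rw [← sq_abs]
    gcongr
    have h1 : |jacobian g x i j| ≤ ‖fderiv ℝ g x (EuclideanSpace.single j 1)‖ :=
      PiLp.norm_apply_le (fderiv ℝ g x (EuclideanSpace.single j 1)) i
    refine h1.trans ((ContinuousLinearMap.le_opNorm _ _).trans ?_)
    simpa using norm_fderiv_le_of_lipschitz ℝ hg
  refine (Finset.sum_le_sum fun i _ => Finset.sum_le_sum fun j _ => this i j).trans ?_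
  simp [mul_assoc]

theorem gradient_comp_eq {f : E p → ℝ} {g : E d → E p} (hf : Differentiable ℝ f)
    (hg : Differentiable ℝ g) (x : E d) :
    gradient (smoothPart f g) x = transposeMul (jacobian g x) (gradient f (g x)) := by
  refine ext_inner_right ℝ fun w => ?_
  rw [inner_transposeMul_jacobian, gradient, gradient, InnerProductSpace.toDual_symm_apply,
    InnerProductSpace.toDual_symm_apply]
  have : fderiv ℝ (smoothPart f g) x = (fderiv ℝ f (g x)).comp (fderiv ℝ g x) :=
    fderiv_comp x (hf _) (hg _)
  rw [this]
  rfl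

theorem norm_gradient_le {f : E p → ℝ} {l : NNReal} (hf : LipschitzWith l f) (u : E p) :
    ‖gradient f u‖ ≤ l := by
  rw [gradient, LinearIsometryEquiv.norm_map]
  exact norm_fderiv_le_of_lipschitz ℝ hf

/-- The descent inequality of a function with Lipschitz gradient. -/
theorem le_add_inner_gradient {F : E d → ℝ} {L : NNReal} (hF : Differentiable ℝ F)
    (hL : LipschitzWith L (gradient F)) (x y : E d) :
    F y ≤ F x + inner ℝ (gradient F x) (y - x) + L * ‖y - x‖ ^ 2 := by
  have hgrad : ∀ z w, inner ℝ (gradient F z) w = fderiv ℝ F z w := by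
    intro z w
    rw [gradient, InnerProductSpace.toDual_symm_apply]
  have hd : ∀ z ∈ segment ℝ x y, ‖fderiv ℝ F z - fderiv ℝ F x‖ ≤ L * ‖y - x‖ := by
    intro z hz
    have h1 : ‖fderiv ℝ F z - fderiv ℝ F x‖ = ‖gradient F z - gradient F x‖ := by
      rw [gradient, gradient, ← map_sub, LinearIsometryEquiv.norm_map]
    rw [h1, ← dist_eq_norm]
    refine (hL.dist_le_mul z x).trans ?_
    gcongr
    rw [dist_comm, dist_eq_norm, ← norm_neg, neg_sub]
    obtain ⟨a, b, ha, hb, hab, rfl⟩ := hz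
    have : a • x + b • y - x = b • (y - x) := by
      rw [← eq_sub_iff_add_eq] at hab
      subst hab
      module
    rw [this, norm_smul, Real.norm_of_nonneg hb]
    exact mul_le_of_le_one_left (norm_nonneg _) (by linarith)
  -- The mean value inequality on the segment gives the coefficient `L` instead of `L / 2`; the step
  -- size leaves room for this.
  have := (convex_segment x y).norm_image_sub_le_of_norm_fderiv_le' (𝕜 := ℝ)
    (fun z _ => hF z) hd (left_mem_segment ℝ x y) (right_mem_segment ℝ x y)
  have h2 := (le_abs_self _).trans this
  rw [hgrad]
  nlinarith

end Jacobian

/-! ### Gradient of the composition: estimation error and Lipschitz constant. -/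

section Composite

variable {d p : ℕ} {Ξ : Type*} {f : E p → ℝ} {gbar : E d → E p} {lf Lf lg Lg : NNReal}

/-- The error of a chain-rule gradient estimate in terms of the errors of its two ingredients. -/
theorem norm_gradient_estimate_sub_le (hf : Differentiable ℝ f) (hfl : LipschitzWith lf f)
    (hfs : LipschitzWith Lf (gradient f)) (hg : Differentiable ℝ gbar)
    (hgl : LipschitzWith lg gbar) (J : Matrix (Fin p) (Fin d) ℝ) (u : E p) (z : E d) :
    ‖transposeMul J (gradient f u) - gradient (smoothPart f gbar) z‖
      ≤ lf * ‖matVec J - jacVec gbar z‖ + lg * Lf * ‖u - gbar z‖ := by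
  rw [gradient_comp_eq hf hg]
  -- Only the Jacobian error is measured in Frobenius norm, against ‖∇f‖ ≤ `lf`; the true Jacobian
  -- acts with operator norm at most `lg`.
  have e : transposeMul J (gradient f u) - transposeMul (jacobian gbar z) (gradient f (gbar z))
      = transposeMul (J - jacobian gbar z) (gradient f u)
        + transposeMul (jacobian gbar z) (gradient f u - gradient f (gbar z)) := by
    rw [transposeMul_sub_left, transposeMul_sub_right]
    abel
  rw [e]
  refine (norm_add_le _ _).trans (add_le_add ?_ ?_)
  · refine (norm_transposeMul_le _ _).trans ?_
    rw [map_sub, ← jacVec, mul_comm]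
    gcongr
    exact norm_gradient_le hfl u
  · refine (norm_transposeMul_jacobian_le hgl _ _).trans ?_
    rw [mul_assoc]
    gcongr
    simpa [dist_eq_norm] using hfs.dist_le_mul u (gbar z)

theorem norm_gradient_estimate_sub_sq_le (hf : Differentiable ℝ f) (hfl : LipschitzWith lf f)
    (hfs : LipschitzWith Lf (gradient f)) (hg : Differentiable ℝ gbar)
    (hgl : LipschitzWith lg gbar) (J : Matrix (Fin p) (Fin d) ℝ) (u : E p) (z : E d) :
    ‖transposeMul J (gradient f u) - gradient (smoothPart f gbar) z‖ ^ 2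
      ≤ 2 * lf ^ 2 * ‖matVec J - jacVec gbar z‖ ^ 2 + 2 * (lg ^ 2 * Lf ^ 2) * ‖u - gbar z‖ ^ 2 := by
  have h := norm_gradient_estimate_sub_le hf hfl hfs hg hgl J u z
  have h2 := pow_le_pow_left₀ (norm_nonneg _) h 2
  nlinarith [sq_nonneg (lf * ‖matVec J - jacVec gbar z‖ - lg * Lf * ‖u - gbar z‖)]

/-- The exact data at `x` are regarded as an inexact estimate at `y` in
`norm_gradient_estimate_sub_le`. -/
theorem lipschitzWith_gradient_smoothPart (hf : Differentiable ℝ f) (hfl : LipschitzWith lf f)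
    (hfs : LipschitzWith Lf (gradient f)) (hg : Differentiable ℝ gbar)
    (hgl : LipschitzWith lg gbar) (hgs : LipschitzWith Lg (jacVec gbar)) :
    LipschitzWith (lg ^ 2 * Lf + lf * Lg) (gradient (smoothPart f gbar)) := by
  refine LipschitzWith.of_dist_le_mul fun x y => ?_
  rw [dist_eq_norm, gradient_comp_eq hf hg x]
  refine (norm_gradient_estimate_sub_le hf hfl hfs hg hgl _ _ y).trans ?_
  have h1 := hgs.dist_le_mul x y
  have h2 := hgl.dist_le_mul x y
  rw [dist_eq_norm, jacVec] at h1
  rw [dist_eq_norm] at h2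
  push_cast
  have h3 := mul_le_mul_of_nonneg_left h1 lf.coe_nonneg
  have h4 := mul_le_mul_of_nonneg_left h2 (mul_nonneg lg.coe_nonneg Lf.coe_nonneg)
  calc _ ≤ _ := add_le_add h3 h4
    _ = _ := by ring

end Composite

/-! ### Pathwise analysis of the proximal momentum method. -/

section Trajectory

variable {d : ℕ}

/-- The recursion of the proximal momentum method with search directions `v t`. -/
structure Trajectory (r : E d → ℝ) (α β : ℝ) (lam : ℕ → ℝ) (x y z v : ℕ → E d) : Prop where
  init : y 0 = x 0
  extrapolate : ∀ t, z t = (1 - α) • y t + α • x t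
  prox_step : ∀ t, x (t + 1) = prox (lam t) r (x t - lam t • v t)
  momentum : ∀ t, y (t + 1) = z t + (β / lam t) • (x (t + 1) - x t)

variable {r F : E d → ℝ} {LF G0 α β : ℝ} {lam : ℕ → ℝ} {x y z v : ℕ → E d}

theorem ConstantMomentum.lam_pos (H : ConstantMomentum LF G0 α β lam) (t : ℕ) : 0 < lam t :=
  H.β_pos.trans_le (H.lam_mem t).1

theorem ConstantMomentum.lam_le (H : ConstantMomentum LF G0 α β lam) (t : ℕ) :
    lam t ≤ 2 * β := by
  have := (H.lam_mem t).2
  nlinarith [H.α_le_one, H.β_pos]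

/-- The window for `lam t` is made for this: β/λ ≥ 1/(1+α) ≥ 1-α, so the weight `1 - β / lam t` of
the step in the momentum gap is at most `α`. -/
theorem ConstantMomentum.ratio_mem (H : ConstantMomentum LF G0 α β lam) (t : ℕ) :
    1 - α ≤ β / lam t ∧ β / lam t ≤ 1 := by
  have h := H.lam_mem t
  have h0 := H.lam_pos t
  refine ⟨?_, (div_le_one h0).2 h.1⟩
  rw [le_div_iff₀ h0]
  nlinarith [mul_le_mul_of_nonneg_left h.2 (sub_nonneg.2 H.α_le_one),
    mul_nonneg H.β_pos.le (sq_nonneg α)]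

/-- As `1 + α⁻¹ ≥ 2`, the root and the linear term in the step-size bound each contribute 4 · 2 to
the factor 16. -/
theorem ConstantMomentum.β_mul_LF_le (H : ConstantMomentum LF G0 α β lam) (hL : 0 ≤ LF)
    (hG : 0 ≤ G0) : 16 * (β * LF) ≤ 1 := by
  have ha : 1 ≤ α⁻¹ := (one_le_inv₀ H.α_pos).2 H.α_le_one
  have h1 : (1 + α⁻¹) * LF ≤ √((1 + α⁻¹) ^ 2 * LF ^ 2 + 3 * G0) := by
    refine Real.le_sqrt_of_sq_le ?_
    rw [mul_pow]
    linarith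
  have h2 : 2 * LF ≤ (1 + α⁻¹) * LF := by nlinarith
  have h3 : β * (16 * LF) ≤ β * (4 * √((1 + α⁻¹) ^ 2 * LF ^ 2 + 3 * G0) + 4 * (1 + α⁻¹) * LF) :=
    mul_le_mul_of_nonneg_left (by nlinarith) H.β_pos.le
  linarith [H.β_le]

/-- Keeping only `3 * G0` under the root and squaring gives 16 · 3 = 48. -/
theorem ConstantMomentum.β_sq_mul_G0_le (H : ConstantMomentum LF G0 α β lam) (hL : 0 ≤ LF)
    (hG : 0 ≤ G0) : 48 * (β ^ 2 * G0) ≤ 1 := by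
  have ha : 1 ≤ α⁻¹ := (one_le_inv₀ H.α_pos).2 H.α_le_one
  have h1 : √(3 * G0) ≤ √((1 + α⁻¹) ^ 2 * LF ^ 2 + 3 * G0) :=
    Real.sqrt_le_sqrt (by nlinarith [mul_nonneg (sq_nonneg (1 + α⁻¹)) (sq_nonneg LF)])
  have h2 : 0 ≤ 4 * (1 + α⁻¹) * LF := by positivity
  have h3 : β * (4 * √(3 * G0)) ≤ 1 :=
    (mul_le_mul_of_nonneg_left (by linarith) H.β_pos.le).trans H.β_le
  have h4 : 0 ≤ β * (4 * √(3 * G0)) := by have := H.β_pos; positivity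
  have h5 : (β * (4 * √(3 * G0))) ^ 2 ≤ 1 := pow_le_one₀ h4 h3
  rw [mul_pow, mul_pow, Real.sq_sqrt (by positivity)] at h5
  linarith

namespace Trajectory

variable (HT : Trajectory r α β lam x y z v) (H : ConstantMomentum LF G0 α β lam)
include HT H

theorem norm_extrapolate_sub_le (t : ℕ) : ‖z t - x t‖ ≤ ‖y t - x t‖ := by
  have e : z t - x t = (1 - α) • (y t - x t) := by rw [HT.extrapolate]; module
  rw [e, norm_smul, Real.norm_of_nonneg (sub_nonneg.2 H.α_le_one)]
  exact mul_le_of_le_one_left (norm_nonneg _) (by linarith [H.α_pos])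

/-- The new gap is `(1 - α)` times the old one minus at most `α` times the step, hence bounded in
norm by a convex combination; the square is convex. -/
theorem norm_sub_succ_sq_le (t : ℕ) :
    ‖y (t + 1) - x (t + 1)‖ ^ 2 ≤ (1 - α) * ‖y t - x t‖ ^ 2 + α * ‖x (t + 1) - x t‖ ^ 2 := by
  have hr := H.ratio_mem t
  have e : y (t + 1) - x (t + 1)
      = (1 - α) • (y t - x t) - (1 - β / lam t) • (x (t + 1) - x t) := by
    rw [HT.momentum, HT.extrapolate]; module
  have h1 : ‖y (t + 1) - x (t + 1)‖ ≤ (1 - α) * ‖y t - x t‖ + α * ‖x (t + 1) - x t‖ := by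
    rw [e]
    refine (norm_sub_le _ _).trans ?_
    rw [norm_smul, norm_smul, Real.norm_of_nonneg (sub_nonneg.2 H.α_le_one),
      Real.norm_of_nonneg (sub_nonneg.2 hr.2)]
    gcongr
    linarith
  have h2 := pow_le_pow_left₀ (norm_nonneg _) h1 2
  have h3 : 0 ≤ α * (1 - α) := mul_nonneg H.α_pos.le (sub_nonneg.2 H.α_le_one)
  nlinarith [mul_nonneg h3 (sq_nonneg (‖y t - x t‖ - ‖x (t + 1) - x t‖))]

/-- Contraction and forcing in `norm_sub_succ_sq_le` carry the same factor `α`. It cancels after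
telescoping from `y 0 = x 0`, which keeps 1/α out of the rate. -/
theorem sum_norm_sub_sq_le (T : ℕ) :
    ∑ t ∈ Finset.range T, ‖y t - x t‖ ^ 2 ≤ ∑ t ∈ Finset.range T, ‖x (t + 1) - x t‖ ^ 2 := by
  have key : α * ∑ t ∈ Finset.range T, ‖y t - x t‖ ^ 2 + ‖y T - x T‖ ^ 2
      ≤ α * ∑ t ∈ Finset.range T, ‖x (t + 1) - x t‖ ^ 2 := by
    induction T with
    | zero => simp [HT.init]
    | succ T ih =>
      rw [Finset.sum_range_succ, Finset.sum_range_succ]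
      linarith [HT.norm_sub_succ_sq_le H T]
  refine le_of_mul_le_mul_left ?_ H.α_pos
  linarith [sq_nonneg ‖y T - x T‖]

/-- The step enters with a coefficient in [0, 1] and the gap with α(1-α) ≤ 1/4; then (a + b/4)² ≤
2a² + b²/8. -/
theorem norm_extrapolate_succ_sub_sq_le (t : ℕ) :
    ‖z (t + 1) - z t‖ ^ 2 ≤ 2 * ‖x (t + 1) - x t‖ ^ 2 + 1 / 8 * ‖y t - x t‖ ^ 2 := by
  have hr := H.ratio_mem t
  have h01 : 0 ≤ 1 - α := sub_nonneg.2 H.α_le_one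
  have e : z (t + 1) - z t = (1 - (1 - α) * (1 - β / lam t)) • (x (t + 1) - x t)
      - (α * (1 - α)) • (y t - x t) := by
    rw [HT.extrapolate (t + 1), HT.momentum, HT.extrapolate t]; module
  have h0 : 0 ≤ (1 - α) * (1 - β / lam t) := mul_nonneg h01 (sub_nonneg.2 hr.2)
  have h0' : (1 - α) * (1 - β / lam t) ≤ 1 :=
    mul_le_one₀ (by linarith [H.α_pos]) (sub_nonneg.2 hr.2) (by linarith [H.α_le_one])
  have h1 : ‖z (t + 1) - z t‖ ≤ ‖x (t + 1) - x t‖ + 1 / 4 * ‖y t - x t‖ := by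
    rw [e]
    refine (norm_sub_le _ _).trans ?_
    rw [norm_smul, norm_smul, Real.norm_of_nonneg (by linarith),
      Real.norm_of_nonneg (mul_nonneg H.α_pos.le h01)]
    gcongr
    · exact mul_le_of_le_one_left (norm_nonneg _) (by linarith)
    · nlinarith [sq_nonneg (α - 1 / 2)]
  have h2 := pow_le_pow_left₀ (norm_nonneg _) h1 2
  nlinarith [sq_nonneg (‖x (t + 1) - x t‖ - 1 / 4 * ‖y t - x t‖)]

theorem sum_norm_extrapolate_succ_sub_sq_le (T : ℕ) :
    ∑ t ∈ Finset.range T, ‖z (t + 1) - z t‖ ^ 2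
      ≤ 17 / 8 * ∑ t ∈ Finset.range T, ‖x (t + 1) - x t‖ ^ 2 := by
  have h := Finset.sum_le_sum fun t (_ : t ∈ Finset.range T) =>
    HT.norm_extrapolate_succ_sub_sq_le H t
  rw [Finset.sum_add_distrib, ← Finset.mul_sum, ← Finset.mul_sum] at h
  linarith [HT.sum_norm_sub_sq_le H T]

/-- The point `x (t + 1)` and the exact proximal point at `z t` are images, under one nonexpansive
map, of arguments that differ by the gap and the gradient error. The resulting bound 2‖e‖ + ‖s‖ +
β‖δ‖ is squared at the cost of a factor 3. -/
theorem norm_gradMapping_sq_le (hr : ConvexOn ℝ Set.univ r) (t : ℕ) :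
    β ^ 2 * ‖gradMapping (lam t) r F (z t)‖ ^ 2 ≤ 12 * ‖y t - x t‖ ^ 2
      + 3 * ‖x (t + 1) - x t‖ ^ 2 + 3 * β ^ 2 * ‖v t - gradient F (z t)‖ ^ 2 := by
  have hl := H.lam_pos t
  have hbl := (H.lam_mem t).1
  have hz := HT.norm_extrapolate_sub_le H t
  have h1 : ‖x (t + 1) - prox (lam t) r (z t - lam t • gradient F (z t))‖
      ≤ ‖z t - x t‖ + lam t * ‖v t - gradient F (z t)‖ := by
    rw [HT.prox_step]
    refine (norm_prox_sub_le hr hl _ _).trans ?_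
    have e : x t - lam t • v t - (z t - lam t • gradient F (z t))
        = -(z t - x t) - lam t • (v t - gradient F (z t)) := by module
    rw [e]
    refine (norm_sub_le _ _).trans ?_
    rw [norm_neg, norm_smul, Real.norm_of_nonneg hl.le]
  have h2 : ‖z t - prox (lam t) r (z t - lam t • gradient F (z t))‖
      ≤ 2 * ‖y t - x t‖ + ‖x (t + 1) - x t‖ + lam t * ‖v t - gradient F (z t)‖ := by
    have e : z t - prox (lam t) r (z t - lam t • gradient F (z t))
        = (z t - x t) - (x (t + 1) - x t)
          + (x (t + 1) - prox (lam t) r (z t - lam t • gradient F (z t))) := by abel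
    rw [e]
    refine (norm_add_le _ _).trans ?_
    linarith [norm_sub_le (z t - x t) (x (t + 1) - x t)]
  have h3 : β * ‖gradMapping (lam t) r F (z t)‖
      ≤ 2 * ‖y t - x t‖ + ‖x (t + 1) - x t‖ + β * ‖v t - gradient F (z t)‖ := by
    have hc1 : 0 ≤ β / lam t := div_nonneg H.β_pos.le hl.le
    have hc2 := (H.ratio_mem t).2
    rw [gradMapping, norm_smul, norm_inv, Real.norm_of_nonneg hl.le, ← mul_assoc,
      ← div_eq_mul_inv]
    refine (mul_le_mul_of_nonneg_left h2 hc1).trans ?_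
    rw [mul_add, ← mul_assoc (β / lam t) (lam t), div_mul_cancel₀ _ hl.ne']
    gcongr
    exact mul_le_of_le_one_left (by positivity) hc2
  have h4 := pow_le_pow_left₀ (mul_nonneg H.β_pos.le (norm_nonneg _)) h3 2
  rw [mul_pow] at h4
  nlinarith [sq_nonneg (2 * ‖y t - x t‖ - ‖x (t + 1) - x t‖),
    sq_nonneg (2 * ‖y t - x t‖ - β * ‖v t - gradient F (z t)‖),
    sq_nonneg (‖x (t + 1) - x t‖ - β * ‖v t - gradient F (z t)‖)]

theorem sum_norm_gradMapping_sq_le (hr : ConvexOn ℝ Set.univ r) (T : ℕ) :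
    β ^ 2 * ∑ t ∈ Finset.range T, ‖gradMapping (lam t) r F (z t)‖ ^ 2
      ≤ 15 * ∑ t ∈ Finset.range T, ‖x (t + 1) - x t‖ ^ 2
        + 3 * β ^ 2 * ∑ t ∈ Finset.range T, ‖v t - gradient F (z t)‖ ^ 2 := by
  have h := Finset.sum_le_sum fun t (_ : t ∈ Finset.range T) =>
    HT.norm_gradMapping_sq_le (F := F) H hr t
  rw [← Finset.mul_sum, Finset.sum_add_distrib, Finset.sum_add_distrib, ← Finset.mul_sum,
    ← Finset.mul_sum, ← Finset.mul_sum] at h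
  linarith [HT.sum_norm_sub_sq_le H T]

/-- One step decreases the objective, up to the estimation error of the gradient. -/
theorem descent (hr : ConvexOn ℝ Set.univ r) {L : NNReal} (hF : Differentiable ℝ F)
    (hL : LipschitzWith L (gradient F)) (hβL : 16 * (β * L) ≤ 1) (t : ℕ) :
    β * (F (x (t + 1)) + r (x (t + 1))) + 9 / 32 * ‖x (t + 1) - x t‖ ^ 2
      ≤ β * (F (x t) + r (x t)) + 1 / 32 * ‖y t - x t‖ ^ 2
        + 2 * β ^ 2 * ‖v t - gradient F (z t)‖ ^ 2 := by
  have hl := H.lam_pos t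
  have hβ := H.β_pos
  have h1 := prox_variational hr hl (x t - lam t • v t) (x t)
  rw [← HT.prox_step] at h1
  have e1 : (lam t)⁻¹ * inner ℝ (x t - lam t • v t - x (t + 1)) (x t - x (t + 1))
      = (lam t)⁻¹ * ‖x (t + 1) - x t‖ ^ 2 + inner ℝ (v t) (x (t + 1) - x t) := by
    have e : x t - lam t • v t - x (t + 1) = -(x (t + 1) - x t) - lam t • v t := by abel
    rw [e, ← neg_sub (x (t + 1)) (x t), inner_sub_left, inner_neg_neg, real_inner_self_eq_norm_sq,
      inner_neg_right, real_inner_smul_left, sub_neg_eq_add, mul_add, inv_mul_cancel_left₀ hl.ne']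
  rw [e1] at h1
  have h2 := le_add_inner_gradient hF hL (x t) (x (t + 1))
  have h3 : inner ℝ (gradient F (x t)) (x (t + 1) - x t) - inner ℝ (v t) (x (t + 1) - x t)
      ≤ (L * ‖y t - x t‖ + ‖v t - gradient F (z t)‖) * ‖x (t + 1) - x t‖ := by
    rw [← inner_sub_left]
    refine (real_inner_le_norm _ _).trans ?_
    gcongr
    have e : gradient F (x t) - v t
        = (gradient F (x t) - gradient F (z t)) - (v t - gradient F (z t)) := by abel
    rw [e]
    refine (norm_sub_le _ _).trans ?_
    gcongr
    rw [← dist_eq_norm]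
    refine (hL.dist_le_mul _ _).trans ?_
    gcongr
    rw [dist_comm, dist_eq_norm]
    exact HT.norm_extrapolate_sub_le H t
  -- After multiplication by `β`, half of the squared step survives because `lam t ≤ 2 * β`.
  have h4 : 1 / 2 ≤ β * (lam t)⁻¹ := by
    rw [← div_eq_mul_inv, le_div_iff₀ hl]
    linarith [H.lam_le t]
  have h5 : r (x (t + 1)) + F (x (t + 1)) ≤ r (x t) + F (x t)
      - (lam t)⁻¹ * ‖x (t + 1) - x t‖ ^ 2 + L * ‖x (t + 1) - x t‖ ^ 2
      + (L * ‖y t - x t‖ + ‖v t - gradient F (z t)‖) * ‖x (t + 1) - x t‖ := by linarith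
  have h6 := mul_le_mul_of_nonneg_left h5 hβ.le
  generalize ‖x (t + 1) - x t‖ = s at *
  generalize ‖y t - x t‖ = e at *
  generalize ‖v t - gradient F (z t)‖ = δ at *
  -- The budget: βLs² ≤ s²/16, βLes ≤ (e² + s²)/32 and βδs ≤ s²/8 + 2(βδ)², so 1/2 - 1/16 - 1/32 -
  -- 1/8 = 9/32 of s² remains.
  have a1 := mul_le_mul_of_nonneg_right h4 (sq_nonneg s)
  have a2 := mul_le_mul_of_nonneg_right hβL (sq_nonneg s)
  have a3 := mul_le_mul_of_nonneg_right hβL (sq_nonneg e)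
  have a4 : 0 ≤ β * L * (e - s) ^ 2 := by positivity
  have a5 := sq_nonneg (4 * (β * δ) - s)
  nlinarith

/-- Telescoped descent. The gap terms 1/32 are paid out of 9/32 through `sum_norm_sub_sq_le`, which
leaves 8/32 = 1/4. -/
theorem sum_norm_step_sq_le (hr : ConvexOn ℝ Set.univ r) {L : NNReal} (hF : Differentiable ℝ F)
    (hL : LipschitzWith L (gradient F)) (hβL : 16 * (β * L) ≤ 1)
    (hb : BddBelow (Set.range fun w => F w + r w)) (T : ℕ) :
    1 / 4 * ∑ t ∈ Finset.range T, ‖x (t + 1) - x t‖ ^ 2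
      ≤ β * (F (x 0) + r (x 0) - ⨅ w, (F w + r w))
        + 2 * β ^ 2 * ∑ t ∈ Finset.range T, ‖v t - gradient F (z t)‖ ^ 2 := by
  have key : β * (F (x T) + r (x T)) + 9 / 32 * ∑ t ∈ Finset.range T, ‖x (t + 1) - x t‖ ^ 2
      ≤ β * (F (x 0) + r (x 0)) + 1 / 32 * ∑ t ∈ Finset.range T, ‖y t - x t‖ ^ 2
        + 2 * β ^ 2 * ∑ t ∈ Finset.range T, ‖v t - gradient F (z t)‖ ^ 2 := by
    induction T with
    | zero => simp
    | succ T ih =>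
      simp only [Finset.sum_range_succ, mul_add]
      have := HT.descent H hr hF hL hβL T
      linarith
  have h1 := HT.sum_norm_sub_sq_le H T
  have h2 := mul_le_mul_of_nonneg_left (ciInf_le hb (x T)) H.β_pos.le
  linarith

end Trajectory

end Trajectory

/-! ### The algorithm as a trajectory; bounds uniform in the batches. -/

section Run

variable {d p : ℕ} {Ξ : Type*} {f : E p → ℝ} {g : Ξ → E d → E p} {gbar : E d → E p} {r : E d → ℝ}
  {lf Lf lg Lg : NNReal} {LF G0 α β : ℝ} {lam : ℕ → ℝ}

variable (f g r) in
/-- The gradient estimate that the algorithm uses in iteration `t`. -/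
noncomputable def gradEst (τ : ℕ) (α β lam : ℕ → ℝ) (x0 : E d) (A : ℕ → Multiset Ξ) (t : ℕ) : E d :=
  transposeMul (iterate f g r τ α β lam x0 A (t + 1)).jacEst
    (gradient f (iterate f g r τ α β lam x0 A (t + 1)).gEst)

/-- Makes every inequality for `Trajectory` available for each outcome of the sampling separately.
-/
theorem trajectory_iterate (τ : ℕ) (x0 : E d) (A : ℕ → Multiset Ξ) :
    Trajectory r α β lam
      (fun t => (iterate f g r τ (fun _ => α) (fun _ => β) lam x0 A t).x)
      (fun t => (iterate f g r τ (fun _ => α) (fun _ => β) lam x0 A t).y)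
      (zIter f g r τ (fun _ => α) (fun _ => β) lam x0 A)
      (gradEst f g r τ (fun _ => α) (fun _ => β) lam x0 A) :=
  ⟨rfl, fun _ => rfl, fun _ => rfl, fun _ => rfl⟩

theorem matVec_jacEst_succ (τ : ℕ) (α β lam : ℕ → ℝ) (x0 : E d) (A : ℕ → Multiset Ξ) (t : ℕ) :
    matVec (iterate f g r τ α β lam x0 A (t + 1)).jacEst = if t % τ = 0 then
        batchMean (A t) fun ξ => jacVec (g ξ) (zIter f g r τ α β lam x0 A t)
      else matVec (iterate f g r τ α β lam x0 A t).jacEst + batchMean (A t) fun ξ =>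
        jacVec (g ξ) (zIter f g r τ α β lam x0 A t)
          - jacVec (g ξ) (iterate f g r τ α β lam x0 A t).zPrev := by
  simp only [iterate, step]
  split_ifs
  · rw [map_batchMean]; rfl
  · rw [map_add, map_batchMean]
    simp only [map_sub]
    rfl

theorem gEst_succ (τ : ℕ) (α β lam : ℕ → ℝ) (x0 : E d) (A : ℕ → Multiset Ξ) (t : ℕ) :
    (iterate f g r τ α β lam x0 A (t + 1)).gEst = if t % τ = 0 then
        batchMean (A t) fun ξ => g ξ (zIter f g r τ α β lam x0 A t)
      else (iterate f g r τ α β lam x0 A t).gEst + batchMean (A t) fun ξ =>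
        g ξ (zIter f g r τ α β lam x0 A t)
          - g ξ (iterate f g r τ α β lam x0 A t).zPrev := rfl

theorem norm_extrapolate_le (h0 : 0 ≤ α) (h1 : α ≤ 1) {t : ℕ} {S : State d p} {K : ℝ}
    (hx : ‖S.x‖ ≤ K) (hy : ‖S.y‖ ≤ K) : ‖extrapolate (fun _ => α) t S‖ ≤ K := by
  refine (norm_add_le _ _).trans ?_
  rw [norm_smul, norm_smul, Real.norm_of_nonneg (sub_nonneg.2 h1), Real.norm_of_nonneg h0]
  nlinarith [mul_le_mul_of_nonneg_left hx h0, mul_le_mul_of_nonneg_left hy (sub_nonneg.2 h1)]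

/-- The iterates and the Jacobian estimates are bounded uniformly in the batches. -/
theorem exists_bound_iterate (H : SmoothnessAssumption f g gbar r lf Lf lg Lg)
    (hM : ConstantMomentum LF G0 α β lam) (τ : ℕ) (x0 : E d) (t : ℕ) :
    ∃ K : ℝ, 0 ≤ K ∧ ∀ A : ℕ → Multiset Ξ,
      ‖(iterate f g r τ (fun _ => α) (fun _ => β) lam x0 A t).x‖ ≤ K ∧
      ‖(iterate f g r τ (fun _ => α) (fun _ => β) lam x0 A t).y‖ ≤ K ∧
      ‖matVec (iterate f g r τ (fun _ => α) (fun _ => β) lam x0 A t).jacEst‖ ≤ K := by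
  induction t with
  | zero =>
    refine ⟨‖x0‖, norm_nonneg _, fun A => ⟨le_rfl, le_rfl, ?_⟩⟩
    simp [iterate, initState]
  | succ t ih =>
    obtain ⟨K, hK, ih⟩ := ih
    set K0 := √(p * d * (lg : ℝ) ^ 2)
    have hK0 : 0 ≤ K0 := Real.sqrt_nonneg _
    -- The estimate `gEst` may be unbounded over the batches, but it enters only through `gradient
    -- f`, which is bounded by `lf`. The Jacobian estimate alone controls the search direction.
    set Kx := ‖prox (lam t) r 0‖ + (K + lam t * ((K + 2 * K0) * lf))
    have hl := hM.lam_pos t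
    have hKx : 0 ≤ Kx := by positivity
    refine ⟨K + 2 * K0 + Kx + (K + β / lam t * (Kx + K)), ?_, fun A => ?_⟩
    · have := hM.β_pos; positivity
    obtain ⟨hx, hy, hJ⟩ := ih A
    have hJ' : ‖matVec (iterate f g r τ (fun _ => α) (fun _ => β) lam x0 A (t + 1)).jacEst‖
        ≤ K + 2 * K0 := by
      rw [matVec_jacEst_succ]
      split_ifs
      · refine (norm_batchMean_le (A t) hK0 fun ξ => norm_jacVec_le (H.g_lipschitz ξ) _).trans ?_
        linarith
      · refine (norm_add_le _ _).trans (add_le_add hJ (norm_batchMean_le _ (by positivity) ?_))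
        intro ξ
        refine (norm_sub_le _ _).trans ?_
        linarith [norm_jacVec_le (H.g_lipschitz ξ)
            (zIter f g r τ (fun _ => α) (fun _ => β) lam x0 A t),
          norm_jacVec_le (H.g_lipschitz ξ)
            (iterate f g r τ (fun _ => α) (fun _ => β) lam x0 A t).zPrev]
    have hT := trajectory_iterate (f := f) (g := g) (r := r) (α := α) (β := β) (lam := lam) τ x0 A
    have hx' : ‖(iterate f g r τ (fun _ => α) (fun _ => β) lam x0 A (t + 1)).x‖ ≤ Kx := by
      have e := hT.prox_step t
      simp only at e
      rw [e]
      set u := (iterate f g r τ (fun _ => α) (fun _ => β) lam x0 A t).x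
        - lam t • gradEst f g r τ (fun _ => α) (fun _ => β) lam x0 A t with hu
      have h1 := norm_prox_sub_le H.r_convex hl u 0
      have h2 : ‖prox (lam t) r u‖ ≤ ‖prox (lam t) r 0‖ + ‖u‖ := by
        rw [sub_zero] at h1
        linarith [norm_sub_norm_le (prox (lam t) r u) (prox (lam t) r 0)]
      refine h2.trans (add_le_add le_rfl ?_)
      refine (norm_sub_le _ _).trans (add_le_add hx ?_)
      rw [norm_smul, Real.norm_of_nonneg hl.le]
      gcongr
      refine (norm_transposeMul_le _ _).trans ?_
      gcongr
      exact norm_gradient_le H.f_lipschitz _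
    have hy' : ‖(iterate f g r τ (fun _ => α) (fun _ => β) lam x0 A (t + 1)).y‖
        ≤ K + β / lam t * (Kx + K) := by
      have e := hT.momentum t
      simp only at e
      rw [e]
      refine (norm_add_le _ _).trans (add_le_add
        (norm_extrapolate_le hM.α_pos.le hM.α_le_one hx hy) ?_)
      have hb : 0 ≤ β / lam t := div_nonneg hM.β_pos.le hl.le
      rw [norm_smul, Real.norm_of_nonneg hb]
      gcongr
      exact (norm_sub_le _ _).trans (add_le_add hx' hx)
    have hb : 0 ≤ K + β / lam t * (Kx + K) := (norm_nonneg _).trans hy'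
    exact ⟨by linarith, by linarith, by linarith⟩

/-- The number of evaluations after `T` iterations. -/
theorem evals_iterate (τ : ℕ) (α β lam : ℕ → ℝ) (x0 : E d) (A : ℕ → Multiset Ξ) (T : ℕ) :
    (iterate f g r τ α β lam x0 A T).evals
      = ∑ t ∈ Finset.range T, if t % τ = 0 then 2 * (A t).card else 4 * (A t).card := by
  induction T with
  | zero => rfl
  | succ T ih => rw [Finset.sum_range_succ, ← ih]; rfl

end Run

/-! ### Adaptedness of the iterates. -/

section Measurability

variable {Ω : Type*}

/-- The information contained in the batches of the iterations before `t`. -/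
abbrev past (n : ℕ → MeasurableSpace Ω) (t : ℕ) : MeasurableSpace Ω := ⨆ s, ⨆ _ : s < t, n s

theorem past_mono {n : ℕ → MeasurableSpace Ω} {s t : ℕ} (h : s ≤ t) : past n s ≤ past n t :=
  iSup_mono fun _ => iSup_mono' fun hi => ⟨hi.trans_le h, le_rfl⟩

theorem le_past {n : ℕ → MeasurableSpace Ω} {s t : ℕ} (h : s < t) : n s ≤ past n t :=
  le_iSup₂_of_le s h le_rfl

/-- Functions continuous in space and measurable in the outcome are jointly measurable, so a random
point may be inserted into a batch mean. -/
theorem measurable_random_field {m : MeasurableSpace Ω} {X V : Type*} [TopologicalSpace X]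
    [TopologicalSpace.MetrizableSpace X] [MeasurableSpace X] [SecondCountableTopology X]
    [OpensMeasurableSpace X] [TopologicalSpace V] [TopologicalSpace.PseudoMetrizableSpace V]
    [MeasurableSpace V] [BorelSpace V] {u : X → Ω → V} (hc : ∀ ω, Continuous fun x => u x ω)
    (hu : ∀ x, Measurable (u x)) {Z : Ω → X} (hZ : Measurable Z) :
    Measurable fun ω => u (Z ω) ω :=
  (measurable_uncurry_of_continuous_of_measurable hc hu).comp (hZ.prodMk measurable_id)

variable {d p : ℕ}

theorem measurable_transposeMul {m : MeasurableSpace Ω} {M : Ω → Matrix (Fin p) (Fin d) ℝ}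
    {u : Ω → E p} (hM : Measurable fun ω => matVec (M ω)) (hu : Measurable u) :
    Measurable fun ω => transposeMul (M ω) (u ω) := by
  have hc : Continuous fun q : EuclideanSpace ℝ (Fin p × Fin d) × E p =>
      (WithLp.toLp 2 fun j => ∑ i, q.1 (i, j) * q.2 i : E d) := by fun_prop
  exact hc.measurable.comp (hM.prodMk hu)

variable {Ξ : Type*} {f : E p → ℝ} {g : Ξ → E d → E p} {gbar : E d → E p} {r : E d → ℝ}
  {lf Lf lg Lg : NNReal} {LF G0 α β : ℝ} {lam : ℕ → ℝ}

theorem measurable_batchMean {m : MeasurableSpace Ω} {κ : Type*} [Fintype κ]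
    {h : Ξ → E d → EuclideanSpace ℝ κ} {l : NNReal} (hl : ∀ ξ, LipschitzWith l (h ξ))
    {A : Ω → Multiset Ξ} (hA : ∀ z, Measurable fun ω => batchMean (A ω) fun ξ => h ξ z)
    {Z : Ω → E d} (hZ : Measurable Z) :
    Measurable fun ω => batchMean (A ω) fun ξ => h ξ (Z ω) :=
  measurable_random_field (u := fun z ω => batchMean (A ω) fun ξ => h ξ z)
    (fun ω => (lipschitzWith_batchMean (A ω) hl).continuous) hA hZ

/-- The state before iteration `t` depends on earlier batches only. With independence of the
batches, this allows the evaluation points to be frozen when averaging over batch `t`. -/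
theorem measurable_iterate (H : SmoothnessAssumption f g gbar r lf Lf lg Lg)
    (hM : ConstantMomentum LF G0 α β lam) {n : ℕ → MeasurableSpace Ω} {A : ℕ → Ω → Multiset Ξ}
    {T : ℕ} (hA : ∀ t < T, ∀ z, Measurable[n t] fun ω => batchMean (A t ω) fun ξ => g ξ z)
    (hA' : ∀ t < T, ∀ z, Measurable[n t] fun ω => batchMean (A t ω) fun ξ => jacVec (g ξ) z)
    (τ : ℕ) (x0 : E d) {t : ℕ} (ht : t ≤ T) :
    let S := fun ω => iterate f g r τ (fun _ => α) (fun _ => β) lam x0 (fun s => A s ω) t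
    Measurable[past n t] (fun ω => (S ω).x) ∧ Measurable[past n t] (fun ω => (S ω).y) ∧
      Measurable[past n t] (fun ω => (S ω).zPrev) ∧ Measurable[past n t] (fun ω => (S ω).gEst) ∧
      Measurable[past n t] (fun ω => matVec (S ω).jacEst) := by
  induction t with
  | zero =>
    exact ⟨measurable_const, measurable_const, measurable_const, measurable_const,
      (measurable_const : Measurable[past n 0] fun _ : Ω =>
        matVec (initState x0 : State d p).jacEst)⟩
  | succ t ih =>
    intro S
    obtain ⟨hx, hy, hzp, hg, hJ⟩ := ih (Nat.le_of_succ_le ht)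
    have hle : past n t ≤ past n (t + 1) := past_mono t.le_succ
    replace hx := hx.mono hle le_rfl
    replace hy := hy.mono hle le_rfl
    replace hzp := hzp.mono hle le_rfl
    replace hg := hg.mono hle le_rfl
    replace hJ := hJ.mono hle le_rfl
    have hA1 := fun z => (hA t ht z).mono (le_past (n := n) t.lt_succ_self) le_rfl
    have hA2 := fun z => (hA' t ht z).mono (le_past (n := n) t.lt_succ_self) le_rfl
    let _ : MeasurableSpace Ω := past n (t + 1)
    have hz : Measurable fun ω =>
        zIter f g r τ (fun _ => α) (fun _ => β) lam x0 (fun s => A s ω) t :=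
      (hy.const_smul (1 - α)).add (hx.const_smul α)
    have hg' : Measurable fun ω => (S ω).gEst := by
      simp only [S, gEst_succ]
      split_ifs
      · exact measurable_batchMean H.g_lipschitz hA1 hz
      · simp only [batchMean_sub]
        exact hg.add ((measurable_batchMean H.g_lipschitz hA1 hz).sub
          (measurable_batchMean H.g_lipschitz hA1 hzp))
    have hJ' : Measurable fun ω => matVec (S ω).jacEst := by
      simp only [S, matVec_jacEst_succ]
      split_ifs
      · exact measurable_batchMean H.lipschitzWith_jacVec hA2 hz
      · simp only [batchMean_sub]
        exact hJ.add ((measurable_batchMean H.lipschitzWith_jacVec hA2 hz).sub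
          (measurable_batchMean H.lipschitzWith_jacVec hA2 hzp))
    have hv : Measurable fun ω => transposeMul (S ω).jacEst (gradient f (S ω).gEst) :=
      measurable_transposeMul hJ' (H.f_smooth.continuous.measurable.comp hg')
    have hx' : Measurable fun ω => (S ω).x :=
      (continuous_prox H.r_convex (hM.lam_pos t)).measurable.comp (hx.sub (hv.const_smul (lam t)))
    exact ⟨hx', hz.add ((hx'.sub hx).const_smul (β / lam t)), hz, hg', hJ'⟩

end Measurability

/-! ### Freezing an independent argument, in place of conditional expectations. -/

section Freezing

variable {Ω X Y : Type*} {mΩ : MeasurableSpace Ω} {P : Measure Ω} [IsProbabilityMeasure P]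
  [MeasurableSpace X]

theorem lintegral_comp_indepFun [MeasurableSpace Y] {Z : Ω → X} {U : Ω → Y} (hZ : Measurable Z)
    (hU : Measurable U) (h : IndepFun Z U P) {k : X × Y → ENNReal} (hk : Measurable k) :
    ∫⁻ ω, k (Z ω, U ω) ∂P = ∫⁻ ω, ∫⁻ ω', k (Z ω, U ω') ∂P ∂P := by
  have h1 := (indepFun_iff_map_prod_eq_prod_map_map hZ.aemeasurable hU.aemeasurable).1 h
  have := Measure.isProbabilityMeasure_map (μ := P) hU.aemeasurable
  have := Measure.isProbabilityMeasure_map (μ := P) hZ.aemeasurable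
  calc ∫⁻ ω, k (Z ω, U ω) ∂P = ∫⁻ q, k q ∂(P.map fun ω => (Z ω, U ω)) :=
        (lintegral_map hk (hZ.prodMk hU)).symm
    _ = ∫⁻ x, ∫⁻ y, k (x, y) ∂(P.map U) ∂(P.map Z) := by
        rw [h1, lintegral_prod _ hk.aemeasurable]
    _ = ∫⁻ ω, ∫⁻ y, k (Z ω, y) ∂(P.map U) ∂P :=
        lintegral_map hk.lintegral_prod_right' hZ
    _ = _ := by
        refine lintegral_congr fun ω => ?_
        exact lintegral_map (hk.comp measurable_prodMk_left) hU

/-- In the expectation of `k Z ω`, an argument `Z` that is independent of the random function `k`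
may be frozen. -/
theorem lintegral_random_field {m n : MeasurableSpace Ω} (hm : m ≤ mΩ) (hn : n ≤ mΩ)
    (h : Indep m n P) {Z : Ω → X} (hZ : Measurable[m] Z) [TopologicalSpace X]
    [TopologicalSpace.MetrizableSpace X] [SecondCountableTopology X] [OpensMeasurableSpace X]
    {k : X → Ω → ENNReal} (hc : ∀ ω, Continuous fun x => k x ω) (hk : ∀ x, Measurable[n] (k x)) :
    ∫⁻ ω, k (Z ω) ω ∂P = ∫⁻ ω, ∫⁻ ω', k (Z ω) ω' ∂P ∂P := by
  -- The second random variable is the outcome itself, seen only through the σ-algebra `n`.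
  have hU : @Measurable Ω Ω mΩ n id := measurable_id'' hn
  refine @lintegral_comp_indepFun Ω X Ω mΩ P _ _ n Z id (hZ.mono hm le_rfl) hU ?_
    (Function.uncurry k) ?_
  · rw [IndepFun_iff_Indep, MeasurableSpace.comap_id]
    exact indep_of_indep_of_le_left h hZ.comap_le
  · exact measurable_uncurry_of_continuous_of_measurable hc hk

end Freezing

/-- Double counting: there are at most `τ` lags `i`, and for a fixed lag the map `t ↦ t - 1 - i` is
injective on `t > i`. The factor `τ` cancels the variance reduction `1 / τ` of the batches. -/
theorem sum_epoch_le {q : ℕ → ℝ} (hq : ∀ s, 0 ≤ q s) {τ : ℕ} (hτ : 0 < τ) (T : ℕ) :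
    ∑ t ∈ Finset.range T, ∑ i ∈ Finset.range (t % τ), q (t - 1 - i)
      ≤ τ * ∑ s ∈ Finset.range T, q s := by
  have h1 : ∀ t ∈ Finset.range T, ∑ i ∈ Finset.range (t % τ), q (t - 1 - i)
      ≤ ∑ i ∈ Finset.range τ, if i < t then q (t - 1 - i) else 0 := by
    intro t _
    calc ∑ i ∈ Finset.range (t % τ), q (t - 1 - i)
        = ∑ i ∈ Finset.range (t % τ), if i < t then q (t - 1 - i) else 0 := by
          refine Finset.sum_congr rfl fun i hi => ?_
          rw [if_pos ((Finset.mem_range.1 hi).trans_le (Nat.mod_le t τ))]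
      _ ≤ _ := Finset.sum_le_sum_of_subset_of_nonneg
          (Finset.range_subset_range.2 (Nat.mod_lt t hτ).le)
          fun i _ _ => by split_ifs <;> simp [hq]
  refine (Finset.sum_le_sum h1).trans ?_
  rw [Finset.sum_comm]
  have h2 : ∀ i ∈ Finset.range τ, ∑ t ∈ Finset.range T, (if i < t then q (t - 1 - i) else 0)
      ≤ ∑ s ∈ Finset.range T, q s := by
    intro i _
    rw [← Finset.sum_filter]
    have hinj : Set.InjOn (fun t => t - 1 - i) ((Finset.range T).filter (i < ·)) := by
      intro a ha b hb hab
      simp only [Finset.coe_filter, Finset.mem_range, Set.mem_ofPred_eq] at ha hb hab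
      omega
    rw [← Finset.sum_image (f := q) hinj]
    refine Finset.sum_le_sum_of_subset_of_nonneg ?_ fun s _ _ => hq s
    intro s hs
    simp only [Finset.mem_image, Finset.mem_filter, Finset.mem_range] at hs ⊢
    omega
  refine (Finset.sum_le_sum h2).trans ?_
  simp

/-! ### Second moments and orthogonality. -/

section SecondMoment

variable {Ω V : Type*} {mΩ : MeasurableSpace Ω} {P : Measure Ω} [NormedAddCommGroup V]

theorem enorm_sq_eq_ofReal (v : V) : ‖v‖ₑ ^ 2 = ENNReal.ofReal (‖v‖ ^ 2) := by
  rw [ENNReal.ofReal_pow (norm_nonneg v), ofReal_norm]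

theorem continuous_enorm_sq : Continuous fun v : V => ‖v‖ₑ ^ 2 :=
  (ENNReal.continuous_pow 2).comp continuous_enorm

theorem lintegral_enorm_sq_eq {φ : Ω → V} (h : Integrable (fun ω => ‖φ ω‖ ^ 2) P) :
    ∫⁻ ω, ‖φ ω‖ₑ ^ 2 ∂P = ENNReal.ofReal (∫ ω, ‖φ ω‖ ^ 2 ∂P) := by
  rw [ofReal_integral_eq_lintegral_ofReal h (Filter.Eventually.of_forall fun ω => sq_nonneg _)]
  simp_rw [enorm_sq_eq_ofReal]

/-- The cross term integrates to zero because `ψ` is centred. In use, `v` is the frozen past error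
and `ψ` the new fluctuation. -/
theorem lintegral_enorm_add_sq_le [IsProbabilityMeasure P] [InnerProductSpace ℝ V]
    [CompleteSpace V] {ψ : Ω → V} (hψ : AEStronglyMeasurable ψ P) {K s : ℝ}
    (hK : ∀ ω, ‖ψ ω‖ ≤ K) (h0 : ∫ ω, ψ ω ∂P = 0) (hs : 0 ≤ s)
    (h2 : ∫⁻ ω, ‖ψ ω‖ₑ ^ 2 ∂P ≤ ENNReal.ofReal s) (v : V) :
    ∫⁻ ω, ‖v + ψ ω‖ₑ ^ 2 ∂P ≤ ‖v‖ₑ ^ 2 + ENNReal.ofReal s := by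
  have hint : Integrable ψ P := .of_bound hψ K (.of_forall hK)
  have hint2 : Integrable (fun ω => ‖ψ ω‖ ^ 2) P :=
    .of_bound (hψ.norm.pow 2) (K ^ 2) (.of_forall fun ω => by
      rw [Real.norm_of_nonneg (sq_nonneg _)]
      exact pow_le_pow_left₀ (norm_nonneg _) (hK ω) 2)
  have hin : Integrable (fun ω => 2 * inner ℝ v (ψ ω)) P := (hint.const_inner v).const_mul 2
  have he : ∀ ω, ‖v + ψ ω‖ ^ 2 = ‖v‖ ^ 2 + 2 * inner ℝ v (ψ ω) + ‖ψ ω‖ ^ 2 :=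
    fun ω => norm_add_sq_real _ _
  have hint3 : Integrable (fun ω => ‖v‖ ^ 2 + 2 * inner ℝ v (ψ ω)) P :=
    (integrable_const _).add hin
  have hint4 : Integrable (fun ω => ‖v + ψ ω‖ ^ 2) P := by
    simp_rw [he]
    exact hint3.add hint2
  rw [lintegral_enorm_sq_eq hint4, enorm_sq_eq_ofReal,
    ← ENNReal.ofReal_add (sq_nonneg _) hs]
  refine ENNReal.ofReal_le_ofReal ?_
  simp_rw [he]
  rw [integral_add hint3 hint2, integral_add (integrable_const _) hin, integral_const_mul,
    integral_inner hint, h0]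
  rw [lintegral_enorm_sq_eq hint2] at h2
  have := (ENNReal.ofReal_le_ofReal_iff hs).1 h2
  simpa using this

end SecondMoment

/-! ### Mean square error of the recursive estimator. -/

section Estimator

variable {Ω Ξ κ : Type*} [Fintype κ] [mΩ : MeasurableSpace Ω] {d : ℕ}

/-- Conditions on the batches under which the recursive estimator of `hbar` is controlled: the
batches of the iterations `0, τ, 2τ, …` estimate `hbar` with mean square error at most `c`, and
all other ones estimate differences of `hbar` without bias and with reduced variance. -/
structure UnbiasedBatches (P : Measure Ω) (n : ℕ → MeasurableSpace Ω) (A : ℕ → Ω → Multiset Ξ)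
    (T τ : ℕ) (h : Ξ → E d → EuclideanSpace ℝ κ) (hbar : E d → EuclideanSpace ℝ κ) (l : NNReal)
    (c : ℝ) : Prop where
  nonneg : 0 ≤ c
  lipschitz : ∀ ξ, LipschitzWith l (h ξ)
  lipschitz_mean : LipschitzWith l hbar
  measurable : ∀ t < T, ∀ z, Measurable[n t] fun ω => batchMean (A t ω) fun ξ => h ξ z
  fresh : ∀ t < T, t % τ = 0 → ∀ z,
    ∫⁻ ω, ‖batchMean (A t ω) (fun ξ => h ξ z) - hbar z‖ₑ ^ 2 ∂P ≤ ENNReal.ofReal c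
  unbiased : ∀ t < T, t % τ ≠ 0 → ∀ z z',
    ∫ ω, batchMean (A t ω) (fun ξ => h ξ z - h ξ z') ∂P = hbar z - hbar z'
  variance : ∀ t < T, t % τ ≠ 0 → ∀ z z',
    ∫⁻ ω, ‖batchMean (A t ω) (fun ξ => h ξ z - h ξ z') - (hbar z - hbar z')‖ₑ ^ 2 ∂P
      ≤ ENNReal.ofReal (l ^ 2 / τ * ‖z - z'‖ ^ 2)

namespace UnbiasedBatches

variable {P : Measure Ω} {n : ℕ → MeasurableSpace Ω}
  {A : ℕ → Ω → Multiset Ξ} {T τ : ℕ} {h : Ξ → E d → EuclideanSpace ℝ κ}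
  {hbar : E d → EuclideanSpace ℝ κ} {l : NNReal} {c : ℝ}

theorem measurable_sub (U : UnbiasedBatches P n A T τ h hbar l c) {t : ℕ} (ht : t < T)
    (z z' : E d) :
    Measurable[n t] fun ω => batchMean (A t ω) (fun ξ => h ξ z - h ξ z') - (hbar z - hbar z') := by
  simp only [batchMean_sub]
  exact ((U.measurable t ht z).sub (U.measurable t ht z')).sub measurable_const

variable [IsProbabilityMeasure P]

theorem lintegral_add_sq_le (U : UnbiasedBatches P n A T τ h hbar l c) {t : ℕ} (ht : t < T)
    (hn : n t ≤ mΩ) (hτ : t % τ ≠ 0) (v : EuclideanSpace ℝ κ) (z z' : E d) :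
    ∫⁻ ω, ‖v + (batchMean (A t ω) (fun ξ => h ξ z - h ξ z') - (hbar z - hbar z'))‖ₑ ^ 2 ∂P
      ≤ ‖v‖ₑ ^ 2 + ENNReal.ofReal (l ^ 2 / τ * ‖z - z'‖ ^ 2) := by
  have hm := (U.measurable_sub ht z z').mono hn le_rfl
  have hb : ∀ ω, ‖batchMean (A t ω) (fun ξ => h ξ z - h ξ z')‖ ≤ l * dist z z' := fun ω =>
    norm_batchMean_le _ (by positivity) fun ξ => by
      rw [← dist_eq_norm]; exact (U.lipschitz ξ).dist_le_mul z z'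
  have hb' : ∀ ω, ‖batchMean (A t ω) (fun ξ => h ξ z - h ξ z') - (hbar z - hbar z')‖
      ≤ 2 * (l * dist z z') := fun ω => by
    have := U.lipschitz_mean.dist_le_mul z z'
    rw [dist_eq_norm] at this
    linarith [norm_sub_le (batchMean (A t ω) (fun ξ => h ξ z - h ξ z')) (hbar z - hbar z'), hb ω]
  have hint : Integrable (fun ω => batchMean (A t ω) (fun ξ => h ξ z - h ξ z')) P := by
    refine .of_bound ?_ _ (.of_forall hb)
    simp only [batchMean_sub]
    exact (((U.measurable t ht z).sub (U.measurable t ht z')).mono hn le_rfl).aestronglyMeasurable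
  refine lintegral_enorm_add_sq_le hm.aestronglyMeasurable hb' ?_ (by positivity)
    (U.variance t ht hτ z z') v
  rw [integral_sub hint (integrable_const _), U.unbiased t ht hτ]
  simp

/-- The mean square error of the recursive estimator. -/
theorem error_le (U : UnbiasedBatches P n A T τ h hbar l c) (hn : ∀ t < T, n t ≤ mΩ)
    (hind : ∀ t < T, Indep (past n t) (n t) P) {z : ℕ → Ω → E d} {est : ℕ → Ω → EuclideanSpace ℝ κ}
    (hz : ∀ t < T, Measurable[past n t] (z t)) (hest : ∀ t ≤ T, Measurable[past n t] (est t))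
    (hfresh : ∀ t < T, t % τ = 0 → ∀ ω,
      est (t + 1) ω = batchMean (A t ω) fun ξ => h ξ (z t ω))
    (hrec : ∀ t, t + 1 < T → (t + 1) % τ ≠ 0 → ∀ ω, est (t + 2) ω
      = est (t + 1) ω + batchMean (A (t + 1) ω) fun ξ => h ξ (z (t + 1) ω) - h ξ (z t ω))
    {q : ℕ → ℝ} (hq0 : ∀ s, 0 ≤ q s)
    (hq : ∀ t, t + 1 < T → ∫⁻ ω, ‖z (t + 1) ω - z t ω‖ₑ ^ 2 ∂P ≤ ENNReal.ofReal (q t))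
    {t : ℕ} (ht : t < T) :
    ∫⁻ ω, ‖est (t + 1) ω - hbar (z t ω)‖ₑ ^ 2 ∂P
      ≤ ENNReal.ofReal (c + ∑ i ∈ Finset.range (t % τ), l ^ 2 / τ * q (t - 1 - i)) := by
  have hpast : ∀ t ≤ T, past n t ≤ mΩ := fun t ht =>
    iSup₂_le fun s hs => hn s (hs.trans_le ht)
  have fresh_case : ∀ t < T, t % τ = 0 → ∫⁻ ω, ‖est (t + 1) ω - hbar (z t ω)‖ₑ ^ 2 ∂P
      ≤ ENNReal.ofReal (c + ∑ i ∈ Finset.range (t % τ), l ^ 2 / τ * q (t - 1 - i)) := by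
    intro t ht h0
    simp only [hfresh t ht h0, h0, Finset.range_zero, Finset.sum_empty, add_zero]
    rw [lintegral_random_field (hpast t ht.le) (hn t ht) (hind t ht) (hz t ht)
      (k := fun z ω => ‖batchMean (A t ω) (fun ξ => h ξ z) - hbar z‖ₑ ^ 2)]
    · refine (lintegral_mono fun ω => U.fresh t ht h0 (z t ω)).trans ?_
      simp
    · intro ω
      have h1 := (lipschitzWith_batchMean (A t ω) U.lipschitz).continuous
      have h2 := U.lipschitz_mean.continuous
      fun_prop
    · intro w
      exact continuous_enorm_sq.measurable.comp ((U.measurable t ht w).sub measurable_const)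
  induction t with
  | zero => exact fresh_case 0 ht (Nat.zero_mod τ)
  | succ t ih =>
    by_cases h0 : (t + 1) % τ = 0
    · exact fresh_case _ ht h0
    have ih := ih (Nat.lt_of_succ_lt ht)
    -- Iterations `t` and `t + 1` lie in the same epoch.
    have hmod : (t + 1) % τ = t % τ + 1 := by
      rcases Nat.eq_zero_or_pos τ with rfl | hτ
      · simp
      · have h1 := Nat.mod_lt t hτ
        rw [Nat.add_mod] at h0 ⊢
        rcases Nat.lt_or_ge 1 τ with h2 | h2
        · rw [Nat.mod_eq_of_lt h2] at h0 ⊢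
          rcases Nat.lt_or_ge (t % τ + 1) τ with h3 | h3
          · exact Nat.mod_eq_of_lt h3
          · have : t % τ + 1 = τ := by omega
            rw [this, Nat.mod_self] at h0
            exact absurd rfl h0
        · have : τ = 1 := by omega
          subst this
          exact absurd (Nat.mod_one _) h0
    have hsum : ∑ i ∈ Finset.range ((t + 1) % τ), (l : ℝ) ^ 2 / τ * q (t + 1 - 1 - i)
        = ∑ i ∈ Finset.range (t % τ), (l : ℝ) ^ 2 / τ * q (t - 1 - i) + l ^ 2 / τ * q t := by
      -- The term `i = 0` split off here is the newest increment `q t`; the other lags shift by one.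
      rw [hmod, Finset.sum_range_succ']
      congr 1
      refine Finset.sum_congr rfl fun i _ => ?_
      congr 2
      omega
    rw [hsum, ← add_assoc, ENNReal.ofReal_add (by
      have := U.nonneg
      exact add_nonneg this (Finset.sum_nonneg fun i _ => mul_nonneg (by positivity) (hq0 _)))
      (mul_nonneg (by positivity) (hq0 _))]
    have hzt : Measurable[past n (t + 1)] (z t) :=
      (hz t (Nat.lt_of_succ_lt ht)).mono (past_mono t.le_succ) le_rfl
    have he : Measurable[past n (t + 1)] fun ω => est (t + 1) ω - hbar (z t ω) :=
      (hest (t + 1) ht.le).sub (U.lipschitz_mean.continuous.measurable.comp hzt)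
    -- The old error is determined by the past, and the second summand is centred once the past is
    -- frozen; hence the squares add. The index is shifted: `est (t + 1)` estimates `hbar` at `z t`.
    have e : ∀ ω, est (t + 2) ω - hbar (z (t + 1) ω) = (est (t + 1) ω - hbar (z t ω))
        + (batchMean (A (t + 1) ω) (fun ξ => h ξ (z (t + 1) ω) - h ξ (z t ω))
          - (hbar (z (t + 1) ω) - hbar (z t ω))) := by
      intro ω
      rw [hrec t ht h0]
      abel
    simp only [e]
    rw [lintegral_random_field (hpast _ ht.le) (hn _ ht) (hind _ ht)
      (he.prodMk ((hz _ ht).prodMk hzt))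
      (k := fun q ω => ‖q.1 + (batchMean (A (t + 1) ω) (fun ξ => h ξ q.2.1 - h ξ q.2.2)
        - (hbar q.2.1 - hbar q.2.2))‖ₑ ^ 2)]
    · refine (lintegral_mono fun ω => U.lintegral_add_sq_le ht (hn _ ht) h0 _ _ _).trans ?_
      rw [lintegral_add_left (((he.mono (hpast _ ht.le) le_rfl).enorm).pow_const 2)]
      refine add_le_add ih ?_
      have e2 : ∀ ω, ENNReal.ofReal (l ^ 2 / τ * ‖z (t + 1) ω - z t ω‖ ^ 2)
          = ENNReal.ofReal (l ^ 2 / τ) * ‖z (t + 1) ω - z t ω‖ₑ ^ 2 := by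
        intro ω
        rw [ENNReal.ofReal_mul (by positivity), enorm_sq_eq_ofReal]
      simp only [e2]
      rw [lintegral_const_mul' _ _ ENNReal.ofReal_ne_top, ENNReal.ofReal_mul (by positivity)]
      gcongr
      exact hq t ht
    · intro ω
      simp only [batchMean_sub]
      have h1 := (lipschitzWith_batchMean (A (t + 1) ω) U.lipschitz).continuous
      have h2 := U.lipschitz_mean.continuous
      exact continuous_enorm_sq.comp (continuous_fst.add
        (((h1.comp (continuous_fst.comp continuous_snd)).sub
          (h1.comp (continuous_snd.comp continuous_snd))).sub
        ((h2.comp (continuous_fst.comp continuous_snd)).sub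
          (h2.comp (continuous_snd.comp continuous_snd)))))
    · intro w
      exact continuous_enorm_sq.measurable.comp (measurable_const.add (U.measurable_sub ht _ _))

end UnbiasedBatches

end Estimator

/-! ### The uniformly random output index. -/

section RandomIndex

variable {Ω : Type*} {mΩ : MeasurableSpace Ω} {P : Measure Ω}

theorem indepFun_of_indep {X Y : Type*} [MeasurableSpace X] [MeasurableSpace Y]
    {m n : MeasurableSpace Ω} (h : Indep m n P) {Z : Ω → X} {W : Ω → Y} (hZ : Measurable[m] Z)
    (hW : Measurable[n] W) : IndepFun Z W P := by
  rw [IndepFun_iff_Indep]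
  exact indep_of_indep_of_le h hZ.comap_le hW.comap_le

/-- The expectation at an independent uniformly distributed index is the average. -/
theorem integral_random_index [IsProbabilityMeasure P] {T : ℕ} {ζ : Ω → Fin T}
    (hζ : Measurable ζ) {m : MeasurableSpace Ω} (hu : ∀ t, P {ω | ζ ω = t} = (T : ENNReal)⁻¹)
    (hind : Indep m (MeasurableSpace.comap ζ ⊤) P) {H : ℕ → Ω → ℝ}
    (hm : ∀ t < T, Measurable[m] (H t)) (hint : ∀ t < T, Integrable (H t) P) :
    Integrable (fun ω => H (ζ ω) ω) P ∧
      ∫ ω, H (ζ ω) ω ∂P = (T : ℝ)⁻¹ * ∑ t ∈ Finset.range T, ∫ ω, H t ω ∂P := by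
  have hset : ∀ t, MeasurableSet[mΩ] {ω | ζ ω = t} := fun t => hζ (measurableSet_singleton t)
  -- Each indicator is independent of `H t`, so every summand factors into `1 / T` times an
  -- expectation.
  have e : ∀ ω, H (ζ ω) ω = ∑ t : Fin T, {ω | ζ ω = t}.indicator 1 ω * H t ω := by
    intro ω
    rw [Finset.sum_eq_single (ζ ω)]
    · simp [Set.indicator]
    · intro t _ ht
      simp [Set.indicator, ht.symm]
    · simp
  have hI : ∀ t, Integrable ({ω | ζ ω = t}.indicator (1 : Ω → ℝ)) P := fun t =>
    (integrable_const (1 : ℝ)).indicator (hset t)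
  have hindep : ∀ t : Fin T, IndepFun ({ω | ζ ω = t}.indicator (1 : Ω → ℝ)) (H t) P := by
    intro t
    refine (indepFun_of_indep hind (hm t t.2) ?_).symm
    exact (measurable_const (a := (1 : ℝ))).indicator ⟨{t}, trivial, rfl⟩
  have hprod : ∀ t : Fin T, Integrable (fun ω => {ω | ζ ω = t}.indicator 1 ω * H t ω) P :=
    fun t => (hindep t).integrable_mul (hI t) (hint t t.2)
  simp only [e]
  refine ⟨integrable_finsetSum _ fun t _ => hprod t, ?_⟩
  rw [integral_finsetSum _ fun t _ => hprod t, Finset.mul_sum,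
    ← Fin.sum_univ_eq_sum_range fun t => (T : ℝ)⁻¹ * ∫ ω, H t ω ∂P]
  refine Finset.sum_congr rfl fun t _ => ?_
  rw [(hindep t).integral_fun_mul_eq_mul_integral (hI t).aestronglyMeasurable
    (hint t t.2).aestronglyMeasurable]
  congr 1
  change ∫ ω, {ω | ζ ω = t}.indicator (1 : Ω → ℝ) ω ∂P = _
  rw [integral_indicator_one (hset t), Measure.real, hu]
  simp

end RandomIndex

/-! ### The convergence rate for abstract unbiased batches. -/

section Rate

variable {Ω : Type*} [mΩ : MeasurableSpace Ω]

/-- The batches of different iterations are independent (`n t` is the information contained in the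
batch of iteration `t`), and so is the uniformly distributed output index. -/
structure IndependentBatches (P : Measure Ω) (n : ℕ → MeasurableSpace Ω) (T : ℕ)
    (ζ : Ω → Fin T) : Prop where
  le : ∀ t < T, n t ≤ mΩ
  indep : ∀ t < T, Indep (past n t) (n t) P
  output_measurable : Measurable ζ
  output_uniform : ∀ t, P {ω | ζ ω = t} = (T : ENNReal)⁻¹
  output_indep : Indep (past n T) (MeasurableSpace.comap ζ ⊤) P

theorem integrable_of_measurable_of_bound {P : Measure Ω} [IsProbabilityMeasure P] {φ : Ω → ℝ}
    (h : Measurable φ) (h0 : ∀ ω, 0 ≤ φ ω) {K : ℝ} (hK : ∀ ω, φ ω ≤ K) : Integrable φ P :=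
  .of_bound h.aestronglyMeasurable K (.of_forall fun ω => by
    rw [Real.norm_of_nonneg (h0 ω)]; exact hK ω)

variable {d p : ℕ} {Ξ : Type*} {f : E p → ℝ} {g : Ξ → E d → E p} {gbar : E d → E p} {r : E d → ℝ}
  {lf Lf lg Lg : NNReal} {α β : ℝ} {lam : ℕ → ℝ} {P : Measure Ω} [IsProbabilityMeasure P]
  {n : ℕ → MeasurableSpace Ω} {A : ℕ → Ω → Multiset Ξ} {T τ : ℕ} {ζ : Ω → Fin T} {c1 c2 : ℝ}

/-- The total mean square error of the gradient estimates. -/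
theorem sum_integral_gradient_error_le (H : SmoothnessAssumption f g gbar r lf Lf lg Lg)
    (hg : Differentiable ℝ gbar)
    (hM : ConstantMomentum (constLF lf Lf lg Lg) (constG0 lf Lf lg Lg) α β lam) (hτ : 0 < τ)
    (hI : IndependentBatches P n T ζ) (U1 : UnbiasedBatches P n A T τ g gbar lg c1)
    (U2 : UnbiasedBatches P n A T τ (fun ξ => jacVec (g ξ)) (jacVec gbar) Lg c2) (x0 : E d)
    {z v : ℕ → Ω → E d}
    (hz : ∀ t ω, z t ω = zIter f g r τ (fun _ => α) (fun _ => β) lam x0 (fun s => A s ω) t)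
    (hv : ∀ t ω, v t ω = gradEst f g r τ (fun _ => α) (fun _ => β) lam x0 (fun s => A s ω) t)
    (hzm : ∀ t ≤ T, Measurable[past n t] (z t))
    (hdm : ∀ t < T, Measurable fun ω => ‖v t ω - gradient (smoothPart f gbar) (z t ω)‖ ^ 2)
    (hzi : ∀ t < T, Integrable (fun ω => ‖z (t + 1) ω - z t ω‖ ^ 2) P) :
    ∑ t ∈ Finset.range T, ∫ ω, ‖v t ω - gradient (smoothPart f gbar) (z t ω)‖ ^ 2 ∂P
      ≤ T * (2 * lf ^ 2 * c2 + 2 * (lg ^ 2 * Lf ^ 2) * c1)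
        + constG0 lf Lf lg Lg * ∑ t ∈ Finset.range T, ∫ ω, ‖z (t + 1) ω - z t ω‖ ^ 2 ∂P := by
  have hpast : ∀ t ≤ T, past n t ≤ mΩ := fun t ht =>
    iSup₂_le fun s hs => hI.le s (hs.trans_le ht)
  set S : ℕ → Ω → State d p := fun t ω =>
    iterate f g r τ (fun _ => α) (fun _ => β) lam x0 (fun s => A s ω) t with hS
  have hSm := fun t (ht : t ≤ T) =>
    measurable_iterate H hM U1.measurable U2.measurable τ x0 ht
  set q : ℕ → ℝ := fun t => ∫ ω, ‖z (t + 1) ω - z t ω‖ ^ 2 ∂P with hqdef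
  have hq0 : ∀ s, 0 ≤ q s := fun s => integral_nonneg fun ω => sq_nonneg _
  have hq : ∀ t, t + 1 < T →
      ∫⁻ ω, ‖z (t + 1) ω - z t ω‖ₑ ^ 2 ∂P ≤ ENNReal.ofReal (q t) := fun t ht =>
    (lintegral_enorm_sq_eq (hzi t (Nat.lt_of_succ_lt ht))).le
  have hmod : ∀ (c : ℝ) (l : NNReal) (t : ℕ), 0 ≤ c →
      0 ≤ c + ∑ i ∈ Finset.range (t % τ), (l : ℝ) ^ 2 / τ * q (t - 1 - i) := fun c l t hc =>
    add_nonneg hc (Finset.sum_nonneg fun i _ => mul_nonneg (by positivity) (hq0 _))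
  have E1 : ∀ t < T, ∫⁻ ω, ‖(S (t + 1) ω).gEst - gbar (z t ω)‖ₑ ^ 2 ∂P
      ≤ ENNReal.ofReal (c1 + ∑ i ∈ Finset.range (t % τ), lg ^ 2 / τ * q (t - 1 - i)) := by
    intro t ht
    refine U1.error_le hI.le hI.indep (est := fun t ω => (S t ω).gEst) (fun t ht => hzm t ht.le)
      (fun t ht => (hSm t ht).2.2.2.1) ?_ ?_ hq0 hq ht
    · intro t _ h0 ω
      simp only [hS, gEst_succ, if_pos h0, hz]
    · intro t _ h0 ω
      simp only [hS, gEst_succ (t := t + 1), if_neg h0, hz]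
      rfl
  have E2 : ∀ t < T, ∫⁻ ω, ‖matVec (S (t + 1) ω).jacEst - jacVec gbar (z t ω)‖ₑ ^ 2 ∂P
      ≤ ENNReal.ofReal (c2 + ∑ i ∈ Finset.range (t % τ), Lg ^ 2 / τ * q (t - 1 - i)) := by
    intro t ht
    refine U2.error_le hI.le hI.indep (est := fun t ω => matVec (S t ω).jacEst)
      (fun t ht => hzm t ht.le) (fun t ht => (hSm t ht).2.2.2.2) ?_ ?_ hq0 hq ht
    · intro t _ h0 ω
      simp only [hS, matVec_jacEst_succ, if_pos h0, hz]
    · intro t _ h0 ω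
      simp only [hS, matVec_jacEst_succ (t := t + 1), if_neg h0, hz]
      rfl
  have D : ∀ t < T, ∫ ω, ‖v t ω - gradient (smoothPart f gbar) (z t ω)‖ ^ 2 ∂P
      ≤ 2 * lf ^ 2 * (c2 + ∑ i ∈ Finset.range (t % τ), Lg ^ 2 / τ * q (t - 1 - i))
        + 2 * (lg ^ 2 * Lf ^ 2)
          * (c1 + ∑ i ∈ Finset.range (t % τ), lg ^ 2 / τ * q (t - 1 - i)) := by
    intro t ht
    have hb1 := hmod c1 lg t U1.nonneg
    have hb2 := hmod c2 Lg t U2.nonneg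
    have hme : Measurable fun ω => ‖matVec (S (t + 1) ω).jacEst - jacVec gbar (z t ω)‖ₑ ^ 2 :=
      continuous_enorm_sq.measurable.comp
        (((hSm (t + 1) ht).2.2.2.2.mono (hpast _ ht) le_rfl).sub
          (U2.lipschitz_mean.continuous.measurable.comp ((hzm t ht.le).mono (hpast _ ht.le) le_rfl)))
    -- The estimator errors are bounded as extended integrals, so no integrability of `gEst` has to
    -- be established.
    rw [integral_eq_lintegral_of_nonneg_ae (.of_forall fun ω => sq_nonneg _)
      (hdm t ht).aestronglyMeasurable]
    refine ENNReal.toReal_le_of_le_ofReal (by positivity) ?_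
    have hp : ∀ ω, ENNReal.ofReal (‖v t ω - gradient (smoothPart f gbar) (z t ω)‖ ^ 2)
        ≤ ENNReal.ofReal (2 * lf ^ 2) * ‖matVec (S (t + 1) ω).jacEst - jacVec gbar (z t ω)‖ₑ ^ 2
          + ENNReal.ofReal (2 * (lg ^ 2 * Lf ^ 2))
            * ‖(S (t + 1) ω).gEst - gbar (z t ω)‖ₑ ^ 2 := by
      intro ω
      rw [enorm_sq_eq_ofReal, enorm_sq_eq_ofReal, ← ENNReal.ofReal_mul (by positivity),
        ← ENNReal.ofReal_mul (by positivity), ← ENNReal.ofReal_add (by positivity) (by positivity)]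
      refine ENNReal.ofReal_le_ofReal ?_
      rw [hv]
      exact norm_gradient_estimate_sub_sq_le H.f_diff H.f_lipschitz H.f_smooth hg
        U1.lipschitz_mean _ _ _
    refine (lintegral_mono hp).trans ?_
    rw [lintegral_add_left (hme.const_mul _), lintegral_const_mul' _ _ ENNReal.ofReal_ne_top,
      lintegral_const_mul' _ _ ENNReal.ofReal_ne_top, ENNReal.ofReal_add (by positivity)
      (by positivity), ENNReal.ofReal_mul (p := 2 * lf ^ 2) (by positivity),
      ENNReal.ofReal_mul (p := 2 * (lg ^ 2 * Lf ^ 2)) (by positivity)]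
    exact add_le_add (mul_le_mul_right (E2 t ht) _) (mul_le_mul_right (E1 t ht) _)
  refine (Finset.sum_le_sum fun t ht => D t (Finset.mem_range.1 ht)).trans ?_
  have hs := sum_epoch_le hq0 hτ T
  have hτ' : (0 : ℝ) < τ := by exact_mod_cast hτ
  simp only [← Finset.mul_sum]
  set Q := ∑ t ∈ Finset.range T, ∑ i ∈ Finset.range (t % τ), q (t - 1 - i) with hQ
  -- The two weights combine to 2·lf²·Lg² + 2·lg²·Lf²·lg² = `constG0`.
  have e1 : ∑ t ∈ Finset.range T,
        (2 * (lf : ℝ) ^ 2 * (c2 + Lg ^ 2 / τ * ∑ i ∈ Finset.range (t % τ), q (t - 1 - i))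
        + 2 * ((lg : ℝ) ^ 2 * Lf ^ 2)
          * (c1 + lg ^ 2 / τ * ∑ i ∈ Finset.range (t % τ), q (t - 1 - i)))
      = T * (2 * lf ^ 2 * c2 + 2 * (lg ^ 2 * Lf ^ 2) * c1)
        + constG0 lf Lf lg Lg * (Q / τ) := by
    have : ∀ t : ℕ, (2 * (lf : ℝ) ^ 2
          * (c2 + Lg ^ 2 / τ * ∑ i ∈ Finset.range (t % τ), q (t - 1 - i))
        + 2 * ((lg : ℝ) ^ 2 * Lf ^ 2)
          * (c1 + lg ^ 2 / τ * ∑ i ∈ Finset.range (t % τ), q (t - 1 - i)))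
        = (2 * lf ^ 2 * c2 + 2 * (lg ^ 2 * Lf ^ 2) * c1)
          + constG0 lf Lf lg Lg / τ * ∑ i ∈ Finset.range (t % τ), q (t - 1 - i) := by
      intro t
      rw [constG0]
      ring
    simp only [this]
    rw [Finset.sum_add_distrib, ← Finset.mul_sum, ← hQ]
    simp
    ring
  rw [e1]
  have hG : 0 ≤ constG0 lf Lf lg Lg := by rw [constG0]; positivity
  gcongr
  rw [div_le_iff₀ hτ', mul_comm]
  exact hs

/-- The convergence rate of the momentum method with variance reduction. -/
theorem convergence_rate (H : SmoothnessAssumption f g gbar r lf Lf lg Lg)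
    (hg : Differentiable ℝ gbar)
    (hM : ConstantMomentum (constLF lf Lf lg Lg) (constG0 lf Lf lg Lg) α β lam) (hτ : 0 < τ)
    (hT : 1 ≤ T) (hI : IndependentBatches P n T ζ)
    (U1 : UnbiasedBatches P n A T τ g gbar lg c1)
    (U2 : UnbiasedBatches P n A T τ (fun ξ => jacVec (g ξ)) (jacVec gbar) Lg c2) (x0 : E d)
    {c : ℝ} (hc : 2 * lf ^ 2 * c2 + 2 * (lg ^ 2 * Lf ^ 2) * c1 ≤ c) {z : ℕ → Ω → E d}
    (hz : ∀ t ω, z t ω = zIter f g r τ (fun _ => α) (fun _ => β) lam x0 (fun s => A s ω) t) :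
    Integrable (fun ω => ‖gradMapping (lam (ζ ω)) r (smoothPart f gbar) (z (ζ ω) ω)‖) P ∧
    Integrable (fun ω => ‖gradMapping (lam (ζ ω)) r (smoothPart f gbar) (z (ζ ω) ω)‖ ^ 2) P ∧
    ∫ ω, ‖gradMapping (lam (ζ ω)) r (smoothPart f gbar) (z (ζ ω) ω)‖ ^ 2 ∂P
      ≤ 112 * ((objective f gbar r x0 - ⨅ w, objective f gbar r w) / (T * β)) + 227 * c := by
  set F := smoothPart f gbar with hF
  have hpast : ∀ t ≤ T, past n t ≤ mΩ := fun t ht =>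
    iSup₂_le fun s hs => hI.le s (hs.trans_le ht)
  set S : ℕ → Ω → State d p := fun t ω =>
    iterate f g r τ (fun _ => α) (fun _ => β) lam x0 (fun s => A s ω) t with hS
  set v : ℕ → Ω → E d := fun t ω =>
    gradEst f g r τ (fun _ => α) (fun _ => β) lam x0 (fun s => A s ω) t with hv
  have hFd : Differentiable ℝ F := H.f_diff.comp hg
  have hFL := lipschitzWith_gradient_smoothPart H.f_diff H.f_lipschitz H.f_smooth hg
    U1.lipschitz_mean U2.lipschitz_mean
  rw [← hF] at hFL
  have hLF : 0 ≤ constLF lf Lf lg Lg := by rw [constLF]; positivity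
  have hG : 0 ≤ constG0 lf Lf lg Lg := by rw [constG0]; positivity
  have hβ := hM.β_pos
  have hTr : ∀ ω, Trajectory r α β lam (fun t => (S t ω).x) (fun t => (S t ω).y)
      (fun t => z t ω) (fun t => v t ω) := fun ω => by
    simp only [hz]
    exact trajectory_iterate τ x0 fun s => A s ω
  have hSm := fun t (ht : t ≤ T) =>
    measurable_iterate H hM U1.measurable U2.measurable τ x0 ht
  have hzm : ∀ t ≤ T, Measurable[past n t] (z t) := fun t ht => by
    have e : z t = fun ω => (1 - α) • (S t ω).y + α • (S t ω).x :=
      funext fun ω => (hTr ω).extrapolate t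
    rw [e]
    exact ((hSm t ht).2.1.const_smul (1 - α)).add ((hSm t ht).1.const_smul α)
  have hzm' : ∀ t ≤ T, Measurable (z t) := fun t ht => (hzm t ht).mono (hpast t ht) le_rfl
  have hxm : ∀ t ≤ T, Measurable fun ω => (S t ω).x := fun t ht =>
    (hSm t ht).1.mono (hpast t ht) le_rfl
  have hdm : ∀ t < T, Measurable fun ω => ‖v t ω - gradient F (z t ω)‖ ^ 2 := fun t ht =>
    (((measurable_transposeMul ((hSm (t + 1) ht).2.2.2.2.mono (hpast _ ht) le_rfl)
      (H.f_smooth.continuous.measurable.comp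
        ((hSm (t + 1) ht).2.2.2.1.mono (hpast _ ht) le_rfl))).sub
      (hFL.continuous.measurable.comp (hzm' t ht.le))).norm).pow_const 2
  -- Uniform bounds make all the squared quantities below integrable, so the pathwise inequalities
  -- may be averaged.
  choose K hK0 hK using exists_bound_iterate H hM τ x0
  have hxb : ∀ t ω, ‖(S t ω).x‖ ≤ K t := fun t ω => (hK t _).1
  have hzb : ∀ t ω, ‖z t ω‖ ≤ K t := fun t ω => by
    rw [hz]
    exact norm_extrapolate_le hM.α_pos.le hM.α_le_one (hK t _).1 (hK t _).2.1
  have hdb : ∀ t ω, ‖v t ω - gradient F (z t ω)‖ ≤ K (t + 1) * lf + lg * lf := fun t ω => by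
    refine (norm_sub_le _ _).trans (add_le_add ?_ ?_)
    · refine (norm_transposeMul_le _ _).trans ?_
      exact mul_le_mul (hK (t + 1) _).2.2 (norm_gradient_le H.f_lipschitz _) (norm_nonneg _)
        (hK0 _)
    · rw [hF, gradient_comp_eq H.f_diff hg]
      refine (norm_transposeMul_jacobian_le U1.lipschitz_mean _ _).trans ?_
      gcongr
      exact norm_gradient_le H.f_lipschitz _
  have hzi : ∀ t < T, Integrable (fun ω => ‖z (t + 1) ω - z t ω‖ ^ 2) P := fun t ht =>
    integrable_of_measurable_of_bound ((((hzm' _ ht).sub (hzm' _ ht.le)).norm).pow_const 2)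
      (fun ω => sq_nonneg _) (K := (K (t + 1) + K t) ^ 2) fun ω =>
      pow_le_pow_left₀ (norm_nonneg _)
        ((norm_sub_le _ _).trans (add_le_add (hzb _ ω) (hzb _ ω))) 2
  have hxi : ∀ t < T, Integrable (fun ω => ‖(S (t + 1) ω).x - (S t ω).x‖ ^ 2) P := fun t ht =>
    integrable_of_measurable_of_bound ((((hxm _ ht).sub (hxm _ ht.le)).norm).pow_const 2)
      (fun ω => sq_nonneg _) (K := (K (t + 1) + K t) ^ 2) fun ω =>
      pow_le_pow_left₀ (norm_nonneg _)
        ((norm_sub_le _ _).trans (add_le_add (hxb _ ω) (hxb _ ω))) 2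
  have hdi : ∀ t < T, Integrable (fun ω => ‖v t ω - gradient F (z t ω)‖ ^ 2) P := fun t ht =>
    integrable_of_measurable_of_bound (hdm t ht) (fun ω => sq_nonneg _)
      (K := (K (t + 1) * lf + lg * lf) ^ 2) fun ω =>
      pow_le_pow_left₀ (norm_nonneg _) (hdb t ω) 2
  have hGc : ∀ t, Continuous fun w => ‖gradMapping (lam t) r F w‖ := fun t => by
    have h1 := continuous_prox H.r_convex (hM.lam_pos t)
    have h2 := hFL.continuous
    unfold gradMapping
    fun_prop
  have hGm : ∀ t < T, Measurable[past n T] fun ω => ‖gradMapping (lam t) r F (z t ω)‖ :=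
    fun t ht => (hGc t).measurable.comp ((hzm t ht.le).mono (past_mono ht.le) le_rfl)
  have hGb : ∀ t, ∃ B, ∀ ω, ‖gradMapping (lam t) r F (z t ω)‖ ≤ B := fun t => by
    obtain ⟨B, hB⟩ := (isCompact_closedBall (0 : E d) (K t)).exists_bound_of_continuousOn
      (hGc t).continuousOn
    refine ⟨B, fun ω => ?_⟩
    simpa using hB (z t ω) (by simpa using hzb t ω)
  choose B hB using hGb
  have hGi : ∀ t < T, Integrable (fun ω => ‖gradMapping (lam t) r F (z t ω)‖) P := fun t ht =>
    integrable_of_measurable_of_bound ((hGm t ht).mono (hpast T le_rfl) le_rfl)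
      (fun ω => norm_nonneg _) (hB t)
  have hGi2 : ∀ t < T, Integrable (fun ω => ‖gradMapping (lam t) r F (z t ω)‖ ^ 2) P :=
    fun t ht => integrable_of_measurable_of_bound
      (((hGm t ht).mono (hpast T le_rfl) le_rfl).pow_const 2) (fun ω => sq_nonneg _)
      fun ω => pow_le_pow_left₀ (norm_nonneg _) (hB t ω) 2
  have hR1 := integral_random_index hI.output_measurable hI.output_uniform hI.output_indep hGm hGi
  have hR2 := integral_random_index hI.output_measurable hI.output_uniform hI.output_indep
    (fun t ht => (hGm t ht).pow_const 2) hGi2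
  refine ⟨hR1.1, hR2.1, ?_⟩
  rw [hR2.2]
  have herr := sum_integral_gradient_error_le H hg hM hτ hI U1 U2 x0 (v := v) hz
    (fun _ _ => rfl) hzm hdm hzi
  have hstep : 1 / 4 * ∑ t ∈ Finset.range T, ∫ ω, ‖(S (t + 1) ω).x - (S t ω).x‖ ^ 2 ∂P
      ≤ β * (objective f gbar r x0 - ⨅ w, objective f gbar r w)
        + 2 * β ^ 2 * ∑ t ∈ Finset.range T, ∫ ω, ‖v t ω - gradient F (z t ω)‖ ^ 2 ∂P := by
    rw [← integral_finsetSum _ fun t ht => hxi t (Finset.mem_range.1 ht),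
      ← integral_finsetSum _ fun t ht => hdi t (Finset.mem_range.1 ht), ← integral_const_mul,
      ← integral_const_mul]
    have hi1 := (integrable_finsetSum _ fun t ht => hxi t (Finset.mem_range.1 ht)).const_mul (1 / 4)
    have hi2 := (integrable_finsetSum _ fun t ht =>
      hdi t (Finset.mem_range.1 ht)).const_mul (2 * β ^ 2)
    have := integral_mono hi1 ((integrable_const
      (β * (objective f gbar r x0 - ⨅ w, objective f gbar r w))).add hi2) fun ω =>
      (hTr ω).sum_norm_step_sq_le hM H.r_convex hFd hFL
        (by simpa [constLF] using hM.β_mul_LF_le hLF hG) H.bddBelow T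
    refine this.trans_eq ?_
    simp only [Pi.add_apply]
    rw [integral_add (integrable_const _) hi2]
    simp
  have hzs : ∑ t ∈ Finset.range T, ∫ ω, ‖z (t + 1) ω - z t ω‖ ^ 2 ∂P
      ≤ 17 / 8 * ∑ t ∈ Finset.range T, ∫ ω, ‖(S (t + 1) ω).x - (S t ω).x‖ ^ 2 ∂P := by
    rw [← integral_finsetSum _ fun t ht => hxi t (Finset.mem_range.1 ht),
      ← integral_finsetSum _ fun t ht => hzi t (Finset.mem_range.1 ht), ← integral_const_mul]
    exact integral_mono (integrable_finsetSum _ fun t ht => hzi t (Finset.mem_range.1 ht))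
      ((integrable_finsetSum _ fun t ht => hxi t (Finset.mem_range.1 ht)).const_mul _)
      fun ω => (hTr ω).sum_norm_extrapolate_succ_sub_sq_le hM T
  have hgm : β ^ 2 * ∑ t ∈ Finset.range T, ∫ ω, ‖gradMapping (lam t) r F (z t ω)‖ ^ 2 ∂P
      ≤ 15 * ∑ t ∈ Finset.range T, ∫ ω, ‖(S (t + 1) ω).x - (S t ω).x‖ ^ 2 ∂P
        + 3 * β ^ 2 * ∑ t ∈ Finset.range T, ∫ ω, ‖v t ω - gradient F (z t ω)‖ ^ 2 ∂P := by
    rw [← integral_finsetSum _ fun t ht => hxi t (Finset.mem_range.1 ht),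
      ← integral_finsetSum _ fun t ht => hdi t (Finset.mem_range.1 ht),
      ← integral_finsetSum _ fun t ht => hGi2 t (Finset.mem_range.1 ht), ← integral_const_mul,
      ← integral_const_mul, ← integral_const_mul]
    have hi1 := (integrable_finsetSum _ fun t ht => hxi t (Finset.mem_range.1 ht)).const_mul 15
    have hi2 := (integrable_finsetSum _ fun t ht =>
      hdi t (Finset.mem_range.1 ht)).const_mul (3 * β ^ 2)
    rw [← integral_add hi1 hi2]
    exact integral_mono ((integrable_finsetSum _ fun t ht =>
      hGi2 t (Finset.mem_range.1 ht)).const_mul _) (hi1.add hi2)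
      fun ω => (hTr ω).sum_norm_gradMapping_sq_le hM H.r_convex T
  have hX0 : 0 ≤ ∑ t ∈ Finset.range T, ∫ ω, ‖(S (t + 1) ω).x - (S t ω).x‖ ^ 2 ∂P :=
    Finset.sum_nonneg fun t _ => integral_nonneg fun ω => sq_nonneg _
  have hZ0 : 0 ≤ ∑ t ∈ Finset.range T, ∫ ω, ‖z (t + 1) ω - z t ω‖ ^ 2 ∂P :=
    Finset.sum_nonneg fun t _ => integral_nonneg fun ω => sq_nonneg _
  have hβG := hM.β_sq_mul_G0_le hLF hG
  have hT0 : (0 : ℝ) < T := by exact_mod_cast hT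
  set Gs := ∑ t ∈ Finset.range T, ∫ ω, ‖gradMapping (lam t) r F (z t ω)‖ ^ 2 ∂P
  set Xs := ∑ t ∈ Finset.range T, ∫ ω, ‖(S (t + 1) ω).x - (S t ω).x‖ ^ 2 ∂P
  set Zs := ∑ t ∈ Finset.range T, ∫ ω, ‖z (t + 1) ω - z t ω‖ ^ 2 ∂P
  set Ds := ∑ t ∈ Finset.range T, ∫ ω, ‖v t ω - gradient F (z t ω)‖ ^ 2 ∂P
  set Δ := objective f gbar r x0 - ⨅ w, objective f gbar r w
  set G0 := constG0 lf Lf lg Lg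
  -- The increments return with the small factor β²G_0 ≤ 1/48.
  have hD : β ^ 2 * Ds ≤ β ^ 2 * (T * c) + 1 / 48 * Zs := by
    have h1 : Ds ≤ T * c + G0 * Zs :=
      herr.trans (add_le_add (mul_le_mul_of_nonneg_left hc hT0.le) le_rfl)
    have h2 := mul_le_mul_of_nonneg_left h1 (sq_nonneg β)
    have h3 := mul_le_mul_of_nonneg_right hβG hZ0
    nlinarith
  -- Since `Zs ≤ 17/8 * Xs`, the feedback is 17/192 of `Xs`, and 1/4 - 17/192 = 31/192 > 1/7.
  have hX : Xs ≤ 7 * (β * Δ + 2 * (β ^ 2 * (T * c))) := by linarith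
  -- As 15 + 3 · 17/384 < 16, the coefficients are 16 · 7 = 112 and 2 · 112 + 3 = 227.
  have hGs : β ^ 2 * Gs ≤ 112 * (β * Δ) + 227 * (β ^ 2 * (T * c)) := by linarith
  have hfin : β ^ 2 * (T * ((T : ℝ)⁻¹ * Gs)) ≤ β ^ 2 * (T * (112 * (Δ / (T * β)) + 227 * c)) := by
    rw [mul_inv_cancel_left₀ hT0.ne']
    refine hGs.trans_eq ?_
    field_simp
  exact le_of_mul_le_mul_left (le_of_mul_le_mul_left hfin (by positivity)) hT0

end Rate

/-! ### Uniformly random subsets: mean and variance by counting. -/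

section Subsets

variable {ι V : Type*} [Fintype ι] [NormedAddCommGroup V] [InnerProductSpace ℝ V]

theorem sum_powersetCard_sum [DecidableEq ι] {b : ℕ} (hb : 1 ≤ b) (c : ι → V) :
    ∑ s ∈ Finset.powersetCard b (Finset.univ : Finset ι), ∑ i ∈ s, c i
      = ((Fintype.card ι - 1).choose (b - 1) : ℝ) • ∑ i, c i := by
  have h1 : ∀ s : Finset ι, ∑ i ∈ s, c i = ∑ i, if {i} ⊆ s then c i else 0 := by
    intro s
    simp
  simp only [h1]
  rw [Finset.sum_comm, Finset.smul_sum]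
  refine Finset.sum_congr rfl fun i _ => ?_
  rw [← Finset.sum_filter, Finset.sum_const,
    Finset.card_filter_powersetCard_subset _ _ _ (Finset.subset_univ _) (by simpa using hb)]
  simp [← Nat.cast_smul_eq_nsmul ℝ]

/-- Sampling without replacement does not increase the variance. All pairs i ≠ j lie in the same
number `K2` of subsets; completing the diagonal turns the cross terms into K2‖Σc‖² = 0 and leaves
(K1 - K2)Σ‖c_i‖². Counting pairs requires `2 ≤ b`. -/
theorem sum_powersetCard_norm_sum_sq_le [DecidableEq ι] {b : ℕ} (hb : 2 ≤ b)
    {c : ι → V} (hc : ∑ i, c i = 0) :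
    ∑ s ∈ Finset.powersetCard b (Finset.univ : Finset ι), ‖∑ i ∈ s, c i‖ ^ 2
      ≤ ((Fintype.card ι - 1).choose (b - 1) : ℝ) * ∑ i, ‖c i‖ ^ 2 := by
  set K1 : ℝ := ((Fintype.card ι - 1).choose (b - 1) : ℝ)
  set K2 : ℝ := ((Fintype.card ι - 2).choose (b - 2) : ℝ)
  have h1 : ∀ s : Finset ι, ‖∑ i ∈ s, c i‖ ^ 2
      = ∑ i, ∑ j, if {i, j} ⊆ s then inner ℝ (c i) (c j) else 0 := by
    intro s
    rw [← real_inner_self_eq_norm_sq, sum_inner]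
    simp only [inner_sum, Finset.insert_subset_iff, Finset.singleton_subset_iff, ite_and]
    rw [← Finset.sum_subset (Finset.subset_univ s) fun i _ hi => by simp [hi]]
    refine Finset.sum_congr rfl fun i hi => ?_
    simp [hi]
  have h2 : ∀ i j, (∑ s ∈ Finset.powersetCard b (Finset.univ : Finset ι),
      if {i, j} ⊆ s then inner ℝ (c i) (c j) else 0)
      = K2 * inner ℝ (c i) (c j) + if i = j then (K1 - K2) * ‖c i‖ ^ 2 else 0 := by
    intro i j
    rw [← Finset.sum_filter, Finset.sum_const]
    by_cases hij : i = j
    · subst hij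
      rw [Finset.card_filter_powersetCard_subset _ _ _ (Finset.subset_univ _) (by simp; omega)]
      simp [K1]
      ring
    · rw [Finset.card_filter_powersetCard_subset _ _ _ (Finset.subset_univ _)
        (by rw [Finset.card_pair hij]; exact hb), Finset.card_pair hij]
      simp [hij, K2]
  simp only [h1]
  rw [Finset.sum_comm]
  have h3 : ∀ i, ∑ s ∈ Finset.powersetCard b (Finset.univ : Finset ι), ∑ j,
      (if {i, j} ⊆ s then inner ℝ (c i) (c j) else 0) = (K1 - K2) * ‖c i‖ ^ 2 := by
    intro i
    rw [Finset.sum_comm]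
    simp only [h2]
    rw [Finset.sum_add_distrib, ← Finset.mul_sum, ← inner_sum, hc]
    simp
  simp only [h3]
  rw [← Finset.mul_sum]
  gcongr
  have : 0 ≤ K2 := Nat.cast_nonneg _
  linarith

theorem sum_norm_sub_mean_sq_le (φ : ι → V) :
    ∑ i, ‖φ i - (Fintype.card ι : ℝ)⁻¹ • ∑ j, φ j‖ ^ 2 ≤ ∑ i, ‖φ i‖ ^ 2 := by
  rcases isEmpty_or_nonempty ι with h | h
  · simp
  set m := (Fintype.card ι : ℝ)⁻¹ • ∑ j, φ j with hm
  have hN : (Fintype.card ι : ℝ) ≠ 0 := by exact_mod_cast Fintype.card_ne_zero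
  have h1 : ∑ j, φ j = (Fintype.card ι : ℝ) • m := by rw [hm, smul_inv_smul₀ hN]
  have h2 : ∀ i, ‖φ i - m‖ ^ 2 = ‖φ i‖ ^ 2 - 2 * inner ℝ (φ i) m + ‖m‖ ^ 2 :=
    fun i => norm_sub_sq_real _ _
  simp only [h2]
  rw [Finset.sum_add_distrib, Finset.sum_sub_distrib, ← Finset.mul_sum, ← sum_inner, h1,
    real_inner_smul_left, real_inner_self_eq_norm_sq]
  simp only [Finset.sum_const, Finset.card_univ, nsmul_eq_mul]
  have : 0 ≤ (Fintype.card ι : ℝ) * ‖m‖ ^ 2 := by positivity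
  linarith

end Subsets

/-! ### Independence of a batch from its past. -/

section Independence

variable {Ω : Type*} [mΩ : MeasurableSpace Ω] {P : Measure Ω}

/-- The map `π` assigns to each sample its iteration; earlier and current samples are disjoint
groups of an independent family. Both sampling schemes are instances. -/
theorem indep_past {ι : Type*} {m : ι → MeasurableSpace Ω} (hm : ∀ q, m q ≤ mΩ)
    (hind : iIndep m P) {n : ℕ → MeasurableSpace Ω} {T : ℕ} {π : ι → ℕ}
    (hn : ∀ t < T, n t ≤ ⨆ q ∈ {q | π q = t}, m q) {t : ℕ} (ht : t < T) :
    Indep (past n t) (n t) P := by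
  have hd : Disjoint {q | π q < t} {q | π q = t} := by
    rw [Set.disjoint_left]
    intro q h1 h2
    simp only [Set.mem_ofPred_eq] at h1 h2
    omega
  refine indep_of_indep_of_le (indep_iSup_of_disjoint hm hind hd) ?_ (hn t ht)
  refine iSup₂_le fun s hs => (hn s (hs.trans ht)).trans ?_
  refine iSup₂_le fun q hq => le_iSup₂_of_le q ?_ le_rfl
  simp only [Set.mem_ofPred_eq] at hq ⊢
  omega

end Independence

/-! ### Finite-sum sampling. -/

section FiniteSum

theorem batchMean_univ {n : ℕ} {V : Type*} [AddCommGroup V] [Module ℝ V] (φ : Fin n → V) :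
    batchMean (Finset.univ : Finset (Fin n)).val φ = (n : ℝ)⁻¹ • ∑ i, φ i := by
  rw [batchMean, Finset.card_val, Finset.card_univ, Fintype.card_fin]
  rfl

/-- If `Nat.sqrt n = 1`, every iteration is a refresh; hence the pair count for random subsets is
always applicable when needed. -/
theorem two_le_sqrt_of_mod_ne_zero {n t : ℕ} (hn : 1 ≤ n) (h : t % Nat.sqrt n ≠ 0) :
    2 ≤ Nat.sqrt n := by
  have h1 : 0 < Nat.sqrt n := Nat.sqrt_pos.2 hn
  by_contra hb
  have h2 : Nat.sqrt n = 1 := by omega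
  rw [h2] at h
  exact h (Nat.mod_one t)

/-- An index lies in a uniformly random `b`-subset with probability `b / n`. The default proof of
`hbn` covers `b = Nat.sqrt n`. -/
theorem inv_choose_mul_choose {n b : ℕ} (hn : 1 ≤ n) (hb : 1 ≤ b) (hbn : b ≤ n := by
    exact Nat.sqrt_le_self _) :
    (n.choose b : ℝ)⁻¹ * (b : ℝ)⁻¹ * ((n - 1).choose (b - 1) : ℝ) = (n : ℝ)⁻¹ := by
  obtain ⟨m, rfl⟩ := Nat.exists_eq_add_of_le' hn
  obtain ⟨k, rfl⟩ := Nat.exists_eq_add_of_le' hb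
  have h1 := Nat.add_one_mul_choose_eq m k
  have h2 : ((m + 1).choose (k + 1) : ℝ) ≠ 0 := by exact_mod_cast (Nat.choose_pos hbn).ne'
  have h3 : ((m + 1 : ℕ) : ℝ) * (m.choose k : ℝ)
      = ((m + 1).choose (k + 1) : ℝ) * ((k + 1 : ℕ) : ℝ) := by
    exact_mod_cast h1
  have h4 : ((m + 1 : ℕ) : ℝ) ≠ 0 := by positivity
  have h5 : ((k + 1 : ℕ) : ℝ) ≠ 0 := by positivity
  simp only [Nat.add_sub_cancel]
  field_simp
  linarith

variable {Ω : Type*} [mΩ : MeasurableSpace Ω] {P : Measure Ω} {n T : ℕ} {A : ℕ → Ω → Finset (Fin n)} {ζ : Ω → Fin T}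

theorem FiniteSumSampling.measurable_batch (H : FiniteSumSampling P n T A ζ) {t : ℕ}
    (ht : t < T) : Measurable (A t) :=
  measurable_to_countable' fun s => H.measurable t ht s

theorem FiniteSumSampling.independentBatches (H : FiniteSumSampling P n T A ζ) :
    IndependentBatches P (fun t => MeasurableSpace.comap (A t) inferInstance) T ζ where
  le t ht := (H.measurable_batch ht).comap_le
  indep t ht := by
    refine indep_past (T := T) (π := fun q : Fin T => (q : ℕ))
      (fun q => (H.measurable_batch q.2).comap_le) H.indep.iIndep ?_ ht
    intro t ht
    exact le_iSup₂_of_le (⟨t, ht⟩ : Fin T) rfl le_rfl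
  output_measurable := H.output_measurable
  output_uniform := H.output_uniform
  output_indep := by
    have h := (IndepFun_iff_Indep _ _ _).1 H.output_indep
    refine indep_of_indep_of_le_left h.symm (iSup₂_le fun s hs => ?_)
    have e : A s = (fun q : Fin T → Finset (Fin n) => q ⟨s, hs⟩)
        ∘ fun ω (t : Fin T) => A t ω := rfl
    change MeasurableSpace.comap (A s) inferInstance ≤ _
    rw [e, ← MeasurableSpace.comap_comp]
    exact MeasurableSpace.comap_mono (measurable_pi_apply _).comap_le

variable [IsProbabilityMeasure P]

/-- The prescribed masses of the subsets of the right size already add up to 1, so all other subsets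
are null. -/
theorem FiniteSumSampling.measure_eq (H : FiniteSumSampling P n T A ζ) {t : ℕ} (ht : t < T)
    (h0 : t % Nat.sqrt n ≠ 0) (s : Finset (Fin n)) :
    P {ω | A t ω = s}
      = if s.card = Nat.sqrt n then ((n.choose (Nat.sqrt n) : ℕ) : ENNReal)⁻¹ else 0 := by
  split_ifs with hs
  · exact H.uniform t ht h0 s hs
  have h1 : ∑ s : Finset (Fin n), P {ω | A t ω = s} = 1 := by
    have := sum_measure_preimage_singleton (μ := P) (f := A t) Finset.univ
      fun s _ => H.measurable t ht s
    refine this.trans ?_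
    simp
  rw [← Finset.sum_filter_add_sum_filter_not _ (fun s => s.card = Nat.sqrt n)] at h1
  have h2 : ∑ s ∈ Finset.univ.filter (fun s : Finset (Fin n) => s.card = Nat.sqrt n),
      P {ω | A t ω = s} = 1 := by
    rw [Finset.sum_congr rfl fun s hs => H.uniform t ht h0 s (Finset.mem_filter.1 hs).2,
      Finset.sum_const, Finset.univ_filter_card_eq, Finset.card_powersetCard]
    simp only [Finset.card_univ, Fintype.card_fin, nsmul_eq_mul]
    refine ENNReal.mul_inv_cancel ?_ (ENNReal.natCast_ne_top _)
    exact_mod_cast (Nat.choose_pos (Nat.sqrt_le_self n)).ne'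
  rw [h2] at h1
  have h3 : ∑ s ∈ Finset.univ.filter (fun s : Finset (Fin n) => ¬ s.card = Nat.sqrt n),
      P {ω | A t ω = s} = 0 :=
    (ENNReal.add_right_inj ENNReal.one_ne_top).1 (h1.trans (add_zero 1).symm)
  exact Finset.sum_eq_zero_iff.1 h3 s (by simpa using hs)

theorem FiniteSumSampling.ae_card (H : FiniteSumSampling P n T A ζ) :
    ∀ᵐ ω ∂P, ∀ t < T, t % Nat.sqrt n ≠ 0 → (A t ω).card = Nat.sqrt n := by
  rw [ae_all_iff]
  intro t
  by_cases ht : t < T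
  swap
  · exact .of_forall fun ω h => absurd h ht
  by_cases h0 : t % Nat.sqrt n = 0
  · exact .of_forall fun ω _ h => absurd h0 h
  have h1 : ∀ᵐ ω ∂P, ∀ s : Finset (Fin n), s.card ≠ Nat.sqrt n → A t ω ≠ s := by
    rw [ae_all_iff]
    intro s
    by_cases hs : s.card = Nat.sqrt n
    · exact .of_forall fun ω h => absurd hs h
    · have := H.measure_eq ht h0 s
      rw [if_neg hs] at this
      filter_upwards [measure_eq_zero_iff_ae_notMem.1 this] with ω hω _ using hω
  filter_upwards [h1] with ω hω _ _
  by_contra h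
  exact hω _ h rfl

theorem FiniteSumSampling.integral_comp {V : Type*} [NormedAddCommGroup V] [NormedSpace ℝ V]
    [CompleteSpace V] (H : FiniteSumSampling P n T A ζ) {t : ℕ} (ht : t < T)
    (h0 : t % Nat.sqrt n ≠ 0) (F : Finset (Fin n) → V) :
    Integrable (fun ω => F (A t ω)) P ∧ ∫ ω, F (A t ω) ∂P = (n.choose (Nat.sqrt n) : ℝ)⁻¹ •
      ∑ s ∈ Finset.powersetCard (Nat.sqrt n) Finset.univ, F s := by
  have hA := H.measurable_batch ht
  have hFs : StronglyMeasurable F := .of_discrete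
  have := Measure.isProbabilityMeasure_map (μ := P) hA.aemeasurable
  have hi : Integrable F (P.map (A t)) := Integrable.of_finite
  refine ⟨hi.comp_measurable hA, ?_⟩
  rw [← integral_map hA.aemeasurable hFs.aestronglyMeasurable, integral_fintype hi,
    Finset.smul_sum, ← Finset.univ_filter_card_eq, Finset.sum_filter]
  refine Finset.sum_congr rfl fun s _ => ?_
  have h1 : (P.map (A t)).real {s} = P.real {ω | A t ω = s} := by
    rw [map_measureReal_apply hA (measurableSet_singleton s)]
    rfl
  rw [h1, Measure.real, H.measure_eq ht h0]
  split_ifs <;> simp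

/-- Full batches are exact, hence the refresh error `0`. The other batches are as large as the epoch
is long, so their variance reduction is the required `1 / τ`. -/
theorem FiniteSumSampling.unbiasedBatches (H : FiniteSumSampling P n T A ζ) (hn : 1 ≤ n) {d : ℕ} {κ : Type*}
    [Fintype κ] {h : Fin n → E d → EuclideanSpace ℝ κ} {l : NNReal}
    (hl : ∀ i, LipschitzWith l (h i)) {hbar : E d → EuclideanSpace ℝ κ}
    (hbar_eq : ∀ z, hbar z = batchMean (Finset.univ : Finset (Fin n)).val fun i => h i z) :
    UnbiasedBatches P (fun t => MeasurableSpace.comap (A t) inferInstance)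
      (fun t ω => finiteBatch A ω t) T (Nat.sqrt n) h hbar l 0 where
  nonneg := le_rfl
  lipschitz := hl
  lipschitz_mean := by
    rw [funext hbar_eq]
    exact lipschitzWith_batchMean _ hl
  measurable t _ z := by
    have : Measurable fun s : Finset (Fin n) => batchMean s.val fun i => h i z := .of_discrete
    exact this.comp (comap_measurable (A t))
  fresh t ht h0 z := by
    simp [finiteBatch, H.full t ht h0, hbar_eq]
  unbiased t ht h0 z z' := by
    rw [hbar_eq, hbar_eq, ← batchMean_sub]
    set φ : Fin n → EuclideanSpace ℝ κ := fun i => h i z - h i z'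
    have hb := two_le_sqrt_of_mod_ne_zero hn h0
    refine (H.integral_comp ht h0 fun s => batchMean s.val φ).2.trans ?_
    have e : ∀ s ∈ Finset.powersetCard (Nat.sqrt n) (Finset.univ : Finset (Fin n)),
        batchMean s.val φ = (Nat.sqrt n : ℝ)⁻¹ • ∑ i ∈ s, φ i := fun s hs => by
      rw [← (Finset.mem_powersetCard.1 hs).2]
      rfl
    rw [Finset.sum_congr rfl e, ← Finset.smul_sum, sum_powersetCard_sum (by omega), smul_smul,
      smul_smul, Fintype.card_fin, inv_choose_mul_choose hn (by omega), batchMean_univ]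
  variance t ht h0 z z' := by
    rw [hbar_eq, hbar_eq, ← batchMean_sub]
    set φ : Fin n → EuclideanSpace ℝ κ := fun i => h i z - h i z'
    have hb := two_le_sqrt_of_mod_ne_zero hn h0
    set m := batchMean (Finset.univ : Finset (Fin n)).val φ with hm
    have hm' : m = (n : ℝ)⁻¹ • ∑ i, φ i := batchMean_univ φ
    have hb0 : (Nat.sqrt n : ℝ) ≠ 0 := by
      have : Nat.sqrt n ≠ 0 := by omega
      exact_mod_cast this
    have hn0 : (n : ℝ) ≠ 0 := by
      have : n ≠ 0 := by omega
      exact_mod_cast this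
    have hI := H.integral_comp ht h0 fun s => ‖batchMean s.val φ - m‖ ^ 2
    change ∫⁻ ω, ‖batchMean (A t ω).val φ - m‖ₑ ^ 2 ∂P ≤ _
    rw [lintegral_enorm_sq_eq hI.1, hI.2]
    refine ENNReal.ofReal_le_ofReal ?_
    have e : ∀ s ∈ Finset.powersetCard (Nat.sqrt n) (Finset.univ : Finset (Fin n)),
        ‖batchMean s.val φ - m‖ ^ 2
          = ((Nat.sqrt n : ℝ)⁻¹) ^ 2 * ‖∑ i ∈ s, (φ i - m)‖ ^ 2 := fun s hs => by
      have hs' := (Finset.mem_powersetCard.1 hs).2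
      have e1 : batchMean s.val φ - m = (Nat.sqrt n : ℝ)⁻¹ • ∑ i ∈ s, (φ i - m) := by
        rw [Finset.sum_sub_distrib, Finset.sum_const, hs', ← Nat.cast_smul_eq_nsmul ℝ, smul_sub,
          inv_smul_smul₀ hb0, ← hs']
        rfl
      rw [e1, norm_smul, mul_pow, Real.norm_eq_abs, sq_abs]
    rw [Finset.sum_congr rfl e, ← Finset.mul_sum, smul_eq_mul]
    have hc : ∑ i, (φ i - m) = 0 := by
      rw [Finset.sum_sub_distrib, Finset.sum_const, Finset.card_univ, Fintype.card_fin,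
        ← Nat.cast_smul_eq_nsmul ℝ, hm', smul_inv_smul₀ hn0, sub_self]
    have h1 := sum_powersetCard_norm_sum_sq_le hb hc
    have h2 : ∑ i, ‖φ i - m‖ ^ 2 ≤ ∑ i, ‖φ i‖ ^ 2 := by
      have := sum_norm_sub_mean_sq_le φ
      rwa [Fintype.card_fin, ← hm'] at this
    have h3 : ∑ i, ‖φ i‖ ^ 2 ≤ n * (l ^ 2 * ‖z - z'‖ ^ 2) := by
      refine (Finset.sum_le_sum fun i _ => ?_).trans_eq (b := ∑ _i : Fin n,
        ((l : ℝ) ^ 2 * ‖z - z'‖ ^ 2)) (by simp)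
      rw [← mul_pow]
      refine pow_le_pow_left₀ (norm_nonneg _) ?_ 2
      rw [← dist_eq_norm, ← dist_eq_norm]
      exact (hl i).dist_le_mul z z'
    rw [Fintype.card_fin] at h1
    calc (n.choose (Nat.sqrt n) : ℝ)⁻¹ * (((Nat.sqrt n : ℝ)⁻¹) ^ 2
          * ∑ s ∈ Finset.powersetCard (Nat.sqrt n) Finset.univ, ‖∑ i ∈ s, (φ i - m)‖ ^ 2)
        ≤ (n.choose (Nat.sqrt n) : ℝ)⁻¹ * (((Nat.sqrt n : ℝ)⁻¹) ^ 2
          * (((n - 1).choose (Nat.sqrt n - 1) : ℝ) * (n * (l ^ 2 * ‖z - z'‖ ^ 2)))) := by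
          gcongr
          exact h1.trans (mul_le_mul_of_nonneg_left (h2.trans h3) (Nat.cast_nonneg _))
      _ = ((n.choose (Nat.sqrt n) : ℝ)⁻¹ * (Nat.sqrt n : ℝ)⁻¹
            * ((n - 1).choose (Nat.sqrt n - 1) : ℝ))
          * (n * (Nat.sqrt n : ℝ)⁻¹ * (l ^ 2 * ‖z - z'‖ ^ 2)) := by ring
      _ = l ^ 2 / Nat.sqrt n * ‖z - z'‖ ^ 2 := by
          rw [inv_choose_mul_choose hn (by omega)]
          field_simp

end FiniteSum

section FiniteMean

variable {d p n : ℕ} {g : Fin n → E d → E p}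

theorem finiteMean_eq_batchMean (g : Fin n → E d → E p) (z : E d) :
    finiteMean g z = batchMean (Finset.univ : Finset (Fin n)).val fun i => g i z := by
  rw [batchMean_univ, finiteMean]

theorem hasFDerivAt_finiteMean (hg : ∀ i, Differentiable ℝ (g i)) (z : E d) :
    HasFDerivAt (finiteMean g) ((n : ℝ)⁻¹ • ∑ i, fderiv ℝ (g i) z) z :=
  (HasFDerivAt.fun_sum (u := Finset.univ) fun i _ => (hg i z).hasFDerivAt).const_smul (n : ℝ)⁻¹

theorem jacVec_finiteMean_eq_batchMean (hg : ∀ i, Differentiable ℝ (g i)) (z : E d) :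
    jacVec (finiteMean g) z
      = batchMean (Finset.univ : Finset (Fin n)).val fun i => jacVec (g i) z := by
  rw [batchMean_univ]
  ext q
  simp [jacVec, matVec_apply, jacobian, (hasFDerivAt_finiteMean hg z).fderiv]

end FiniteMean

/-! ### Second moments of averages of independent samples. -/

section IndependentSums

variable {Ω κ : Type*} [Fintype κ] {mΩ : MeasurableSpace Ω} {P : Measure Ω}

/-- The second moment of a sum of independent centred random vectors. -/
theorem lintegral_sum_sq_le {b : ℕ} {Y : Fin b → Ω → EuclideanSpace ℝ κ}
    (hint : ∀ i, Integrable (Y i) P) (h0 : ∀ i, ∫ ω, Y i ω ∂P = 0) (hind : iIndepFun Y P) {s : ℝ}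
    (hs : 0 ≤ s) (h2 : ∀ i, ∫⁻ ω, ‖Y i ω‖ₑ ^ 2 ∂P ≤ ENNReal.ofReal s) :
    ∫⁻ ω, ‖∑ i, Y i ω‖ₑ ^ 2 ∂P ≤ ENNReal.ofReal (b * s) := by
  have hint2 : ∀ i, Integrable (fun ω => ‖Y i ω‖ ^ 2) P := fun i => by
    refine ⟨(hint i).aestronglyMeasurable.norm.pow 2, ?_⟩
    rw [hasFiniteIntegral_iff_ofReal (.of_forall fun ω => sq_nonneg _)]
    simp_rw [← enorm_sq_eq_ofReal]
    exact (h2 i).trans_lt ENNReal.ofReal_lt_top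
  have hint2' : ∀ i, ∫ ω, ‖Y i ω‖ ^ 2 ∂P ≤ s := fun i => by
    have := h2 i
    rwa [lintegral_enorm_sq_eq (hint2 i), ENNReal.ofReal_le_ofReal_iff hs] at this
  have hco : ∀ i k, Integrable (fun ω => Y i ω k) P := fun i k =>
    (EuclideanSpace.proj k : EuclideanSpace ℝ κ →L[ℝ] ℝ).integrable_comp (hint i)
  have hco0 : ∀ i k, ∫ ω, Y i ω k ∂P = 0 := fun i k => by
    have := (EuclideanSpace.proj k : EuclideanSpace ℝ κ →L[ℝ] ℝ).integral_comp_comm (hint i)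
    rw [h0] at this
    exact this.trans (map_zero _)
  -- Inner products are expanded in coordinates, where independence of real variables makes the
  -- cross terms vanish.
  have hcind : ∀ i j, i ≠ j → ∀ k, IndepFun (fun ω => Y i ω k) (fun ω => Y j ω k) P :=
    fun i j hij k => (hind.indepFun hij).comp (φ := fun v : EuclideanSpace ℝ κ => v k)
      (ψ := fun v : EuclideanSpace ℝ κ => v k)
      (EuclideanSpace.proj k : EuclideanSpace ℝ κ →L[ℝ] ℝ).continuous.measurable
      (EuclideanSpace.proj k : EuclideanSpace ℝ κ →L[ℝ] ℝ).continuous.measurable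
  have hmul : ∀ i j, i ≠ j → ∀ k, Integrable (fun ω => Y j ω k * Y i ω k) P :=
    fun i j hij k => (hcind j i hij.symm k).integrable_mul (hco j k) (hco i k)
  have hin : ∀ i j, Integrable (fun ω => inner ℝ (Y i ω) (Y j ω)) P := fun i j => by
    by_cases hij : i = j
    · subst hij
      simpa only [real_inner_self_eq_norm_sq] using hint2 i
    · simp only [PiLp.inner_apply, RCLike.inner_apply, conj_trivial]
      exact integrable_finsetSum _ fun k _ => hmul i j hij k
  have hin0 : ∀ i j, ∫ ω, inner ℝ (Y i ω) (Y j ω) ∂P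
      = if i = j then ∫ ω, ‖Y i ω‖ ^ 2 ∂P else 0 := fun i j => by
    split_ifs with hij
    · subst hij
      simp only [real_inner_self_eq_norm_sq]
    · simp only [PiLp.inner_apply, RCLike.inner_apply, conj_trivial]
      rw [integral_finsetSum _ fun k _ => hmul i j hij k]
      refine Finset.sum_eq_zero fun k _ => ?_
      rw [(hcind j i (Ne.symm hij) k).integral_fun_mul_eq_mul_integral
        (hco j k).aestronglyMeasurable (hco i k).aestronglyMeasurable, hco0, zero_mul]
  have e : ∀ ω, ‖∑ i, Y i ω‖ ^ 2 = ∑ i, ∑ j, inner ℝ (Y i ω) (Y j ω) := fun ω => by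
    rw [← real_inner_self_eq_norm_sq, sum_inner]
    simp only [inner_sum]
  have hI : Integrable (fun ω => ‖∑ i, Y i ω‖ ^ 2) P := by
    simp only [e]
    exact integrable_finsetSum _ fun i _ => integrable_finsetSum _ fun j _ => hin i j
  rw [lintegral_enorm_sq_eq hI]
  refine ENNReal.ofReal_le_ofReal ?_
  simp only [e]
  rw [integral_finsetSum _ fun i _ => integrable_finsetSum _ fun j _ => hin i j]
  refine (Finset.sum_le_sum (g := fun _ => s) fun i _ => ?_).trans (by simp)
  rw [integral_finsetSum _ fun j _ => hin i j]
  simp only [hin0]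
  simpa using hint2' i

variable {Ξ : Type*} [MeasurableSpace Ξ] {μ : Measure Ξ}

/-- The mean square error of the average of independent samples. -/
theorem lintegral_sample_mean_sub_sq_le {b : ℕ} (hb : 1 ≤ b) {X : Fin b → Ω → Ξ}
    (hX : ∀ i, Measurable (X i)) (hlaw : ∀ i, P.map (X i) = μ) (hind : iIndepFun X P)
    [IsProbabilityMeasure μ] {φ : Ξ → EuclideanSpace ℝ κ} (hφ : Measurable φ)
    (hint : Integrable φ μ) {s : ℝ} (hs : 0 ≤ s)
    (h2 : ∫⁻ ξ, ‖φ ξ - ∫ ξ', φ ξ' ∂μ‖ₑ ^ 2 ∂μ ≤ ENNReal.ofReal s) :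
    ∫⁻ ω, ‖(b : ℝ)⁻¹ • ∑ i, φ (X i ω) - ∫ ξ, φ ξ ∂μ‖ₑ ^ 2 ∂P ≤ ENNReal.ofReal (s / b) := by
  set a := ∫ ξ, φ ξ ∂μ with ha
  have hb0 : (b : ℝ) ≠ 0 := by
    have : b ≠ 0 := by omega
    exact_mod_cast this
  have hbp : (0 : ℝ) < b := by positivity
  have hφa : Measurable fun ξ => φ ξ - a := hφ.sub_const a
  have hia : Integrable (fun ξ => φ ξ - a) μ := hint.sub (integrable_const a)
  have h := lintegral_sum_sq_le (P := P) (Y := fun i ω => φ (X i ω) - a) (s := s) ?_ ?_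
    (hind.comp (fun _ ξ => φ ξ - a) fun _ => hφa) hs ?_
  · have e : ∀ ω, ‖(b : ℝ)⁻¹ • ∑ i, φ (X i ω) - a‖ₑ ^ 2
        = ENNReal.ofReal ((b : ℝ)⁻¹ ^ 2) * ‖∑ i, (φ (X i ω) - a)‖ₑ ^ 2 := by
      intro ω
      have e1 : (b : ℝ)⁻¹ • ∑ i, φ (X i ω) - a = (b : ℝ)⁻¹ • ∑ i, (φ (X i ω) - a) := by
        rw [Finset.sum_sub_distrib, Finset.sum_const, Finset.card_univ, Fintype.card_fin,
          ← Nat.cast_smul_eq_nsmul ℝ, smul_sub, inv_smul_smul₀ hb0]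
      rw [e1, enorm_smul, mul_pow, enorm_sq_eq_ofReal, Real.norm_eq_abs, sq_abs]
    simp only [e]
    rw [lintegral_const_mul' _ _ ENNReal.ofReal_ne_top]
    refine (mul_le_mul_right h _).trans_eq ?_
    rw [← ENNReal.ofReal_mul (by positivity)]
    congr 1
    field_simp
  · intro i
    rw [← hlaw i] at hia
    exact hia.comp_measurable (hX i)
  · intro i
    have h1 : ∫ ω, (φ (X i ω) - a) ∂P = ∫ ξ, (φ ξ - a) ∂(P.map (X i)) :=
      (integral_map (hX i).aemeasurable hφa.aestronglyMeasurable).symm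
    rw [h1, hlaw, integral_sub hint (integrable_const a)]
    simp [ha]
  · intro i
    have h1 : ∫⁻ ω, ‖φ (X i ω) - a‖ₑ ^ 2 ∂P = ∫⁻ ξ, ‖φ ξ - a‖ₑ ^ 2 ∂(P.map (X i)) :=
      (lintegral_map (continuous_enorm_sq.measurable.comp hφa) (hX i)).symm
    rw [h1, hlaw]
    exact h2

theorem lintegral_sub_mean_sq_le [IsProbabilityMeasure μ] {φ : Ξ → EuclideanSpace ℝ κ}
    (hφ : Measurable φ) {K : ℝ} (hK : ∀ ξ, ‖φ ξ‖ ≤ K) :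
    ∫⁻ ξ, ‖φ ξ - ∫ ξ', φ ξ' ∂μ‖ₑ ^ 2 ∂μ ≤ ENNReal.ofReal (K ^ 2) := by
  have hint : Integrable φ μ := .of_bound hφ.aestronglyMeasurable K (.of_forall hK)
  have hint2 : Integrable (fun ξ => ‖φ ξ‖ ^ 2) μ :=
    .of_bound (hφ.norm.pow_const 2).aestronglyMeasurable (K ^ 2) (.of_forall fun ω => by
      rw [Real.norm_of_nonneg (sq_nonneg _)]
      exact pow_le_pow_left₀ (norm_nonneg _) (hK ω) 2)
  set a := ∫ ξ, φ ξ ∂μ with ha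
  have hin : Integrable (fun ξ => 2 * inner ℝ a (φ ξ)) μ := (hint.const_inner a).const_mul 2
  have he : ∀ ξ, ‖φ ξ - a‖ ^ 2 = ‖φ ξ‖ ^ 2 - 2 * inner ℝ a (φ ξ) + ‖a‖ ^ 2 := fun ξ => by
    rw [norm_sub_sq_real, real_inner_comm]
  have hI : Integrable (fun ξ => ‖φ ξ - a‖ ^ 2) μ := by
    simp only [he]
    exact (hint2.sub hin).add (integrable_const _)
  rw [lintegral_enorm_sq_eq hI]
  refine ENNReal.ofReal_le_ofReal ?_
  simp only [he]
  have hsub : Integrable (fun ξ => ‖φ ξ‖ ^ 2 - 2 * inner ℝ a (φ ξ)) μ := hint2.sub hin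
  rw [integral_add hsub (integrable_const _), integral_sub hint2 hin,
    integral_const_mul, integral_inner hint, ← ha, real_inner_self_eq_norm_sq]
  have h1 : ∫ ξ, ‖φ ξ‖ ^ 2 ∂μ ≤ K ^ 2 := by
    refine (integral_mono hint2 (integrable_const (K ^ 2)) fun ξ =>
      pow_le_pow_left₀ (norm_nonneg _) (hK ξ) 2).trans_eq ?_
    simp
  simp only [integral_const, probReal_univ, one_smul]
  nlinarith [sq_nonneg ‖a‖]

end IndependentSums

/-! ### Measurability and differentiation of the mean map. -/

section OnlineMean

variable {Ξ : Type*} [MeasurableSpace Ξ] {μ : Measure Ξ} {d p : ℕ} {g : Ξ → E d → E p}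

/-- A pointwise limit of measurable difference quotients; the term `k = 0` is `0` and harmless. -/
theorem measurable_fderiv_apply (hm : ∀ x, Measurable fun ξ => g ξ x)
    (hg : ∀ ξ, Differentiable ℝ (g ξ)) (x w : E d) :
    Measurable fun ξ => fderiv ℝ (g ξ) x w := by
  refine measurable_of_tendsto_metrizable
    (f := fun (k : ℕ) ξ => (k : ℝ) • (g ξ (x + (k : ℝ)⁻¹ • w) - g ξ x))
    (fun k => ((hm (x + (k : ℝ)⁻¹ • w)).sub (hm x)).const_smul (k : ℝ)) (tendsto_pi_nhds.2 fun ξ => ?_)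
  refine (hg ξ x).hasFDerivAt.lim w ?_
  simpa using tendsto_natCast_atTop_atTop (R := ℝ)

theorem measurable_fderiv_family (hm : ∀ x, Measurable fun ξ => g ξ x)
    (hg : ∀ ξ, Differentiable ℝ (g ξ)) (x : E d) :
    StronglyMeasurable fun ξ => fderiv ℝ (g ξ) x := by
  have e : (fun ξ => fderiv ℝ (g ξ) x) = fun ξ => ∑ j, (EuclideanSpace.proj j :
      E d →L[ℝ] ℝ).smulRight (fderiv ℝ (g ξ) x (EuclideanSpace.single j 1)) := by
    funext ξ
    ext w i
    have hw : w = ∑ j, w j • EuclideanSpace.single j (1 : ℝ) := by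
      ext i
      simp [Finset.sum_apply, Pi.single_apply]
    conv_lhs => rw [hw, map_sum]
    simp
  rw [e]
  refine Finset.stronglyMeasurable_fun_sum _ fun j _ => ?_
  have hc : Continuous fun u : E p => (EuclideanSpace.proj j :
      E d →L[ℝ] ℝ).smulRight u :=
    (ContinuousLinearMap.smulRightL ℝ (E d) (E p) (EuclideanSpace.proj j)).continuous
  exact hc.comp_stronglyMeasurable (measurable_fderiv_apply hm hg x _).stronglyMeasurable

theorem measurable_jacVec (hm : ∀ x, Measurable fun ξ => g ξ x)
    (hg : ∀ ξ, Differentiable ℝ (g ξ)) (x : E d) : Measurable fun ξ => jacVec (g ξ) x := by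
  have hc : Continuous fun u : Fin d → E p =>
      (WithLp.toLp 2 fun q => u q.2 q.1 : EuclideanSpace ℝ (Fin p × Fin d)) := by fun_prop
  exact hc.measurable.comp (measurable_pi_lambda (fun ξ j =>
    fderiv ℝ (g ξ) x (EuclideanSpace.single j 1)) fun j => measurable_fderiv_apply hm hg x _)

variable [IsProbabilityMeasure μ] {l : NNReal}

/-- Differentiation under the integral sign, dominated by the common Lipschitz constant. -/
theorem hasFDerivAt_onlineMean (hm : ∀ x, Measurable fun ξ => g ξ x)
    (hi : ∀ x, Integrable (fun ξ => g ξ x) μ) (hg : ∀ ξ, Differentiable ℝ (g ξ))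
    (hl : ∀ ξ, LipschitzWith l (g ξ)) (x : E d) :
    Integrable (fun ξ => fderiv ℝ (g ξ) x) μ ∧
      HasFDerivAt (onlineMean μ g) (∫ ξ, fderiv ℝ (g ξ) x ∂μ) x :=
  hasFDerivAt_integral_of_dominated_loc_of_lip (F := fun x ξ => g ξ x) (s := Set.univ)
    (bound := fun _ => (l : ℝ)) Filter.univ_mem
    (.of_forall fun x => (hm x).aestronglyMeasurable) (hi x)
    (measurable_fderiv_family hm hg x).aestronglyMeasurable
    (.of_forall fun ξ => by simpa using hl ξ) (integrable_const _)
    (.of_forall fun ξ => (hg ξ x).hasFDerivAt)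

theorem integrable_jacVec (hm : ∀ x, Measurable fun ξ => g ξ x)
    (hg : ∀ ξ, Differentiable ℝ (g ξ)) (hl : ∀ ξ, LipschitzWith l (g ξ)) (x : E d) :
    Integrable (fun ξ => jacVec (g ξ) x) μ :=
  .of_bound (measurable_jacVec hm hg x).aestronglyMeasurable _
    (.of_forall fun ξ => norm_jacVec_le (hl ξ) x)

theorem jacVec_onlineMean (hm : ∀ x, Measurable fun ξ => g ξ x)
    (hi : ∀ x, Integrable (fun ξ => g ξ x) μ) (hg : ∀ ξ, Differentiable ℝ (g ξ))
    (hl : ∀ ξ, LipschitzWith l (g ξ)) (x : E d) :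
    jacVec (onlineMean μ g) x = ∫ ξ, jacVec (g ξ) x ∂μ := by
  obtain ⟨h1, h2⟩ := hasFDerivAt_onlineMean hm hi hg hl x
  ext q
  have h3 := (EuclideanSpace.proj q : EuclideanSpace ℝ (Fin p × Fin d) →L[ℝ] ℝ).integral_comp_comm
    (integrable_jacVec (μ := μ) hm hg hl x)
  have h4 := (EuclideanSpace.proj q.1 : E p →L[ℝ] ℝ).integral_comp_comm
    (h1.apply_continuousLinearMap (EuclideanSpace.single q.2 1))
  refine Eq.trans ?_ h3
  rw [jacVec, matVec_apply, jacobian, Matrix.of_apply, h2.fderiv,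
    ContinuousLinearMap.integral_apply h1]
  exact h4.symm

theorem lipschitzWith_integral {κ : Type*} [Fintype κ] {h : Ξ → E d → EuclideanSpace ℝ κ}
    (hi : ∀ x, Integrable (fun ξ => h ξ x) μ) (hl : ∀ ξ, LipschitzWith l (h ξ)) :
    LipschitzWith l fun x => ∫ ξ, h ξ x ∂μ := by
  refine LipschitzWith.of_dist_le_mul fun x y => ?_
  rw [dist_eq_norm, ← integral_sub (hi x) (hi y)]
  refine (norm_integral_le_of_norm_le_const (C := l * dist x y) (.of_forall fun ξ => ?_)).trans_eq
    (by simp)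
  rw [← dist_eq_norm]
  exact (hl ξ).dist_le_mul x y

end OnlineMean

/-! ### Online sampling. -/

section Online

theorem batchMean_onlineBatch {Ω Ξ V : Type*} [AddCommGroup V] [Module ℝ V] {m : ℕ → ℕ}
    (ξ : (t : ℕ) → Fin (m t) → Ω → Ξ) (ω : Ω) (t : ℕ) (φ : Ξ → V) :
    batchMean (onlineBatch ξ ω t) φ = (m t : ℝ)⁻¹ • ∑ i, φ (ξ t i ω) := by
  rw [batchMean, onlineBatch, Multiset.card_map, Multiset.map_map, Finset.card_val,
    Finset.card_univ, Fintype.card_fin]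
  rfl

variable {Ω : Type*} [mΩ : MeasurableSpace Ω] {P : Measure Ω} {Ξ : Type*} [MeasurableSpace Ξ]
  {μ : Measure Ξ} {m : ℕ → ℕ} {T : ℕ} {ξ : (t : ℕ) → Fin (m t) → Ω → Ξ} {ζ : Ω → Fin T}

theorem OnlineSampling.independentBatches (H : OnlineSampling P μ m T ξ ζ) :
    IndependentBatches P (fun t => ⨆ i, MeasurableSpace.comap (ξ t i) inferInstance) T ζ where
  le t ht := iSup_le fun i => (H.measurable t ht i).comap_le
  indep t ht := by
    refine indep_past (T := T) (π := fun q : (t : Fin T) × Fin (m t) => (q.1 : ℕ))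
      (fun q => (H.measurable q.1 q.1.2 q.2).comap_le) H.indep.iIndep ?_ ht
    intro t ht
    exact iSup_le fun i => le_iSup₂_of_le (⟨⟨t, ht⟩, i⟩ : (t : Fin T) × Fin (m t)) rfl le_rfl
  output_measurable := H.output_measurable
  output_uniform := H.output_uniform
  output_indep := by
    have h := (IndepFun_iff_Indep _ _ _).1 H.output_indep
    refine indep_of_indep_of_le_left h.symm (iSup₂_le fun s hs => iSup_le fun i => ?_)
    have e : ξ s i = (fun q : (t : Fin T) × Fin (m t) → Ξ => q ⟨⟨s, hs⟩, i⟩)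
        ∘ fun ω (q : (t : Fin T) × Fin (m t)) => ξ q.1 q.2 ω := rfl
    rw [e, ← MeasurableSpace.comap_comp]
    exact MeasurableSpace.comap_mono (measurable_pi_apply _).comap_le

/-- Refreshes average `B` samples of variance at most `s`. For the recursive batches the variance of
a difference is at most its second moment l²‖z - z'‖², divided by the batch size `τ`. -/
theorem OnlineSampling.unbiasedBatches [IsProbabilityMeasure μ]
    (H : OnlineSampling P μ m T ξ ζ) {τ : ℕ} (hτ : 1 ≤ τ) {d : ℕ} {κ : Type*} [Fintype κ]
    {h : Ξ → E d → EuclideanSpace ℝ κ} {l : NNReal} (hl : ∀ x, LipschitzWith l (h x))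
    (hm : ∀ z, Measurable fun x => h x z) (hi : ∀ z, Integrable (fun x => h x z) μ)
    {hbar : E d → EuclideanSpace ℝ κ} (hbar_eq : ∀ z, hbar z = ∫ x, h x z ∂μ) {s : ℝ}
    (hs : 0 ≤ s) (hvar : ∀ z, ∫⁻ x, ‖h x z - hbar z‖ₑ ^ 2 ∂μ ≤ ENNReal.ofReal s) {B : ℕ}
    (hB : 1 ≤ B) (hmB : ∀ t, t % τ = 0 → m t = B) (hmτ : ∀ t, t % τ ≠ 0 → m t = τ) :
    UnbiasedBatches P (fun t => ⨆ i, MeasurableSpace.comap (ξ t i) inferInstance)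
      (fun t ω => onlineBatch ξ ω t) T τ h hbar l (s / B) where
  nonneg := by positivity
  lipschitz := hl
  lipschitz_mean := by
    rw [funext hbar_eq]
    exact lipschitzWith_integral hi hl
  measurable t _ z := by
    simp only [batchMean_onlineBatch]
    refine (Finset.measurable_fun_sum (f := fun i ω => h (ξ t i ω) z) Finset.univ
      fun i _ => ?_).const_smul (m t : ℝ)⁻¹
    exact ((hm z).comp (comap_measurable (ξ t i))).mono
      (le_iSup (fun i => MeasurableSpace.comap (ξ t i) inferInstance) i) le_rfl
  fresh t ht h0 z := by
    simp only [batchMean_onlineBatch]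
    rw [hbar_eq, ← hmB t h0]
    refine lintegral_sample_mean_sub_sq_le (by rw [hmB t h0]; exact hB) (H.measurable t ht)
      (H.law t ht) ?_ (hm z) (hi z) hs (by rw [← hbar_eq]; exact hvar z)
    exact H.indep.precomp (g := fun i : Fin (m t) => (⟨⟨t, ht⟩, i⟩ : (t : Fin T) × Fin (m t)))
      (fun i j hij => by simpa using hij)
  unbiased t ht h0 z z' := by
    simp only [batchMean_onlineBatch]
    have hφ : Measurable fun x => h x z - h x z' := (hm z).sub (hm z')
    have hφi : Integrable (fun x => h x z - h x z') μ := (hi z).sub (hi z')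
    have h1 : ∀ i, ∫ ω, (h (ξ t i ω) z - h (ξ t i ω) z') ∂P = hbar z - hbar z' := fun i => by
      have := integral_map (μ := P) (H.measurable t ht i).aemeasurable hφ.aestronglyMeasurable
      rw [← this, H.law t ht, integral_sub (hi z) (hi z'), hbar_eq, hbar_eq]
    have h2 : ∀ i, Integrable (fun ω => h (ξ t i ω) z - h (ξ t i ω) z') P := fun i => by
      rw [← H.law t ht i] at hφi
      exact hφi.comp_measurable (H.measurable t ht i)
    have hmt : (m t : ℝ) ≠ 0 := by
      have : m t ≠ 0 := by rw [hmτ t h0]; omega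
      exact_mod_cast this
    rw [integral_smul, integral_finsetSum _ fun i _ => h2 i, Finset.sum_congr rfl fun i _ => h1 i,
      Finset.sum_const, Finset.card_univ, Fintype.card_fin, ← Nat.cast_smul_eq_nsmul ℝ,
      inv_smul_smul₀ hmt]
  variance t ht h0 z z' := by
    simp only [batchMean_onlineBatch]
    have hφ : Measurable fun x => h x z - h x z' := (hm z).sub (hm z')
    have hφi : Integrable (fun x => h x z - h x z') μ := (hi z).sub (hi z')
    have e : hbar z - hbar z' = ∫ x, (h x z - h x z') ∂μ := by
      rw [integral_sub (hi z) (hi z'), hbar_eq, hbar_eq]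
    rw [e, ← hmτ t h0]
    have hb : ∀ x, ‖h x z - h x z'‖ ≤ l * ‖z - z'‖ := fun x => by
      rw [← dist_eq_norm, ← dist_eq_norm]
      exact (hl x).dist_le_mul z z'
    have := lintegral_sample_mean_sub_sq_le (by rw [hmτ t h0]; exact hτ) (H.measurable t ht)
      (H.law t ht) (H.indep.precomp
        (g := fun i : Fin (m t) => (⟨⟨t, ht⟩, i⟩ : (t : Fin T) × Fin (m t))) (fun i j hij => by simpa using hij))
      hφ hφi (sq_nonneg _) (lintegral_sub_mean_sq_le (μ := μ) hφ hb)
    refine this.trans_eq ?_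
    congr 1
    rw [mul_pow]
    ring

end Online

/-! ### Counting evaluations. -/

section Complexity

/-- Integrating 2εX ≤ X² + ε² takes the place of Jensen's inequality. -/
theorem integral_le_of_integral_sq_le {Ω : Type*} [MeasurableSpace Ω] {P : Measure Ω}
    [IsProbabilityMeasure P] {X : Ω → ℝ} (h1 : Integrable X P)
    (h2 : Integrable (fun ω => X ω ^ 2) P) {ε : ℝ} (hε : 0 < ε)
    (h : ∫ ω, X ω ^ 2 ∂P ≤ ε ^ 2) : ∫ ω, X ω ∂P ≤ ε := by
  have h3 : ∫ ω, 2 * ε * X ω ∂P ≤ ∫ ω, (X ω ^ 2 + ε ^ 2) ∂P :=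
    integral_mono (h1.const_mul _) (h2.add (integrable_const _)) fun ω => by
      simp only
      nlinarith [sq_nonneg (X ω - ε)]
  rw [integral_const_mul, integral_add h2 (integrable_const _)] at h3
  simp only [integral_const, probReal_univ, one_smul] at h3
  nlinarith

theorem card_multiples_eq {τ : ℕ} (hτ : 0 < τ) (T : ℕ) :
    ∑ t ∈ Finset.range T, (if t % τ = 0 then 1 else 0) = (T + τ - 1) / τ := by
  induction T with
  | zero => simp [Nat.div_eq_of_lt (Nat.sub_lt hτ one_pos)]
  | succ T ih =>
    rw [Finset.sum_range_succ, ih]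
    have e : T + 1 + τ - 1 = (T + τ - 1) + 1 := by omega
    rw [e, Nat.succ_div]
    have e2 : T + τ - 1 + 1 = T + τ := by omega
    simp only [e2, Nat.dvd_iff_mod_eq_zero, Nat.add_mod_right]

theorem sum_evals_le {τ T : ℕ} (hτ : 0 < τ) (hT : 1 ≤ T) {a : ℕ → ℕ} {B b : ℕ}
    (ha : ∀ t < T, a t = if t % τ = 0 then B else b) :
    ((∑ t ∈ Finset.range T, if t % τ = 0 then 2 * a t else 4 * a t : ℕ) : ℝ)
      ≤ 2 * B * (1 + (T - 1) / τ) + 4 * b * T := by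
  have hτ' : (0 : ℝ) < τ := by exact_mod_cast hτ
  have h1 : (∑ t ∈ Finset.range T, if t % τ = 0 then 2 * a t else 4 * a t)
      ≤ ∑ t ∈ Finset.range T, (2 * B * (if t % τ = 0 then 1 else 0) + 4 * b) := by
    refine Finset.sum_le_sum fun t ht => ?_
    rw [ha t (Finset.mem_range.1 ht)]
    split_ifs <;> simp
  -- Number of refreshes, ⌈T/τ⌉. Writing it with `T - 1` lets the rounding up of `T` disappear
  -- later.
  have h2 : (((T + τ - 1) / τ : ℕ) : ℝ) ≤ 1 + (T - 1) / τ := by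
    refine Nat.cast_div_le.trans (le_of_eq ?_)
    rw [Nat.cast_sub (by omega)]
    push_cast
    field_simp
    ring
  calc ((∑ t ∈ Finset.range T, if t % τ = 0 then 2 * a t else 4 * a t : ℕ) : ℝ)
      ≤ ((∑ t ∈ Finset.range T, (2 * B * (if t % τ = 0 then 1 else 0) + 4 * b) : ℕ) : ℝ) := by
        exact_mod_cast h1
    _ = 2 * B * (((T + τ - 1) / τ : ℕ) : ℝ) + 4 * b * T := by
        rw [Finset.sum_add_distrib, ← Finset.mul_sum, card_multiples_eq hτ]
        push_cast
        simp
        ring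
    _ ≤ _ := by gcongr

theorem half_le_floor {s : ℝ} (hs : 1 ≤ s) : s / 2 ≤ (⌊s⌋₊ : ℝ) := by
  have h1 := Nat.lt_floor_add_one s
  have h2 : (1 : ℝ) ≤ ⌊s⌋₊ := by
    have : 1 ≤ ⌊s⌋₊ := Nat.le_floor (by simpa using hs)
    exact_mod_cast this
  linarith

/-- If full batches have size at most `2 s ^ 2` and both the epochs and the other batches have
size about `s`, then `T` iterations take `O(s ^ 2 + s T)` evaluations. -/
theorem sum_evals_le_of_le {τ T B : ℕ} {s : ℝ} (hs : 1 ≤ s) (hT : 1 ≤ T) (h1 : s / 2 ≤ τ)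
    (h2 : (τ : ℝ) ≤ s) (hB : (B : ℝ) ≤ 2 * s ^ 2) {a : ℕ → ℕ}
    (ha : ∀ t < T, a t = if t % τ = 0 then B else τ) :
    ((∑ t ∈ Finset.range T, if t % τ = 0 then 2 * a t else 4 * a t : ℕ) : ℝ)
      ≤ 8 * s ^ 2 + 12 * (s * (T - 1)) := by
  have hτ' : (0 : ℝ) < τ := by linarith
  have hτ : 0 < τ := by exact_mod_cast hτ'
  have hT' : (0 : ℝ) ≤ (T : ℝ) - 1 := by
    have : (1 : ℝ) ≤ T := by exact_mod_cast hT
    linarith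
  refine (sum_evals_le hτ hT ha).trans ?_
  have h3 : ((T : ℝ) - 1) / τ ≤ 2 * (T - 1) / s := by
    rw [div_le_div_iff₀ hτ' (by linarith)]
    nlinarith
  have h4 : 2 * (B : ℝ) * (1 + (T - 1) / τ) ≤ 2 * (2 * s ^ 2) * (1 + 2 * (T - 1) / s) := by
    have : 0 ≤ ((T : ℝ) - 1) / τ := div_nonneg hT' hτ'.le
    gcongr
  have h5 : 2 * (2 * s ^ 2) * (1 + 2 * (T - 1) / s) = 4 * s ^ 2 + 8 * (s * (T - 1)) := by
    field_simp
    ring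
  -- Here 4sT = 4s(T - 1) + 4s, and 4s ≤ 4s² because `1 ≤ s`.
  have h6 : 4 * (τ : ℝ) * T ≤ 4 * s * T := by gcongr
  nlinarith

end Complexity

/-! ### Rate and complexity of the finite-sum problem. -/

section FiniteSum

variable {d p n : ℕ} {f : E p → ℝ} {g : Fin n → E d → E p} {r : E d → ℝ}
  {lf Lf lg Lg : NNReal} {α β : ℝ} {lam : ℕ → ℝ}

theorem finiteSum_rate (hn : 1 ≤ n)
    (H : SmoothnessAssumption f g (finiteMean g) r lf Lf lg Lg)
    (hM : ConstantMomentum (constLF lf Lf lg Lg) (constG0 lf Lf lg Lg) α β lam) (x0 : E d)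
    {T : ℕ} (hT : 1 ≤ T) {Ω : Type*} [MeasurableSpace Ω] {P : Measure Ω} [IsProbabilityMeasure P]
    {A : ℕ → Ω → Finset (Fin n)} {ζ : Ω → Fin T} (hA : FiniteSumSampling P n T A ζ)
    {z : ℕ → Ω → E d} (hz : ∀ t ω, z t ω = zIter f g r (Nat.sqrt n) (fun _ => α) (fun _ => β)
      lam x0 (finiteBatch A ω) t) :
    Integrable (fun ω =>
      ‖gradMapping (lam (ζ ω)) r (smoothPart f (finiteMean g)) (z (ζ ω) ω)‖) P ∧
    Integrable (fun ω =>
      ‖gradMapping (lam (ζ ω)) r (smoothPart f (finiteMean g)) (z (ζ ω) ω)‖ ^ 2) P ∧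
    ∫ ω, ‖gradMapping (lam (ζ ω)) r (smoothPart f (finiteMean g)) (z (ζ ω) ω)‖ ^ 2 ∂P
      ≤ 112 * ((objective f (finiteMean g) r x0 - ⨅ w, objective f (finiteMean g) r w)
        / (T * β)) := by
  have := convergence_rate H (fun x => (hasFDerivAt_finiteMean H.g_diff x).differentiableAt) hM
    (Nat.sqrt_pos.2 hn) hT hA.independentBatches
    (hA.unbiasedBatches hn H.g_lipschitz (finiteMean_eq_batchMean g))
    (hA.unbiasedBatches hn H.lipschitzWith_jacVec (jacVec_finiteMean_eq_batchMean H.g_diff)) x0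
    (c := 0) (by simp) hz
  simpa using this

theorem finiteSum_complexity (hn : 1 ≤ n)
    (H : SmoothnessAssumption f g (finiteMean g) r lf Lf lg Lg)
    (hM : ConstantMomentum (constLF lf Lf lg Lg) (constG0 lf Lf lg Lg) α β lam) (x0 : E d)
    {Δ : ℝ} (hΔ : Δ = objective f (finiteMean g) r x0 - ⨅ w, objective f (finiteMean g) r w)
    {ε : ℝ} (hε : 0 < ε) :
    ∃ T : ℕ, 1 ≤ T ∧ ∀ (Ω : Type*) [MeasurableSpace Ω] (P : Measure Ω) [IsProbabilityMeasure P]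
      (A : ℕ → Ω → Finset (Fin n)) (ζ : Ω → Fin T), FiniteSumSampling P n T A ζ →
      ∀ (S : ℕ → Ω → State d p) (z : ℕ → Ω → E d),
      (∀ t ω, S t ω = iterate f g r (Nat.sqrt n) (fun _ => α) (fun _ => β) lam x0
        (finiteBatch A ω) t) →
      (∀ t ω, z t ω = zIter f g r (Nat.sqrt n) (fun _ => α) (fun _ => β) lam x0
        (finiteBatch A ω) t) →
      Integrable (fun ω =>
        ‖gradMapping (lam (ζ ω)) r (smoothPart f (finiteMean g)) (z (ζ ω) ω)‖) P ∧
      ∫ ω, ‖gradMapping (lam (ζ ω)) r (smoothPart f (finiteMean g)) (z (ζ ω) ω)‖ ∂P ≤ ε ∧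
      ∀ᵐ ω ∂P, ((S T ω).evals : ℝ) ≤ 8 * n + 1344 * (Δ / β * (√n / ε ^ 2)) := by
  have hβ := hM.β_pos
  have hΔ0 : 0 ≤ Δ := by
    rw [hΔ]
    exact sub_nonneg.2 (ciInf_le H.bddBelow x0)
  -- `T = T0 + 1` exceeds the number of iterations that the rate demands, while `T - 1 = T0` does
  -- not. The count 12·√n·(T - 1) then gives 12 · 112 = 1344 without a rounding term.
  set T0 := ⌊112 * Δ / (β * ε ^ 2)⌋₊ with hT0
  refine ⟨T0 + 1, Nat.le_add_left _ _, ?_⟩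
  intro Ω _ P _ A ζ hA S z hS hz
  obtain ⟨h1, h2, h3⟩ := finiteSum_rate hn H hM x0 (Nat.le_add_left _ _) hA hz
  have hT1 : 112 * Δ / (β * ε ^ 2) < T0 + 1 := Nat.lt_floor_add_one _
  have hT2 : (T0 : ℝ) ≤ 112 * Δ / (β * ε ^ 2) := Nat.floor_le (by positivity)
  refine ⟨h1, integral_le_of_integral_sq_le h1 h2 hε (h3.trans ?_), ?_⟩
  · rw [← hΔ]
    push_cast
    rw [div_lt_iff₀ (by positivity)] at hT1
    rw [← mul_div_assoc, div_le_iff₀ (by positivity)]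
    linarith
  · filter_upwards [hA.ae_card] with ω hω
    rw [hS, evals_iterate]
    have hn' : (1 : ℝ) ≤ n := by exact_mod_cast hn
    have hs : 1 ≤ √(n : ℝ) := Real.one_le_sqrt.2 hn'
    have hsq : √(n : ℝ) ^ 2 = n := Real.sq_sqrt (by positivity)
    refine (sum_evals_le_of_le (B := n) hs (Nat.le_add_left _ _) ?_ Real.nat_sqrt_le_real_sqrt
      (by rw [hsq]; linarith) ?_).trans ?_
    · rw [← Real.nat_floor_real_sqrt_eq_nat_sqrt]
      exact half_le_floor hs
    · intro t ht
      split_ifs with h0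
      · simp [finiteBatch, hA.full t ht h0]
      · simpa [finiteBatch] using hω t ht h0
    · rw [hsq]
      push_cast
      rw [add_sub_cancel_right]
      have h4 : √(n : ℝ) * T0 ≤ √n * (112 * Δ / (β * ε ^ 2)) := by gcongr
      have h5 : √(n : ℝ) * (112 * Δ / (β * ε ^ 2)) = 112 * (Δ / β * (√n / ε ^ 2)) := by
        field_simp
      linarith

end FiniteSum

/-! ### Rate and complexity of the online problem. -/

section Online

variable {d p : ℕ} {Ξ : Type*} [MeasurableSpace Ξ] {μ : Measure Ξ} [IsProbabilityMeasure μ]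
  {f : E p → ℝ} {g : Ξ → E d → E p} {r : E d → ℝ} {lf Lf lg Lg : NNReal} {sg sg' : ℝ}
  {α β : ℝ} {lam : ℕ → ℝ} {s0sq : ℝ}

theorem one_le_sqrt_div {ε : ℝ} (hε : 0 < ε) (h : ε ^ 2 ≤ 2 * s0sq) :
    1 ≤ √(2 * s0sq / ε ^ 2) :=
  Real.one_le_sqrt.2 ((one_le_div (by positivity)).2 h)

theorem one_le_onlineEpoch {ε : ℝ} (hε : 0 < ε) (h : ε ^ 2 ≤ 2 * s0sq) :
    1 ≤ onlineEpoch s0sq ε :=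
  Nat.le_floor (by simpa using one_le_sqrt_div hε h)

theorem online_rate (H : SmoothnessAssumption f g (onlineMean μ g) r lf Lf lg Lg)
    (hV : VarianceAssumption μ g sg sg')
    (hM : ConstantMomentum (constLF lf Lf lg Lg) (constG0 lf Lf lg Lg) α β lam) (x0 : E d)
    (hs0 : s0sq = sigmaSq lf Lf lg sg sg') {ε : ℝ} (hε : 0 < ε) (hεs : ε ^ 2 ≤ 2 * s0sq)
    {T : ℕ} (hT : 1 ≤ T) {Ω : Type*} [MeasurableSpace Ω] {P : Measure Ω} [IsProbabilityMeasure P]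
    {ξ : (t : ℕ) → Fin (onlineBatchSize s0sq ε t) → Ω → Ξ} {ζ : Ω → Fin T}
    (hξ : OnlineSampling P μ (onlineBatchSize s0sq ε) T ξ ζ) {z : ℕ → Ω → E d}
    (hz : ∀ t ω, z t ω = zIter f g r (onlineEpoch s0sq ε) (fun _ => α) (fun _ => β)
      lam x0 (onlineBatch ξ ω) t) :
    Integrable (fun ω =>
      ‖gradMapping (lam (ζ ω)) r (smoothPart f (onlineMean μ g)) (z (ζ ω) ω)‖) P ∧
    Integrable (fun ω =>
      ‖gradMapping (lam (ζ ω)) r (smoothPart f (onlineMean μ g)) (z (ζ ω) ω)‖ ^ 2) P ∧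
    ∫ ω, ‖gradMapping (lam (ζ ω)) r (smoothPart f (onlineMean μ g)) (z (ζ ω) ω)‖ ^ 2 ∂P
      ≤ 112 * ((objective f (onlineMean μ g) r x0 - ⨅ w, objective f (onlineMean μ g) r w)
        / (T * β)) + 114 * ε ^ 2 := by
  set B := ⌈2 * s0sq / ε ^ 2⌉₊ with hB
  have hs0' : 0 < s0sq := by have := pow_pos hε 2; linarith
  have hB1 : 1 ≤ B := Nat.one_le_ceil_iff.2 (by positivity)
  have hB0 : (0 : ℝ) < B := by exact_mod_cast hB1
  have hmB : ∀ t, t % onlineEpoch s0sq ε = 0 → onlineBatchSize s0sq ε t = B := fun t h =>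
    if_pos h
  have hmτ : ∀ t, t % onlineEpoch s0sq ε ≠ 0 →
      onlineBatchSize s0sq ε t = onlineEpoch s0sq ε := fun t h => if_neg h
  have hτ := one_le_onlineEpoch hε hεs
  have U1 := hξ.unbiasedBatches hτ H.g_lipschitz hV.measurable hV.integrable (fun _ => rfl)
    (sq_nonneg sg) hV.variance_g hB1 hmB hmτ
  have U2 := hξ.unbiasedBatches hτ H.lipschitzWith_jacVec (measurable_jacVec hV.measurable H.g_diff)
    (integrable_jacVec hV.measurable H.g_diff H.g_lipschitz)
    (jacVec_onlineMean hV.measurable hV.integrable H.g_diff H.g_lipschitz)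
    (sq_nonneg sg') hV.variance_jacVec hB1 hmB hmτ
  -- The left side is σ_0²/B; the batch size turns it into ε²/2, and 227/2 ≤ 114 in the final rate.
  have hc : 2 * (lf : ℝ) ^ 2 * (sg' ^ 2 / B) + 2 * (lg ^ 2 * Lf ^ 2) * (sg ^ 2 / B)
      ≤ ε ^ 2 / 2 := by
    have e : 2 * (lf : ℝ) ^ 2 * (sg' ^ 2 / B) + 2 * (lg ^ 2 * Lf ^ 2) * (sg ^ 2 / B)
        = s0sq / B := by
      rw [hs0, sigmaSq]
      ring
    rw [e, div_le_iff₀ hB0]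
    have := Nat.le_ceil (2 * s0sq / ε ^ 2)
    rw [← hB, div_le_iff₀ (by positivity)] at this
    linarith
  obtain ⟨h1, h2, h3⟩ := convergence_rate H
    (fun x => (hasFDerivAt_onlineMean hV.measurable hV.integrable H.g_diff H.g_lipschitz
      x).2.differentiableAt) hM hτ hT hξ.independentBatches U1 U2 x0 hc hz
  refine ⟨h1, h2, h3.trans ?_⟩
  nlinarith [sq_nonneg ε]

theorem online_complexity (H : SmoothnessAssumption f g (onlineMean μ g) r lf Lf lg Lg)
    (hV : VarianceAssumption μ g sg sg')
    (hM : ConstantMomentum (constLF lf Lf lg Lg) (constG0 lf Lf lg Lg) α β lam) (x0 : E d)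
    {Δ : ℝ} (hΔ : Δ = objective f (onlineMean μ g) r x0 - ⨅ w, objective f (onlineMean μ g) r w)
    (hs0 : s0sq = sigmaSq lf Lf lg sg sg') {ε : ℝ} (hε : 0 < ε) (hεs : ε ^ 2 ≤ 2 * s0sq) :
    ∃ (δ : ℝ) (T : ℕ), 0 < δ ∧ δ ≤ ε ∧ 1 ≤ T ∧
      ∀ (Ω : Type*) [MeasurableSpace Ω] (P : Measure Ω) [IsProbabilityMeasure P]
        (ξ : (t : ℕ) → Fin (onlineBatchSize s0sq δ t) → Ω → Ξ) (ζ : Ω → Fin T),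
      OnlineSampling P μ (onlineBatchSize s0sq δ) T ξ ζ →
      ∀ (S : ℕ → Ω → State d p) (z : ℕ → Ω → E d),
      (∀ t ω, S t ω = iterate f g r (onlineEpoch s0sq δ) (fun _ => α) (fun _ => β)
        lam x0 (onlineBatch ξ ω) t) →
      (∀ t ω, z t ω = zIter f g r (onlineEpoch s0sq δ) (fun _ => α) (fun _ => β)
        lam x0 (onlineBatch ξ ω) t) →
      Integrable (fun ω =>
        ‖gradMapping (lam (ζ ω)) r (smoothPart f (onlineMean μ g)) (z (ζ ω) ω)‖) P ∧
      ∫ ω, ‖gradMapping (lam (ζ ω)) r (smoothPart f (onlineMean μ g)) (z (ζ ω) ω)‖ ∂P ≤ ε ∧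
      ∀ ω, ((S T ω).evals : ℝ) ≤ 70000 * (√s0sq * (s0sq + Δ / β) / ε ^ 3) := by
  have hβ := hM.β_pos
  have hΔ0 : 0 ≤ Δ := by
    rw [hΔ]
    exact sub_nonneg.2 (ciInf_le H.bddBelow x0)
  have hs0' : 0 < s0sq := by have := pow_pos hε 2; linarith
  -- Each of the two terms of the rate receives ε²/2: 112/224 = 1/2 for the first, and 114/16² ≤ 1/2
  -- for the second with `δ = ε / 16`.
  set T0 := ⌊224 * Δ / (β * ε ^ 2)⌋₊ with hT0
  set δ := ε / 16 with hδ
  have hδ0 : 0 < δ := by positivity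
  have hδs : δ ^ 2 ≤ 2 * s0sq := by
    rw [hδ, div_pow]
    linarith [sq_nonneg ε]
  refine ⟨δ, T0 + 1, hδ0, by rw [hδ]; linarith, Nat.le_add_left _ _, ?_⟩
  intro Ω _ P _ ξ ζ hξ S z hS hz
  obtain ⟨h1, h2, h3⟩ := online_rate H hV hM x0 hs0 hδ0 hδs (Nat.le_add_left _ _) hξ hz
  have hT1 : 224 * Δ / (β * ε ^ 2) < T0 + 1 := Nat.lt_floor_add_one _
  have hT2 : (T0 : ℝ) ≤ 224 * Δ / (β * ε ^ 2) := Nat.floor_le (by positivity)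
  refine ⟨h1, integral_le_of_integral_sq_le h1 h2 hε (h3.trans ?_), fun ω => ?_⟩
  · rw [← hΔ]
    push_cast
    have h4 : 112 * (Δ / ((T0 + 1) * β)) ≤ ε ^ 2 / 2 := by
      rw [div_lt_iff₀ (by positivity)] at hT1
      rw [← mul_div_assoc, div_le_iff₀ (by positivity)]
      linarith
    have h5 : 114 * δ ^ 2 ≤ ε ^ 2 / 2 := by
      rw [hδ, div_pow]
      linarith [sq_nonneg ε]
    linarith
  · rw [hS, evals_iterate]
    have hs := one_le_sqrt_div hδ0 hδs
    set s := √(2 * s0sq / δ ^ 2) with hsdef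
    have hsq : s ^ 2 = 2 * s0sq / δ ^ 2 := Real.sq_sqrt (by positivity)
    refine (sum_evals_le_of_le (B := ⌈2 * s0sq / δ ^ 2⌉₊) hs (Nat.le_add_left _ _)
      (half_le_floor hs) (Nat.floor_le (by positivity)) ?_ ?_).trans ?_
    · rw [← hsq]
      have := (Nat.ceil_lt_add_one (sq_nonneg s)).le
      nlinarith
    · intro t _
      rw [onlineBatch, Multiset.card_map, Finset.card_val, Finset.card_univ, Fintype.card_fin]
      rfl
    · set σ := √s0sq with hσ
      have hσ0 : 0 < σ := Real.sqrt_pos.2 hs0'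
      have hσsq : σ ^ 2 = s0sq := Real.sq_sqrt hs0'.le
      -- From ε² ≤ 2σ² and (sε)² = 512σ² ≤ (24σ)², the two parts of the count are 8 · 864 and 12 ·
      -- 5376 = 64512, both below 70000.
      have hεσ : ε ≤ 3 / 2 * σ := by
        refine le_of_sq_le_sq ?_ (by positivity)
        rw [mul_pow, hσsq]
        linarith
      have hsσ : s * ε ≤ 24 * σ := by
        refine le_of_sq_le_sq ?_ (by positivity)
        rw [mul_pow, mul_pow, hsq, hσsq, hδ]
        have : 2 * s0sq / (ε / 16) ^ 2 * ε ^ 2 = 512 * s0sq := by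
          field_simp
          norm_num
        rw [this]
        linarith
      have h6 : s ^ 2 * ε ^ 3 ≤ 864 * (σ * s0sq) := by
        have a1 : (s * ε) ^ 2 ≤ (24 * σ) ^ 2 := pow_le_pow_left₀ (by positivity) hsσ 2
        calc s ^ 2 * ε ^ 3 = (s * ε) ^ 2 * ε := by ring
          _ ≤ (24 * σ) ^ 2 * (3 / 2 * σ) := by gcongr
          _ = 864 * (σ * s0sq) := by rw [← hσsq]; ring
      have h7 : s * T0 * ε ^ 3 ≤ 5376 * (σ * (Δ / β)) := by
        calc s * T0 * ε ^ 3 ≤ s * (224 * Δ / (β * ε ^ 2)) * ε ^ 3 := by gcongr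
          _ = s * ε * (224 * (Δ / β)) := by field_simp
          _ ≤ 24 * σ * (224 * (Δ / β)) := by gcongr
          _ = _ := by ring
      have h8 : 0 ≤ σ * s0sq := by positivity
      have h9 : 0 ≤ σ * (Δ / β) := by positivity
      rw [← mul_div_assoc, le_div_iff₀ (by positivity)]
      push_cast
      linarith

end Online

end MVRC

theorem theorem2 :
    ∃ C : ℝ, 0 < C ∧
    -- the finite-sum problem
    (∀ (d p n : ℕ), 1 ≤ n →
      ∀ (f : MVRC.E p → ℝ) (g : Fin n → MVRC.E d → MVRC.E p) (r : MVRC.E d → ℝ)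
        (lf Lf lg Lg : NNReal),
      MVRC.SmoothnessAssumption f g (MVRC.finiteMean g) r lf Lf lg Lg →
      ∀ (α β : ℝ) (lam : ℕ → ℝ),
      MVRC.ConstantMomentum (MVRC.constLF lf Lf lg Lg) (MVRC.constG0 lf Lf lg Lg) α β lam →
      ∀ (x0 : MVRC.E d) (F Φ : MVRC.E d → ℝ) (Δ : ℝ),
      F = MVRC.smoothPart f (MVRC.finiteMean g) →
      Φ = MVRC.objective f (MVRC.finiteMean g) r →
      Δ = Φ x0 - ⨅ x, Φ x →
      -- the convergence rate, for every number of iterations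
      (∀ T : ℕ, 1 ≤ T →
        ∀ (Ω : Type*) [MeasurableSpace Ω] (P : Measure Ω) [IsProbabilityMeasure P]
          (A : ℕ → Ω → Finset (Fin n)) (ζ : Ω → Fin T),
        MVRC.FiniteSumSampling P n T A ζ →
        ∀ z : ℕ → Ω → MVRC.E d,
        (∀ t ω, z t ω = MVRC.zIter f g r (Nat.sqrt n) (fun _ => α) (fun _ => β) lam x0
          (MVRC.finiteBatch A ω) t) →
        Integrable (fun ω => ‖MVRC.gradMapping (lam (ζ ω)) r F (z (ζ ω) ω)‖ ^ 2) P ∧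
        ∫ ω, ‖MVRC.gradMapping (lam (ζ ω)) r F (z (ζ ω) ω)‖ ^ 2 ∂P
          ≤ C * ((α⁻¹ + 1) / (T * β) * Δ)) ∧
      -- the sample complexity
      (∀ ε : ℝ, 0 < ε → ∃ T : ℕ, 1 ≤ T ∧
        ∀ (Ω : Type*) [MeasurableSpace Ω] (P : Measure Ω) [IsProbabilityMeasure P]
          (A : ℕ → Ω → Finset (Fin n)) (ζ : Ω → Fin T),
        MVRC.FiniteSumSampling P n T A ζ →
        ∀ (S : ℕ → Ω → MVRC.State d p) (z : ℕ → Ω → MVRC.E d),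
        (∀ t ω, S t ω = MVRC.iterate f g r (Nat.sqrt n) (fun _ => α) (fun _ => β) lam x0
          (MVRC.finiteBatch A ω) t) →
        (∀ t ω, z t ω = MVRC.zIter f g r (Nat.sqrt n) (fun _ => α) (fun _ => β) lam x0
          (MVRC.finiteBatch A ω) t) →
        Integrable (fun ω => ‖MVRC.gradMapping (lam (ζ ω)) r F (z (ζ ω) ω)‖) P ∧
        ∫ ω, ‖MVRC.gradMapping (lam (ζ ω)) r F (z (ζ ω) ω)‖ ∂P ≤ ε ∧
        ∀ᵐ ω ∂P, ((S T ω).evals : ℝ)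
          ≤ C * (n + (α⁻¹ + 1) * Δ / β * (√n / ε ^ 2)))) ∧
    -- the online problem
    (∀ (d p : ℕ) (Ξ : Type*) [MeasurableSpace Ξ] (μ : Measure Ξ) [IsProbabilityMeasure μ]
        (f : MVRC.E p → ℝ) (g : Ξ → MVRC.E d → MVRC.E p) (r : MVRC.E d → ℝ)
        (lf Lf lg Lg : NNReal) (sg sg' : ℝ),
      MVRC.SmoothnessAssumption f g (MVRC.onlineMean μ g) r lf Lf lg Lg →
      MVRC.VarianceAssumption μ g sg sg' →
      ∀ (α β : ℝ) (lam : ℕ → ℝ),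
      MVRC.ConstantMomentum (MVRC.constLF lf Lf lg Lg) (MVRC.constG0 lf Lf lg Lg) α β lam →
      ∀ (x0 : MVRC.E d) (F Φ : MVRC.E d → ℝ) (Δ s0sq : ℝ),
      F = MVRC.smoothPart f (MVRC.onlineMean μ g) →
      Φ = MVRC.objective f (MVRC.onlineMean μ g) r →
      Δ = Φ x0 - ⨅ x, Φ x →
      s0sq = MVRC.sigmaSq lf Lf lg sg sg' →
      -- the convergence rate, for every number of iterations
      (∀ ε : ℝ, 0 < ε → ε ^ 2 ≤ 2 * s0sq → ∀ T : ℕ, 1 ≤ T →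
        ∀ (Ω : Type*) [MeasurableSpace Ω] (P : Measure Ω) [IsProbabilityMeasure P]
          (ξ : (t : ℕ) → Fin (MVRC.onlineBatchSize s0sq ε t) → Ω → Ξ) (ζ : Ω → Fin T),
        MVRC.OnlineSampling P μ (MVRC.onlineBatchSize s0sq ε) T ξ ζ →
        ∀ z : ℕ → Ω → MVRC.E d,
        (∀ t ω, z t ω = MVRC.zIter f g r (MVRC.onlineEpoch s0sq ε) (fun _ => α) (fun _ => β)
          lam x0 (MVRC.onlineBatch ξ ω) t) →
        Integrable (fun ω => ‖MVRC.gradMapping (lam (ζ ω)) r F (z (ζ ω) ω)‖ ^ 2) P ∧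
        ∫ ω, ‖MVRC.gradMapping (lam (ζ ω)) r F (z (ζ ω) ω)‖ ^ 2 ∂P
          ≤ C * ((α⁻¹ + 1) * (ε ^ 2 + Δ / (T * β)))) ∧
      -- the sample complexity; the parameters are chosen with `δ` in place of `ε`
      (∀ ε : ℝ, 0 < ε → ε ^ 2 ≤ 2 * s0sq → ∃ (δ : ℝ) (T : ℕ), 0 < δ ∧ δ ≤ ε ∧ 1 ≤ T ∧
        ∀ (Ω : Type*) [MeasurableSpace Ω] (P : Measure Ω) [IsProbabilityMeasure P]
          (ξ : (t : ℕ) → Fin (MVRC.onlineBatchSize s0sq δ t) → Ω → Ξ) (ζ : Ω → Fin T),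
        MVRC.OnlineSampling P μ (MVRC.onlineBatchSize s0sq δ) T ξ ζ →
        ∀ (S : ℕ → Ω → MVRC.State d p) (z : ℕ → Ω → MVRC.E d),
        (∀ t ω, S t ω = MVRC.iterate f g r (MVRC.onlineEpoch s0sq δ) (fun _ => α) (fun _ => β)
          lam x0 (MVRC.onlineBatch ξ ω) t) →
        (∀ t ω, z t ω = MVRC.zIter f g r (MVRC.onlineEpoch s0sq δ) (fun _ => α) (fun _ => β)
          lam x0 (MVRC.onlineBatch ξ ω) t) →
        Integrable (fun ω => ‖MVRC.gradMapping (lam (ζ ω)) r F (z (ζ ω) ω)‖) P ∧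
        ∫ ω, ‖MVRC.gradMapping (lam (ζ ω)) r F (z (ζ ω) ω)‖ ∂P ≤ ε ∧
        ∀ᵐ ω ∂P, ((S T ω).evals : ℝ)
          ≤ C * ((α⁻¹ + 1) ^ (3 / 2 : ℝ) * √s0sq * (s0sq + Δ / β) / ε ^ 3))) := by
  -- The constant comes from the online count, the largest of the four. The rates and counts proved
  -- above carry no explicit α, so the remaining work is to insert factors that are at least 1.
  refine ⟨70000, by norm_num, ?_, ?_⟩
  · intro d p n hn f g r lf Lf lg Lg H α β lam hM x0 F Φ Δ hF hΦ hΔ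
    subst hF hΦ
    have hβ := hM.β_pos
    have hα : 1 ≤ α⁻¹ := (one_le_inv₀ hM.α_pos).2 hM.α_le_one
    have hΔ0 : 0 ≤ Δ := by
      rw [hΔ]
      exact sub_nonneg.2 (ciInf_le H.bddBelow x0)
    refine ⟨fun T hT Ω _ P _ A ζ hA z hz => ?_, fun ε hε => ?_⟩
    · obtain ⟨_, h2, h3⟩ := MVRC.finiteSum_rate hn H hM x0 hT hA hz
      refine ⟨h2, h3.trans ?_⟩
      rw [← hΔ, div_mul_eq_mul_div, mul_div_assoc]
      have hX : 0 ≤ Δ / (T * β) := by positivity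
      nlinarith [mul_nonneg (sub_nonneg.2 hα) hX]
    · obtain ⟨T, hT, h⟩ := MVRC.finiteSum_complexity hn H hM x0 hΔ hε
      refine ⟨T, hT, fun Ω _ P _ A ζ hA S z hS hz => ?_⟩
      obtain ⟨h1, h2, h3⟩ := h Ω P A ζ hA S z hS hz
      refine ⟨h1, h2, ?_⟩
      filter_upwards [h3] with ω hω
      refine hω.trans ?_
      have hX : 0 ≤ Δ / β * (√n / ε ^ 2) := by positivity
      have e : (α⁻¹ + 1) * Δ / β * (√n / ε ^ 2) = (α⁻¹ + 1) * (Δ / β * (√n / ε ^ 2)) := by ring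
      have hn' : (0 : ℝ) ≤ n := Nat.cast_nonneg n
      rw [e]
      nlinarith [mul_nonneg (sub_nonneg.2 hα) hX]
  · intro d p Ξ _ μ _ f g r lf Lf lg Lg sg sg' H hV α β lam hM x0 F Φ Δ s0sq hF hΦ hΔ hs0
    subst hF hΦ
    have hβ := hM.β_pos
    have hα : 1 ≤ α⁻¹ := (one_le_inv₀ hM.α_pos).2 hM.α_le_one
    have hΔ0 : 0 ≤ Δ := by
      rw [hΔ]
      exact sub_nonneg.2 (ciInf_le H.bddBelow x0)
    refine ⟨fun ε hε hεs T hT Ω _ P _ ξ ζ hξ z hz => ?_, fun ε hε hεs => ?_⟩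
    · obtain ⟨_, h2, h3⟩ := MVRC.online_rate H hV hM x0 hs0 hε hεs hT hξ hz
      refine ⟨h2, h3.trans ?_⟩
      rw [← hΔ]
      have hX : 0 ≤ Δ / (T * β) := by positivity
      nlinarith [mul_nonneg (sub_nonneg.2 hα) hX, mul_nonneg (sub_nonneg.2 hα) (sq_nonneg ε),
        sq_nonneg ε]
    · obtain ⟨δ, T, h1, h2, h3, h⟩ := MVRC.online_complexity H hV hM x0 hΔ hs0 hε hεs
      refine ⟨δ, T, h1, h2, h3, fun Ω _ P _ ξ ζ hξ S z hS hz => ?_⟩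
      obtain ⟨h4, h5, h6⟩ := h Ω P ξ ζ hξ S z hS hz
      refine ⟨h4, h5, .of_forall fun ω => (h6 ω).trans ?_⟩
      have hs0' : 0 < s0sq := by have := pow_pos hε 2; linarith
      have hX : 0 ≤ √s0sq * (s0sq + Δ / β) / ε ^ 3 := by positivity
      have hp : 1 ≤ (α⁻¹ + 1) ^ (3 / 2 : ℝ) :=
        Real.one_le_rpow (by linarith) (by norm_num)
      have e : (α⁻¹ + 1) ^ (3 / 2 : ℝ) * √s0sq * (s0sq + Δ / β) / ε ^ 3
          = (α⁻¹ + 1) ^ (3 / 2 : ℝ) * (√s0sq * (s0sq + Δ / β) / ε ^ 3) := by ring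
      rw [e]
      nlinarith [mul_nonneg (sub_nonneg.2 hp) hX]
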